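/- Let $F=\mathbb F_q$ be a finite field with $q$ elements, $E=\mathbb F_{q^2}$ its quadratic extension, $G=GL(2,F)$, and $PGL(2,F)=G/Z(G)$. All representations are complex and finite dimensional. For a representation $\pi$ of a finite group $H$ with character $\chi_\pi$, the Frobenius–Schur indicator is $\nu_2(\pi)=\frac1{|H|}\sum_{h\in H}\chi_\pi(h^2)$. Notation. Let $B\subset G$ be the group of upper triangular matrices, $N\subset B$ the group of unipotent ones, and $Z$ the centre of $G$. For characters $\mu,\mu_1,\mu_2:F^\times\to\mathbb C^\times$ put $\chi_\mu=\mu\circ\det$; let $I(\mu_1,\mu_2)=\mathrm{Ind}_B^G(\mu_1\otimes\mu_2)$, where $(\mu_1\otimes\mu_2)\begin{pmatrix}a&b\\0&d\end{pmatrix}=\mu_1(a)\mu_2(d)$; and let $St_\mu=I(\mu,\mu)/\chi_\mu$, $St=St_1$. A character $\nu:E^\times\to\mathbb C^\times$ is primitive if it is not of the form $\mu\circ N_{E/F}$. Fix an $F$-basis of $E$, which embeds $E^\times$ in $G$ by multiplication on $E$, and a nontrivial additive character $\psi$ of $F$. For $\nu$ primitive, $\mathcal C_\nu$ is the representation, unique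 up to isomorphism, such that $\mathrm{Ind}_{ZN}^G(\nu_\psi)\simeq\mathcal C_\nu\oplus\mathrm{Ind}_{E^\times}^G(\nu)$, where $\nu_\psi\left(a\begin{pmatrix}1&x\\0&1\end{pmatrix}\right)=\nu(a)\psi(x)$ for $a\in F^\times$, $x\in F$. For $q$ odd, $\epsilon$ is the quadratic character of $F^\times$ ($\epsilon(x)=1$ if $x$ is a square, $-1$ otherwise). 1. No irreducible representation $\pi$ of $G$ has $\nu_2(\pi)=-1$: one has $\nu_2(\pi)=1$ if $\chi_\pi$ is real-valued, and $\nu_2(\pi)=0$ otherwise. 2. The representations $\chi_\mu$, $I(\mu_1,\mu_2)$ with $\mu_1\ne\mu_2$, and $St_\mu$ are irreducible; for every primitive $\nu$, $\mathcal C_\nu$ exists and is irreducible. Their indicators take the value $1$ in the following cases, and $0$ in all other cases. - $\chi_\mu$ and $St_\mu$: $\mu=1$ if $q$ is even; $\mu\in\{1,\epsilon\}$ if $q$ is odd. - $I(\mu_1,\mu_2)$ with $\mu_1\neq\mu_2$: $\mu_1\mu_2=1$ if $q$ is even; $\mu_1\mu_2=1$ or $\{\mu_1,\mu_2\}=\{1,\epsilon\}$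 if $q$ is odd. - $\mathcal C_\nu$ with $\nu$ primitive: $\nu|_{F^\times}=1$. 3. An irreducible representation of $G$ has real-valued character if and only if it is isomorphic to one in the following list. - $q$ even: $\chi_1$; $I(\mu,\mu^{-1})$ with $\mu\neq1$; $St$; $\mathcal C_\nu$ with $\nu$ primitive and $\nu|_{F^\times}=1$. - $q$ odd: $\chi_1$, $\chi_\epsilon$; $I(\mu,\mu^{-1})$ with $\mu\notin\{1,\epsilon\}$; $I(1,\epsilon)$; $St$, $St_\epsilon$; $\mathcal C_\nu$ with $\nu$ primitive and $\nu|_{F^\times}=1$. 4. Every irreducible representation of $PGL(2,F)$ has Frobenius–Schur indicator $+1$. 5. The number $t$ of elements $k\in G$ with $k^2=1$ and $k\neq1$ is $t=q^2-1$ if $q$ is even and $t=q^2+q+1$ if $q$ is odd. -/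

import Mathlib

universe u v w

open scoped MatrixGroups

noncomputable section

namespace GL2FS

open Matrix

instance instFinitePGL {n R : Type*} [Fintype n] [DecidableEq n] [CommRing R] [Finite R] :
    Finite (ProjGenLinGroup n R) :=
  Finite.of_surjective _ (ProjGenLinGroup.mk_surjective (n := n) (R := R))

section General

variable {G V : Type*} [Group G] [AddCommGroup V] [Module ℂ V]

/-- The Frobenius-Schur indicator `|G|⁻¹ ∑ χ(g²)` of a complex representation
of a finite group. -/
def indicator [Finite G] (ρ : Representation ℂ G V) : ℂ :=
  (Nat.card G : ℂ)⁻¹ * ∑ᶠ g : G, ρ.character (g ^ 2)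

/-- The character of `ρ` takes only real values. -/
def HasRealCharacter (ρ : Representation ℂ G V) : Prop :=
  ∀ g : G, (ρ.character g).im = 0

/-- The one-dimensional representation on `ℂ` attached to a linear character of `G`. -/
def charRep (χ : G →* ℂ) : Representation ℂ G ℂ where
  toFun g := χ g • LinearMap.id
  map_one' := by ext; simp
  map_mul' g h := by ext; simp [mul_comm]

end General

section GLTwo

variable {F : Type*} [Field F]

/-- A character of a group with values in `ℂˣ`, viewed with values in `ℂ`. -/
def toC {G : Type*} [Group G] (μ : G →* ℂˣ) : G →* ℂ := (Units.coeHom ℂ).comp μ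

/-- `χ_μ = μ ∘ det`. -/
def chi (μ : Fˣ →* ℂˣ) : Representation ℂ (GL (Fin 2) F) ℂ :=
  charRep (toC (μ.comp GeneralLinearGroup.det))

/-- The Borel subgroup of upper triangular matrices. -/
def borel (F : Type*) [Field F] : Subgroup (GL (Fin 2) F) where
  carrier := {g | g 1 0 = 0}
  one_mem' := by simp
  mul_mem' {a b} ha hb := by
    simp only [Set.mem_ofPred_eq] at ha hb ⊢
    simp [Matrix.mul_apply, Fin.sum_univ_two, ha, hb]
  inv_mem' {a} ha := by
    simp only [Set.mem_ofPred_eq] at ha ⊢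
    simp [Matrix.inv_def, Matrix.adjugate_fin_two, ha]

theorem borel_mul_apply_diag (a b : borel F) (i : Fin 2) :
    (a.1 * b.1) i i = a.1 i i * b.1 i i := by
  have ha : a.1 1 0 = 0 := a.2
  have hb : b.1 1 0 = 0 := b.2
  fin_cases i <;> simp [Matrix.mul_apply, Fin.sum_univ_two, ha, hb]

/-- The `i`-th diagonal entry of an upper triangular matrix, as a homomorphism `B → Fˣ`. -/
def borelDiag (i : Fin 2) : borel F →* Fˣ where
  toFun a :=
    { val := a.1 i i
      inv := (a⁻¹).1 i i
      val_inv := by rw [← borel_mul_apply_diag]; simp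
      inv_val := by rw [← borel_mul_apply_diag]; simp }
  map_one' := by ext; simp
  map_mul' a b := by
    ext
    simpa using borel_mul_apply_diag a b i

/-- The character `μ₁ ⊗ μ₂` of `B`, trivial on the unipotent matrices. -/
def borelChar (μ₁ μ₂ : Fˣ →* ℂˣ) : borel F →* ℂ :=
  toC (μ₁.comp (borelDiag 0) * μ₂.comp (borelDiag 1))

/-- The space of the induced representation: all `f : G → ℂ` such that
`f (b g) = (μ₁ ⊗ μ₂)(b) f g` for `b ∈ B`. -/
abbrev PrincipalSpace (μ₁ μ₂ : Fˣ →* ℂˣ) : Submodule ℂ (GL (Fin 2) F → ℂ) :=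
  Representation.coindV (borel F).subtype (charRep (borelChar μ₁ μ₂))

/-- `I(μ₁, μ₂) = Ind_B^G (μ₁ ⊗ μ₂)`, in the model by functions `f (b g) = (μ₁ ⊗ μ₂)(b) f g`, on
which `G` acts by right translation. (For finite groups, this, which Mathlib calls coinduction,
is the induced representation.) -/
def principal (μ₁ μ₂ : Fˣ →* ℂˣ) : Representation ℂ (GL (Fin 2) F) (PrincipalSpace μ₁ μ₂) :=
  Representation.coind (borel F).subtype (charRep (borelChar μ₁ μ₂))

/-- The function `μ ∘ det`, an element of `I(μ, μ)`. -/
def detVec (μ : Fˣ →* ℂˣ) : PrincipalSpace μ μ :=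
  ⟨fun g => (μ (GeneralLinearGroup.det g) : ℂ), by
    rw [Representation.mem_coindV]
    intro b h
    have hb : GeneralLinearGroup.det b.1 = borelDiag 0 b * borelDiag 1 b := by
      have hz : b.1 1 0 = 0 := b.2
      ext
      simp [borelDiag, Matrix.det_fin_two, hz]
    simp [charRep, borelChar, toC, hb]⟩

theorem principal_detVec (μ : Fˣ →* ℂˣ) (g : GL (Fin 2) F) :
    principal μ μ g (detVec μ) = (μ (GeneralLinearGroup.det g) : ℂ) • detVec μ := by
  apply Subtype.ext
  funext h
  change ((μ (GeneralLinearGroup.det (h * g)) : ℂˣ) : ℂ) =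
    (μ (GeneralLinearGroup.det g) : ℂ) * (μ (GeneralLinearGroup.det h) : ℂ)
  simp [mul_comm]

/-- `St_μ = I(μ, μ) / χ_μ`, where `χ_μ` is the line spanned by `μ ∘ det`. -/
def steinberg (μ : Fˣ →* ℂˣ) :
    Representation ℂ (GL (Fin 2) F) (PrincipalSpace μ μ ⧸ Submodule.span ℂ {detVec μ}) :=
  (principal μ μ).quotient (Submodule.span ℂ {detVec μ}) fun g => by
    rw [Submodule.span_singleton_le_iff_mem, Submodule.mem_comap, principal_detVec]
    exact Submodule.smul_mem _ _ (Submodule.mem_span_singleton_self _)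

/-- The embedding `(a, x) ↦ (a, a x; 0, a)` of `Fˣ × F` in `GL(2, F)`, an isomorphism onto `Z N`
with `Z` the centre and `N` the group of unipotent upper triangular matrices. -/
def znHom (F : Type*) [Field F] : Fˣ × Multiplicative F →* GL (Fin 2) F where
  toFun p := GeneralLinearGroup.mkOfDetNeZero
    !![(p.1 : F), (p.1 : F) * Multiplicative.toAdd p.2; 0, (p.1 : F)] (by simp)
  map_one' := by ext i j; fin_cases i <;> fin_cases j <;> simp [GeneralLinearGroup.mkOfDetNeZero]
  map_mul' p r := by
    ext i j
    fin_cases i <;> fin_cases j <;>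
      simp [GeneralLinearGroup.mkOfDetNeZero, Matrix.mul_apply, Fin.sum_univ_two] <;> ring

/-- The quadratic character `ε` of `Fˣ`, with `ε x = 1` for squares and `-1` for non-squares. -/
def epsilon (F : Type*) [Field F] [Fintype F] [DecidableEq F] : Fˣ →* ℂˣ :=
  (Units.map (Int.castRingHom ℂ : ℤ →* ℂ)).comp (quadraticChar F).toUnitHom

variable {E : Type*} [Field E] [Algebra F E]

/-- The restriction of a character of `Eˣ` to `Fˣ`. -/
def resF (F : Type*) [Field F] [Algebra F E] (ν : Eˣ →* ℂˣ) : Fˣ →* ℂˣ :=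
  ν.comp (Units.map (algebraMap F E : F →* E))

/-- A character of `Eˣ` is primitive if it does not factor through the norm to `Fˣ`. -/
def IsPrimitive (F : Type*) [Field F] [Algebra F E] (ν : Eˣ →* ℂˣ) : Prop :=
  ¬ ∃ μ : Fˣ →* ℂˣ, ν = μ.comp (Units.map (Algebra.norm F : E →* F))

/-- The embedding of `Eˣ` in `GL(2, F)` given by multiplication on `E`, in the basis `b`. -/
def torusHom (b : Module.Basis (Fin 2) F E) : Eˣ →* GL (Fin 2) F :=
  Units.map (Algebra.leftMulMatrix b : E →* Matrix (Fin 2) (Fin 2) F)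

/-- The character `a n ↦ ν(a) ψ(n)` of `Z N`. -/
def nuPsi (ψ : AddChar F ℂ) (ν : Eˣ →* ℂˣ) : Fˣ × Multiplicative F →* ℂ :=
  (toC (resF F ν)).coprod ψ.toMonoidHom

/-- `ρ` is (isomorphic to) the cuspidal representation `C_ν`, the representation, unique up to
isomorphism, such that `Ind_{ZN}^G (ν_ψ) ≅ C_ν ⊕ Ind_{Eˣ}^G ν`. -/
def IsCuspidalRep (b : Module.Basis (Fin 2) F E) (ψ : AddChar F ℂ) (ν : Eˣ →* ℂˣ)
    {V : Type*} [AddCommGroup V] [Module ℂ V] (ρ : Representation ℂ (GL (Fin 2) F) V) : Prop :=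
  Nonempty ((Representation.coind (znHom F) (charRep (nuPsi ψ ν))).Equiv
    (ρ.prod (Representation.coind (torusHom b) (charRep (toC ν)))))

end GLTwo

end GL2FS

end

/-! For an irreducible `ρ` with character χ, the average of χ(g)² is the dimension of the space of
invariant bilinear forms: 1 if χ is real and 0 otherwise (`pair_self_of_real`,
`pair_self_of_not_real`). The indicator is the trace of the swap of arguments on that space. So once
every invariant form is known to be symmetric, the indicator equals the average of χ², and the value
-1 is excluded (`indicator_eq_pair_self`).

For GL(2, F) the symmetry comes from Whittaker vectors. The irreducible representations that are not
one-dimensional contain each nontrivial character of N exactly once. The element t = diag(-1, 1) is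
an involution which inverts N. If v spans the relevant N-eigenline and S is the skew part of an
invariant form, then S(v, tw) depends only on the component of w along v, and S(v, tv) = 0 because t
swaps the two arguments while S is skew. So v lies in the kernel of S, which is a subrepresentation,
and S = 0 (`symmetric_of_whittaker`). On a line every form is symmetric.

Multiplicity one is read off from the classification. Frobenius reciprocity gives all pairings
between the characters induced from B, from ZN and from Eˣ. The difference of the last two has norm
one when ν is primitive, hence is the character of an actual representation (`exists_equiv_prod`).
Completeness does not count conjugacy classes: a class function orthogonal to all I(μ₁, μ₂) and all
these differences vanishes at 1, which the character of a nonzero representation cannot do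
(`eq_zero_of_pair_eq_zero`).

The same pairings decide which characters are real. For PGL(2, F) every element is conjugate to its
inverse (`exists_conj_eq_inv`), so all characters are real, and inflation to GL(2, F) gives
indicator 1. The involutions are -1, if it differs from 1, together with the matrices of trace 0 and
determinant -1 other than 1, and the latter are parametrized explicitly. -/

noncomputable section

namespace GL2FS

open Matrix Representation

/-! ### Averages over finite groups. -/

section Average

/-- The average of a function on a finite group. -/
def avg {G : Type*} (f : G → ℂ) : ℂ := (Nat.card G : ℂ)⁻¹ * ∑ᶠ g, f g

/-- The bilinear pairing `|G|⁻¹ ∑ f(g) f'(g)` of functions on a finite group. -/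
def pair {G : Type*} (f f' : G → ℂ) : ℂ := avg fun g => f g * f' g

variable {G : Type*}

theorem avg_eq_sum [Fintype G] (f : G → ℂ) : avg f = (Fintype.card G : ℂ)⁻¹ * ∑ g, f g := by
  rw [avg, finsum_eq_sum_of_fintype, Nat.card_eq_fintype_card]

theorem avg_comp_equiv {H : Type*} (e : H ≃ G) (f : G → ℂ) : avg (fun h => f (e h)) = avg f := by
  rw [avg, avg, Nat.card_congr e, finsum_comp_equiv]

theorem pair_comm (f f' : G → ℂ) : pair f f' = pair f' f := by
  simp only [pair, mul_comm]

variable [Finite G]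

theorem avg_add (f f' : G → ℂ) : avg (f + f') = avg f + avg f' := by
  cases nonempty_fintype G
  simp [avg_eq_sum, Finset.sum_add_distrib, mul_add]

theorem avg_smul (c : ℂ) (f : G → ℂ) : avg (c • f) = c * avg f := by
  cases nonempty_fintype G
  simp only [avg_eq_sum, Pi.smul_apply, smul_eq_mul, ← Finset.mul_sum]
  ring

theorem avg_sub (f f' : G → ℂ) : avg (f - f') = avg f - avg f' := by
  cases nonempty_fintype G
  simp [avg_eq_sum, Finset.sum_sub_distrib, mul_sub]

theorem avg_const [Nonempty G] (c : ℂ) : avg (fun _ : G => c) = c := by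
  cases nonempty_fintype G
  simp [avg_eq_sum]

theorem avg_finset_sum {ι : Type*} (s : Finset ι) (f : ι → G → ℂ) :
    avg (∑ i ∈ s, f i) = ∑ i ∈ s, avg (f i) := by
  cases nonempty_fintype G
  simp only [avg_eq_sum, Finset.sum_apply, ← Finset.mul_sum]
  rw [Finset.sum_comm]

theorem pair_sub_left (f₁ f₂ f : G → ℂ) : pair (f₁ - f₂) f = pair f₁ f - pair f₂ f := by
  simp only [pair, Pi.sub_apply, sub_mul]; exact avg_sub _ _

theorem pair_smul_left (c : ℂ) (f₁ f : G → ℂ) : pair (c • f₁) f = c * pair f₁ f := by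
  simp only [pair, Pi.smul_apply, smul_eq_mul, mul_assoc]; exact avg_smul _ _

theorem pair_sub_right (f f₁ f₂ : G → ℂ) : pair f (f₁ - f₂) = pair f f₁ - pair f f₂ := by
  simp only [pair_comm f, pair_sub_left]

theorem pair_smul_right (c : ℂ) (f f₁ : G → ℂ) : pair f (c • f₁) = c * pair f f₁ := by
  simp only [pair_comm f, pair_smul_left]

theorem avg_character {H : Type*} [Group H] [Finite H] (α : H →* ℂˣ) [Decidable (α = 1)] :
    avg (fun h => (α h : ℂ)) = if α = 1 then 1 else 0 := by
  split_ifs with h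
  · simp [h, avg_const]
  · obtain ⟨k, hk⟩ : ∃ k, α k ≠ 1 := by
      by_contra! hc; exact h (MonoidHom.ext hc)
    have h1 : avg (fun h => (α h : ℂ)) = (α k : ℂ) * avg (fun h => (α h : ℂ)) := by
      rw [← avg_smul, ← avg_comp_equiv (Equiv.mulLeft k)]
      congr 1; ext x; simp
    have h2 : ((α k : ℂ) - 1) * avg (fun h => (α h : ℂ)) = 0 := by linear_combination -h1
    rcases mul_eq_zero.1 h2 with h3 | h3
    · exact absurd (Units.ext (by simpa [sub_eq_zero] using h3)) hk
    · exact h3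

/-- The fibres are cosets of the kernel and so have equal size. This serves both for the determinant
and for the projection onto PGL(2, F). -/
theorem avg_comp_surjective {H K : Type*} [Group H] [Group K] [Finite H] [Finite K] (φ : H →* K)
    (hφ : Function.Surjective φ) (f : K → ℂ) : avg (fun h => f (φ h)) = avg f := by
  classical
  cases nonempty_fintype H
  cases nonempty_fintype K
  have hc (k : K) : (Finset.univ.filter fun h => φ h = k).card =
      (Finset.univ.filter fun h => φ h = 1).card :=
    MonoidHom.card_fiber_eq_of_mem_range φ (hφ k) (hφ 1)
  have hcard : Fintype.card H =
      Fintype.card K * (Finset.univ.filter fun h => φ h = 1).card := by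
    rw [← Finset.card_univ, Finset.card_eq_sum_card_fiberwise (f := φ) (t := Finset.univ)
      (by simp)]
    simp [hc]
  have hne : ((Finset.univ.filter fun h => φ h = 1).card : ℂ) ≠ 0 := by
    rw [Nat.cast_ne_zero, Finset.card_ne_zero]
    exact ⟨1, by simp⟩
  rw [avg_eq_sum, avg_eq_sum, ← Finset.sum_fiberwise Finset.univ φ, hcard]
  have : ∀ k ∈ Finset.univ, ∑ h with φ h = k, f (φ h) =
      ((Finset.univ.filter fun h => φ h = 1).card : ℂ) * f k := by
    intro k _
    rw [Finset.sum_congr rfl (g := fun _ => f k) (by simp +contextual)]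
    simp [hc]
  rw [Finset.sum_congr rfl this, ← Finset.mul_sum]
  push_cast
  field_simp

end Average

/-! ### Orthogonality, irreducibility and reality of characters. -/

section Characters

variable {G V W : Type*} [Group G] [Finite G] [AddCommGroup V] [Module ℂ V]
  [FiniteDimensional ℂ V] [AddCommGroup W] [Module ℂ W] [FiniteDimensional ℂ W]
  (ρ : Representation ℂ G V) (σ : Representation ℂ G W)

/-- The function `g ↦ f(g⁻¹)`. -/
def check {G : Type*} [Group G] (f : G → ℂ) : G → ℂ := fun g => f g⁻¹

omit [FiniteDimensional ℂ V] in
theorem indicator_eq_avg : indicator ρ = avg fun g => ρ.character (g ^ 2) := rfl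

/-- The pairing is bilinear, not Hermitian, so multiplicities need the inversion `check` on one
side. Keeping the two apart is what lets the average of χ² detect self-duality. -/
theorem pair_check_eq_finrank :
    pair ρ.character (check σ.character) = Module.finrank ℂ (IntertwiningMap σ ρ) := by
  cases nonempty_fintype G
  let _ : Invertible (Nat.card G : ℂ) := invertibleOfNonzero (by simp)
  rw [← card_inv_mul_sum_char_mul_char_eq_finrank, pair, avg_eq_sum, Nat.card_eq_fintype_card]
  rfl

-- Averaging the standard Hermitian form gives a positive definite H with A(g)ᴴ H A(g) = H. Hence
-- A(g)ᴴ is conjugate under H to A(g⁻¹), and the traces agree.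
open ComplexOrder in
theorem character_inv (g : G) : ρ.character g⁻¹ = starRingEnd ℂ (ρ.character g) := by
  classical
  cases nonempty_fintype G
  let b := Module.finBasis ℂ V
  let A : G → Matrix (Fin (Module.finrank ℂ V)) (Fin (Module.finrank ℂ V)) ℂ := fun g =>
    LinearMap.toMatrix b b (ρ g)
  have hA (g h : G) : A (g * h) = A g * A h := by
    simp only [A, map_mul, LinearMap.toMatrix_mul]
  have hA1 : A 1 = 1 := by simp [A, LinearMap.toMatrix_one]
  let H := ∑ g, (A g)ᴴ * A g
  have hH : H.PosDef := by
    -- The term at 1 is the identity matrix, which makes the semidefinite sum positive definite.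
    have : H = (A 1)ᴴ * A 1 + ∑ g ∈ Finset.univ.erase 1, (A g)ᴴ * A g :=
      (Finset.add_sum_erase _ (fun g => (A g)ᴴ * A g) (Finset.mem_univ 1)).symm
    rw [this, hA1]
    refine PosDef.add_posSemidef (by simpa using PosDef.one) ?_
    exact Matrix.posSemidef_sum _ fun g _ => Matrix.posSemidef_conjTranspose_mul_self _
  have hinv : (A g)ᴴ * H * A g = H := by
    simp only [H, Finset.mul_sum, Finset.sum_mul]
    rw [← Equiv.sum_comp (Equiv.mulRight g) fun x => (A x)ᴴ * A x]
    refine Finset.sum_congr rfl fun x _ => ?_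
    simp [hA, Matrix.conjTranspose_mul, Matrix.mul_assoc]
  have hgg : A g * A g⁻¹ = 1 := by rw [← hA, mul_inv_cancel, hA1]
  have hcomm : (A g)ᴴ * H = H * A g⁻¹ := by
    calc (A g)ᴴ * H = (A g)ᴴ * H * (A g * A g⁻¹) := by rw [hgg, mul_one]
      _ = ((A g)ᴴ * H * A g) * A g⁻¹ := by simp only [Matrix.mul_assoc]
      _ = _ := by rw [hinv]
  have hdet : IsUnit H.det := (Matrix.isUnit_iff_isUnit_det _).1 hH.isUnit
  have hfin : (A g)ᴴ = H * A g⁻¹ * H⁻¹ := by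
    rw [← hcomm, Matrix.mul_assoc, Matrix.mul_nonsing_inv _ hdet, mul_one]
  have ht (g : G) : ρ.character g = (A g).trace :=
    LinearMap.trace_eq_matrix_trace ℂ b (ρ g)
  rw [ht, ht, ← Complex.star_def, ← Matrix.trace_conjTranspose, hfin, Matrix.trace_mul_comm,
    ← Matrix.mul_assoc, Matrix.nonsing_inv_mul _ hdet, one_mul]

/-- The commutant consists of scalars, and the projection onto a subrepresentation along an
invariant complement belongs to it. A scalar projection leaves only the zero subrepresentation and
the whole space. -/
theorem isIrreducible_of_pair_check (h : pair ρ.character (check ρ.character) = 1) :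
    ρ.IsIrreducible := by
  rw [pair_check_eq_finrank] at h
  have h1 : Module.finrank ℂ (IntertwiningMap ρ ρ) = 1 := by exact_mod_cast h
  have hid : IntertwiningMap.id ρ ≠ 0 := by
    intro h0
    have : Subsingleton (IntertwiningMap ρ ρ) := by
      refine ⟨fun f g => ?_⟩
      have hV (v : V) : v = 0 := by
        simpa using DFunLike.congr_fun h0 v
      ext v
      rw [hV v]; simp
    rw [Module.finrank_zero_of_subsingleton] at h1
    omega
  have hnt : Nontrivial V := by
    by_contra hV
    rw [not_nontrivial_iff_subsingleton] at hV
    exact hid (by ext v; exact Subsingleton.elim _ _)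
  rw [finrank_eq_one_iff_of_nonzero' _ hid] at h1
  have : Nontrivial (Subrepresentation ρ) := by
    refine ⟨⊥, ⊤, fun hbt => ?_⟩
    exact bot_ne_top (α := Submodule ℂ V) (congrArg Subrepresentation.toSubmodule hbt)
  refine ⟨fun p => ?_⟩
  obtain ⟨q, hq⟩ := exists_isCompl p
  have hpq : IsCompl p.toSubmodule q.toSubmodule := by
    constructor
    · rw [disjoint_iff]; exact congrArg Subrepresentation.toSubmodule (disjoint_iff.1 hq.1)
    · rw [codisjoint_iff]; exact congrArg Subrepresentation.toSubmodule (codisjoint_iff.1 hq.2)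
  let T : IntertwiningMap ρ ρ :=
    { toLinearMap := p.toSubmodule.projection q.toSubmodule hpq
      isIntertwining' := fun g => by
        ext v
        obtain ⟨x, hx, y, hy, rfl⟩ : ∃ x ∈ p.toSubmodule, ∃ y ∈ q.toSubmodule, x + y = v :=
          Submodule.mem_sup.1 (hpq.sup_eq_top ▸ Submodule.mem_top)
        have hx' := p.apply_mem_toSubmodule g hx
        have hy' := q.apply_mem_toSubmodule g hy
        simp [Submodule.projection_apply_of_mem_left hpq, hx, hx', hy, hy',
          Submodule.projection_apply_of_mem_right hpq] }
  obtain ⟨c, hc⟩ := h1 T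
  by_cases hc0 : c = 0
  · left
    apply Subrepresentation.toSubmodule_injective
    refine (Submodule.eq_bot_iff _).2 fun x hx => ?_
    have : T x = x := Submodule.projection_apply_of_mem_left hpq hx
    rw [← this, ← hc, hc0]; simp
  · right
    apply Subrepresentation.toSubmodule_injective
    refine (Submodule.eq_top_iff').2 fun x => ?_
    have : T x ∈ p.toSubmodule := Submodule.projection_apply_mem _ _ 
    rw [← hc] at this
    exact (Submodule.smul_mem_iff _ hc0).1 this

variable {ρ σ} in
theorem nonempty_equiv_of_pair_ne_zero (hρ : ρ.IsIrreducible) (hσ : σ.IsIrreducible)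
    (h : pair (check ρ.character) σ.character ≠ 0) : Nonempty (ρ.Equiv σ) := by
  by_contra hne
  rw [not_nonempty_iff] at hne
  rw [pair_comm, pair_check_eq_finrank] at h
  simp [Module.finrank_zero_of_subsingleton] at h

variable {ρ σ} in
theorem pair_check_self (hρ : ρ.IsIrreducible) : pair ρ.character (check ρ.character) = 1 := by
  rw [pair_check_eq_finrank]; simp

theorem pair_self_of_real (hρ : ρ.IsIrreducible) (h : HasRealCharacter ρ) :
    pair ρ.character ρ.character = 1 := by
  rw [← pair_check_self hρ]
  congr 1; ext g
  rw [check, character_inv]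
  exact (Complex.conj_eq_iff_im.2 (h g)).symm

/-- A nonzero pairing gives a nonzero intertwiner from the dual to `ρ`. It is surjective because the
target is irreducible, hence bijective by dimension, and then χ equals its conjugate. -/
theorem pair_self_of_not_real (hρ : ρ.IsIrreducible) (h : ¬ HasRealCharacter ρ) :
    pair ρ.character ρ.character = 0 := by
  have hd : pair ρ.character (check ρ.dual.character) = pair ρ.character ρ.character := by
    congr 1; ext g; simp [check]
  rw [← hd, pair_check_eq_finrank]
  by_contra hne
  apply h
  have : Nontrivial (IntertwiningMap ρ.dual ρ) := by
    by_contra hs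
    rw [not_nontrivial_iff_subsingleton] at hs
    exact hne (by simp [Module.finrank_zero_of_subsingleton])
  obtain ⟨T, hT⟩ := exists_ne (0 : IntertwiningMap ρ.dual ρ)
  have hsurj : Function.Surjective T := (IsIrreducible.surjective_or_eq_zero T).resolve_right hT
  have hinj : Function.Injective T := by
    have := (LinearMap.injective_iff_surjective_of_finrank_eq_finrank (f := T.toLinearMap)
      (Subspace.dual_finrank_eq)).2 hsurj
    exact this
  have hχ := char_iso (T.ofBijective ⟨hinj, hsurj⟩)
  intro g
  rw [← Complex.conj_eq_iff_im, ← character_inv, ← char_dual, hχ]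

theorem hasRealCharacter_iff (hρ : ρ.IsIrreducible) :
    HasRealCharacter ρ ↔ pair ρ.character ρ.character ≠ 0 := by
  refine ⟨fun h => by simp [pair_self_of_real ρ hρ h], fun h => ?_⟩
  by_contra h'
  exact h (pair_self_of_not_real ρ hρ h')

omit [Finite G] in
theorem character_prod : (ρ.prod σ).character = ρ.character + σ.character := by
  ext g; exact LinearMap.trace_prodMap' (ρ g) (σ g)

/-- Under `hf` the pairing is the mean of |f|². This turns an identity between virtual characters
into a norm computation. -/
theorem eq_zero_of_pair_check_eq_zero {f : G → ℂ} (hf : ∀ g, f g⁻¹ = starRingEnd ℂ (f g))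
    (h : pair f (check f) = 0) : f = 0 := by
  cases nonempty_fintype G
  rw [pair, avg_eq_sum] at h
  have h1 : ∑ g, f g * check f g = 0 := by
    rcases mul_eq_zero.1 h with h | h
    · simp at h
    · exact h
  have h2 : ∑ g, Complex.normSq (f g) = 0 := by
    have : ((∑ g, Complex.normSq (f g) : ℝ) : ℂ) = 0 := by
      rw [← h1]; push_cast
      exact Finset.sum_congr rfl fun g _ => by rw [check, hf, Complex.mul_conj]
    exact_mod_cast this
  rw [Finset.sum_eq_zero_iff_of_nonneg fun g _ => Complex.normSq_nonneg _] at h2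
  ext g
  simpa using h2 g (Finset.mem_univ _)

end Characters

/-! ### Complements, and virtual characters of norm one. -/

section Decomposition

variable {G : Type*} [Group G]

/-- Transport of a representation along a linear equivalence. -/
def transport {V W : Type*} [AddCommGroup V] [Module ℂ V] [AddCommGroup W] [Module ℂ W]
    (ρ : Representation ℂ G V) (e : V ≃ₗ[ℂ] W) : Representation ℂ G W where
  toFun g := e.conj (ρ g)
  map_one' := by ext; simp
  map_mul' g h := by ext; simp

/-- The transported representation is isomorphic to the original one. -/
def transportEquiv {V W : Type*} [AddCommGroup V] [Module ℂ V] [AddCommGroup W] [Module ℂ W]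
    (ρ : Representation ℂ G V) (e : V ≃ₗ[ℂ] W) : ρ.Equiv (transport ρ e) :=
  Representation.Equiv.mk e fun g => by
    ext v
    simp [transport]

/-- The product of two isomorphisms of representations. -/
def prodEquiv {V V' W W' : Type*} [AddCommGroup V] [Module ℂ V] [AddCommGroup W] [Module ℂ W]
    [AddCommGroup V'] [Module ℂ V'] [AddCommGroup W'] [Module ℂ W']
    {ρ : Representation ℂ G V} {ρ' : Representation ℂ G V'} {σ : Representation ℂ G W}
    {σ' : Representation ℂ G W'} (e : ρ.Equiv ρ') (f : σ.Equiv σ') :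
    (ρ.prod σ).Equiv (ρ'.prod σ') :=
  Representation.Equiv.mk (e.toLinearEquiv.prodCongr f.toLinearEquiv) fun g => by
    refine LinearMap.ext fun v => ?_
    exact Prod.ext (IntertwiningMap.isIntertwining _ _ e.toIntertwiningMap g v.1)
      (IntertwiningMap.isIntertwining _ _ f.toIntertwiningMap g v.2)

/-- `A ⊕ (B ⊕ C) ≅ B ⊕ (A ⊕ C)`. -/
def prodLeftComm {A B C : Type*} [AddCommGroup A] [Module ℂ A] [AddCommGroup B] [Module ℂ B]
    [AddCommGroup C] [Module ℂ C] (α : Representation ℂ G A) (β : Representation ℂ G B)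
    (γ : Representation ℂ G C) : (α.prod (β.prod γ)).Equiv (β.prod (α.prod γ)) :=
  Representation.Equiv.mk
    { toFun := fun x => (x.2.1, x.1, x.2.2)
      invFun := fun x => (x.2.1, x.1, x.2.2)
      map_add' := fun _ _ => rfl
      map_smul' := fun _ _ => rfl
      left_inv := fun _ => rfl
      right_inv := fun _ => rfl } fun _ => rfl

variable [Finite G]

theorem exists_isCompl_subrepresentation {V : Type*} [AddCommGroup V] [Module ℂ V]
    {ρ : Representation ℂ G V} (p : Subrepresentation ρ) :
    ∃ q : Subrepresentation ρ, IsCompl p.toSubmodule q.toSubmodule := by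
  obtain ⟨q, hq⟩ := exists_isCompl p
  refine ⟨q, ?_, ?_⟩
  · rw [disjoint_iff]; exact congrArg Subrepresentation.toSubmodule (disjoint_iff.1 hq.1)
  · rw [codisjoint_iff]; exact congrArg Subrepresentation.toSubmodule (codisjoint_iff.1 hq.2)

/-- A representation is the sum of two complementary subrepresentations. -/
def equivOfIsCompl {V : Type*} [AddCommGroup V] [Module ℂ V] {ρ : Representation ℂ G V}
    (p q : Subrepresentation ρ) (h : IsCompl p.toSubmodule q.toSubmodule) :
    (p.toRepresentation.prod q.toRepresentation).Equiv ρ :=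
  Representation.Equiv.mk (Submodule.prodEquivOfIsCompl _ _ h) fun g => by
    refine LinearMap.ext fun v => ?_
    exact (map_add (ρ g) (v.1 : V) (v.2 : V)).symm

theorem character_quotient {V : Type*} [AddCommGroup V] [Module ℂ V] [FiniteDimensional ℂ V]
    (ρ : Representation ℂ G V) (p : Submodule ℂ V) (hp : ∀ g, p ≤ p.comap (ρ g)) :
    ρ.character = (ρ.subrepresentation p hp).character + (ρ.quotient p hp).character := by
  let p' : Subrepresentation ρ := ⟨p, fun g _ hv => hp g hv⟩
  obtain ⟨q, hq⟩ := exists_isCompl_subrepresentation p'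
  have e : q.toRepresentation.Equiv (ρ.quotient p hp) :=
    Representation.Equiv.mk (Submodule.quotientEquivOfIsCompl p q.toSubmodule hq).symm fun g => by
      refine LinearMap.ext fun v => ?_
      simp only [LinearMap.comp_apply, LinearEquiv.coe_coe,
        Submodule.quotientEquivOfIsCompl_symm_apply]
      rfl
  rw [← char_iso e, ← char_iso (equivOfIsCompl p' q hq), character_prod]
  rfl

/-- Induction on dim σ. A nonzero intertwiner σ → τ identifies a common summand, which can be
cancelled without changing the virtual character. Once there is none, the norm is dim End τ + dim
End σ = 1, so one of the two spaces is zero, and the dimension inequality lets it be σ. -/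
theorem exists_equiv_prod {n : ℕ} : ∀ {V W : Type u} [AddCommGroup V] [Module ℂ V]
    [FiniteDimensional ℂ V] [AddCommGroup W] [Module ℂ W] [FiniteDimensional ℂ W]
    (σ : Representation ℂ G V) (τ : Representation ℂ G W), Module.finrank ℂ V = n →
    Module.finrank ℂ V ≤ Module.finrank ℂ W →
    pair (τ.character - σ.character) (check (τ.character - σ.character)) = 1 →
    ∃ (C : Type u) (_ : AddCommGroup C) (_ : Module ℂ C) (_ : FiniteDimensional ℂ C)
      (κ : Representation ℂ G C), Nonempty (τ.Equiv (κ.prod σ)) := by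
  induction n using Nat.strong_induction_on with
  | _ n ih =>
  intro V W _ _ _ _ _ _ σ τ hn hle hpair
  by_cases hT : ∃ T : IntertwiningMap σ τ, T ≠ 0
  · obtain ⟨T, hT⟩ := hT
    obtain ⟨p, hp⟩ := exists_isCompl_subrepresentation T.ker
    obtain ⟨r, hr⟩ := exists_isCompl_subrepresentation T.range
    have eσ := equivOfIsCompl _ _ hp
    have eτ := equivOfIsCompl _ _ hr
    -- the complement of the kernel is isomorphic to the range
    have hbij : Function.Bijective (T.toLinearMap.domRestrict p.toSubmodule |>.codRestrict
        T.range.toSubmodule fun v => ⟨v, rfl⟩) := by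
      constructor
      · rw [← LinearMap.ker_eq_bot, Submodule.eq_bot_iff]
        intro x hx
        have h1 : (x : V) ∈ T.ker.toSubmodule := congrArg Subtype.val (LinearMap.mem_ker.1 hx)
        have h2 := (Submodule.disjoint_def.1 hp.disjoint) x h1 x.2
        exact Subtype.ext h2
      · rintro ⟨w, v, rfl⟩
        obtain ⟨x, hx, y, hy, rfl⟩ : ∃ x ∈ T.ker.toSubmodule, ∃ y ∈ p.toSubmodule, x + y = v :=
          Submodule.mem_sup.1 (hp.sup_eq_top ▸ Submodule.mem_top)
        refine ⟨⟨y, hy⟩, Subtype.ext ?_⟩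
        have : T.toLinearMap x = 0 := hx
        change T.toLinearMap y = T.toLinearMap (x + y)
        rw [map_add, this, zero_add]
    have eR : p.toRepresentation.Equiv T.range.toRepresentation :=
      Representation.Equiv.mk (LinearEquiv.ofBijective _ hbij) fun g => by
        refine LinearMap.ext fun v => Subtype.ext ?_
        exact IntertwiningMap.isIntertwining _ _ T g v
    -- The range of T and the complement of its kernel are isomorphic and cancel in the difference.
    have hχ : τ.character - σ.character =
        r.toRepresentation.character - T.ker.toRepresentation.character := by
      rw [← char_iso eσ, ← char_iso eτ, character_prod, character_prod, char_iso eR]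
      abel
    have hd1 := Submodule.finrank_add_eq_of_isCompl hp
    have hd2 := Submodule.finrank_add_eq_of_isCompl hr
    have hd3 := eR.toLinearEquiv.finrank_eq
    have hpos : 0 < Module.finrank ℂ T.range.toSubmodule := by
      rw [Module.finrank_pos_iff, Submodule.nontrivial_iff_ne_bot]
      intro hb
      apply hT
      apply IntertwiningMap.toLinearMap_injective
      exact LinearMap.range_eq_bot.1 hb
    obtain ⟨C, i1, i2, i3, κ, ⟨e⟩⟩ := ih (Module.finrank ℂ T.ker.toSubmodule) (by omega)
      T.ker.toRepresentation r.toRepresentation rfl (by omega) (by rw [← hχ]; exact hpair)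
    refine ⟨C, i1, i2, i3, κ, ⟨?_⟩⟩
    -- With τ = range ⊕ r and r = κ ⊕ ker, moving κ to the front leaves range ⊕ ker, which is σ.
    refine eτ.symm.trans ((prodEquiv (.refl _) e).trans ((prodLeftComm _ _ _).trans ?_))
    refine prodEquiv (.refl _) (Representation.Equiv.trans ?_ eσ)
    refine (prodEquiv eR.symm (.refl _)).trans
      (Representation.Equiv.mk (LinearEquiv.prodComm ℂ _ _) fun g => rfl)
  · push Not at hT
    have hsub : Subsingleton (IntertwiningMap σ τ) := ⟨fun f g => by rw [hT f, hT g]⟩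
    have h0 : pair τ.character (check σ.character) = 0 := by
      rw [pair_check_eq_finrank, Module.finrank_zero_of_subsingleton]; simp
    have h0' : pair σ.character (check τ.character) = 0 := by
      rw [← h0, pair, pair, ← avg_comp_equiv (Equiv.inv G)]
      congr 1; ext g; simp [check, mul_comm]
    have hc : check (τ.character - σ.character) = check τ.character - check σ.character := rfl
    rw [hc, pair_sub_left, pair_sub_right, pair_sub_right, h0, h0', pair_check_eq_finrank,
      pair_check_eq_finrank] at hpair
    have hsum : Module.finrank ℂ (IntertwiningMap τ τ) +
        Module.finrank ℂ (IntertwiningMap σ σ) = 1 := by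
      have : ((Module.finrank ℂ (IntertwiningMap τ τ) +
        Module.finrank ℂ (IntertwiningMap σ σ) : ℕ) : ℂ) = 1 := by
        push_cast; linear_combination hpair
      exact_mod_cast this
    have hposi {X : Type u} [AddCommGroup X] [Module ℂ X] [FiniteDimensional ℂ X] [Nontrivial X]
        (π : Representation ℂ G X) : 0 < Module.finrank ℂ (IntertwiningMap π π) := by
      rw [Module.finrank_pos_iff]
      refine ⟨IntertwiningMap.id π, 0, fun h => ?_⟩
      obtain ⟨x, hx⟩ := exists_ne (0 : X)
      exact hx (by simpa using DFunLike.congr_fun h x)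
    rcases subsingleton_or_nontrivial V with hV | hV
    · refine ⟨W, inferInstance, inferInstance, inferInstance, τ, ⟨Representation.Equiv.symm ?_⟩⟩
      refine Representation.Equiv.mk
        { LinearMap.fst ℂ W V with
          invFun := fun w => (w, 0)
          left_inv := fun x => Prod.ext rfl (Subsingleton.elim _ _)
          right_inv := fun _ => rfl } fun g => rfl
    -- If σ were nonzero then so would be τ, and the two commutant dimensions would add up to at
    -- least 2.
    · have : Nontrivial W := by
        rw [← Module.finrank_pos_iff (R := ℂ)]
        exact lt_of_lt_of_le Module.finrank_pos hle
      have := hposi σ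
      have := hposi τ
      omega

end Decomposition

/-! ### The indicator as the trace of the swap on invariant bilinear forms. -/

section BilinearForms

variable {G V : Type*} [Group G] [Finite G] [AddCommGroup V] [Module ℂ V]
  [FiniteDimensional ℂ V] (ρ : Representation ℂ G V)

/-- On the basis forms (x, y) ↦ xⱼ yᵢ the diagonal coefficient of `F` is Aᵢⱼ Aⱼᵢ, and these sum to
tr A². -/
theorem trace_flip_comp (A : V →ₗ[ℂ] V)
    (F : (V →ₗ[ℂ] Module.Dual ℂ V) →ₗ[ℂ] V →ₗ[ℂ] Module.Dual ℂ V)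
    (hF : ∀ B x y, F B x y = B (A y) (A x)) :
    LinearMap.trace ℂ _ F = LinearMap.trace ℂ V (A * A) := by
  classical
  let b := Module.finBasis ℂ V
  rw [LinearMap.trace_eq_matrix_trace ℂ (b.linearMap b.dualBasis), LinearMap.trace_eq_matrix_trace ℂ b,
    LinearMap.toMatrix_mul, Matrix.trace, Matrix.trace, Fintype.sum_prod_type]
  refine Finset.sum_congr rfl fun i _ => ?_
  rw [Matrix.diag_apply, Matrix.mul_apply]
  refine Finset.sum_congr rfl fun j _ => ?_
  have hB : b.linearMap b.dualBasis (i, j) = (b.coord j).smulRight (b.dualBasis i) := by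
    refine b.ext fun k => ?_
    rw [Module.Basis.linearMap_apply_apply]
    by_cases hjk : j = k <;> simp [hjk]
  have hrepr (M : Matrix (Fin (Module.finrank ℂ V)) (Fin (Module.finrank ℂ V)) ℂ) :
      (stdBasis ℂ _ _).repr M (i, j) = M i j := by
    simp [stdBasis]
  rw [Matrix.diag_apply, LinearMap.toMatrix_apply, Module.Basis.linearMap_repr_apply, hrepr,
    LinearMap.toMatrix_apply, Module.Basis.dualBasis_repr, hF, hB]
  simp [LinearMap.toMatrix_apply, mul_comm]

/-- Let P be the averaging projection onto invariant forms and τ the swap. Then tr P is the average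
of χ² and tr τP is the indicator. Symmetry of all invariant forms says τP = P. -/
theorem indicator_eq_pair_self
    (h : ∀ B : V →ₗ[ℂ] Module.Dual ℂ V, (∀ g x y, B (ρ g x) (ρ g y) = B x y) →
      ∀ x y, B x y = B y x) :
    indicator ρ = pair ρ.character ρ.character := by
  classical
  cases nonempty_fintype G
  let _ : Invertible (Nat.card G : ℂ) := invertibleOfNonzero (by simp)
  let _ : Invertible (Fintype.card G : ℂ) := invertibleOfNonzero (by simp)
  let L := linHom ρ ρ.dual
  let τ : (V →ₗ[ℂ] Module.Dual ℂ V) →ₗ[ℂ] V →ₗ[ℂ] Module.Dual ℂ V :=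
    LinearMap.lflip.toLinearMap
  have hL (g : G) (B : V →ₗ[ℂ] Module.Dual ℂ V) (x y : V) :
      L g B x y = B (ρ g⁻¹ x) (ρ g⁻¹ y) := rfl
  have h1 : τ ∘ₗ L.averageMap = L.averageMap := by
    refine LinearMap.ext fun B => ?_
    have hB := L.averageMap_invariant B
    refine LinearMap.ext₂ fun x y => ?_
    refine (h _ (fun g x y => ?_) x y).symm
    have := congrArg (fun B' : V →ₗ[ℂ] Module.Dual ℂ V => B' x y) (hB g⁻¹)
    simpa [hL] using this
  have havg : L.averageMap = (Fintype.card G : ℂ)⁻¹ • ∑ g, L g := by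
    simp [Representation.averageMap, GroupAlgebra.average, map_sum]
  have h2 : LinearMap.trace ℂ _ L.averageMap = pair ρ.character ρ.character := by
    rw [havg, map_smul, map_sum, smul_eq_mul, pair, avg_eq_sum]
    congr 1
    rw [← Equiv.sum_comp (Equiv.inv G)]
    refine Finset.sum_congr rfl fun g _ => ?_
    change L.character g⁻¹ = _
    simp [L]
  have h3 : LinearMap.trace ℂ _ (τ ∘ₗ L.averageMap) = indicator ρ := by
    rw [havg, LinearMap.comp_smul, map_smul, show τ ∘ₗ ∑ g, L g = ∑ g, τ ∘ₗ L g by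
        ext; simp, map_sum, smul_eq_mul,
      indicator_eq_avg, avg_eq_sum]
    congr 1
    rw [← Equiv.sum_comp (Equiv.inv G)]
    refine Finset.sum_congr rfl fun g _ => ?_
    rw [pow_two, character, map_mul ρ]
    refine trace_flip_comp (ρ g) _ fun B x y => ?_
    change L g⁻¹ B y x = _
    rw [hL, inv_inv]
  rw [← h3, h1, h2]

end BilinearForms

/-! ### Further rules for averages. -/

section Averages

theorem avg_prod {H K : Type*} [Finite H] [Finite K] (f : H × K → ℂ) :
    avg f = avg fun h => avg fun k => f (h, k) := by
  cases nonempty_fintype H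
  cases nonempty_fintype K
  simp only [avg_eq_sum, Fintype.card_prod, Fintype.sum_prod_type, ← Finset.mul_sum]
  push_cast
  rw [mul_inv, mul_assoc]

theorem avg_mul_left {H : Type*} [Finite H] (c : ℂ) (f : H → ℂ) :
    avg (fun h => c * f h) = c * avg f := avg_smul c f

theorem avg_mul_right {H : Type*} [Finite H] (c : ℂ) (f : H → ℂ) :
    avg (fun h => f h * c) = avg f * c := by
  simp only [mul_comm _ c, avg_mul_left]

theorem avg_eq_of_support {H K : Type*} [Finite H] [Finite K] [Nonempty K] {ι : K → H}
    (hι : Function.Injective ι)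
    (f : H → ℂ) (hf : ∀ h, h ∉ Set.range ι → f h = 0) :
    avg f = (Nat.card K / Nat.card H : ℂ) * avg fun k => f (ι k) := by
  classical
  cases nonempty_fintype H
  cases nonempty_fintype K
  rw [avg_eq_sum, avg_eq_sum, Nat.card_eq_fintype_card, Nat.card_eq_fintype_card,
    ← Finset.sum_subset (Finset.subset_univ (Finset.univ.image ι)),
    Finset.sum_image fun a _ b _ h => hι h]
  · field_simp
  · intro h _ hh
    exact hf h fun ⟨k, hk⟩ => hh (by simp [← hk])

end Averages

/-! ### Characters of induced representations and Frobenius reciprocity. -/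

section Coinduction

variable {G H : Type*} [Group G] [Group H] (φ : H →* G) (α : H →* ℂ)

theorem charRep_apply (h : H) (z : ℂ) : charRep α h z = α h * z := rfl

theorem character_charRep : (charRep α).character = α := by
  ext h
  change LinearMap.trace ℂ ℂ (α h • LinearMap.id) = α h
  simp

theorem map_inv_mul_map (h : H) : α h⁻¹ * α h = 1 := by
  rw [← map_mul, inv_mul_cancel, map_one]

theorem character_coind [Fintype G] [Fintype H] [DecidableEq G] (g : G) :
    (coind φ (charRep α)).character g =
      (Fintype.card H : ℂ)⁻¹ * ∑ s, ∑ h, if s * g = φ h * s then α h else 0 := by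
  -- Averaging over H projects all functions onto the induced space, and `e` is this projection
  -- combined with translation by g. Its values lie in the induced space, where it restricts to the
  -- action of g, so its trace is the character and can be computed on delta functions.
  let e : (G → ℂ) →ₗ[ℂ] (G → ℂ) :=
    { toFun := fun f s => (Fintype.card H : ℂ)⁻¹ * ∑ h, α h⁻¹ * f (φ h * s * g)
      map_add' := fun f f' => by
        ext s; simp [mul_add, Finset.sum_add_distrib]
      map_smul' := fun c f => by
        ext s; simp only [Pi.smul_apply, smul_eq_mul, RingHom.id_apply, Finset.mul_sum]
        exact Finset.sum_congr rfl fun _ _ => by ring }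
  have he (f : G → ℂ) (s : G) :
      e f s = (Fintype.card H : ℂ)⁻¹ * ∑ h, α h⁻¹ * f (φ h * s * g) := rfl
  have hmem (f : G → ℂ) : e f ∈ coindV φ (charRep α) := by
    intro k s
    rw [he, charRep_apply, he, mul_left_comm]
    congr 1
    rw [Finset.mul_sum, ← Equiv.sum_comp (Equiv.mulRight k⁻¹)]
    refine Finset.sum_congr rfl fun h _ => ?_
    simp [mul_assoc]
  have htr : (coind φ (charRep α)).character g = LinearMap.trace ℂ _ e := by
    rw [← LinearMap.trace_restrict_eq_of_forall_mem _ e hmem, character]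
    congr 1
    refine LinearMap.ext fun f => Subtype.ext (funext fun s => ?_)
    change f.1 (s * g) = e f.1 s
    rw [he]
    have (h : H) : α h⁻¹ * f.1 (φ h * s * g) = f.1 (s * g) := by
      rw [mul_assoc, f.2 h (s * g), charRep_apply, ← mul_assoc, map_inv_mul_map, one_mul]
    simp [this, -map_inv₀, -map_inv]
  rw [htr, LinearMap.trace_eq_matrix_trace ℂ (Pi.basisFun ℂ G), Matrix.trace, Finset.mul_sum]
  refine Finset.sum_congr rfl fun s _ => ?_
  rw [Matrix.diag_apply, LinearMap.toMatrix_apply, Pi.basisFun_repr, Pi.basisFun_apply, he]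
  congr 1
  rw [← Equiv.sum_comp (Equiv.inv H)]
  refine Finset.sum_congr rfl fun h _ => ?_
  have : (φ h⁻¹ * s * g = s) ↔ (s * g = φ h * s) := by
    rw [map_inv, mul_assoc, inv_mul_eq_iff_eq_mul]
  simp [Pi.single_apply, this, -map_inv]

theorem character_coind_eq_zero [Finite G] [Finite H] (g : G) (hg : ∀ s h, s * g ≠ φ h * s) :
    (coind φ (charRep α)).character g = 0 := by
  classical
  cases nonempty_fintype G
  cases nonempty_fintype H
  simp [character_coind, hg]

theorem character_coind_central [Finite G] [Finite H] (hφ : Function.Injective φ) (h : H)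
    (hh : ∀ s, s * φ h = φ h * s) :
    (coind φ (charRep α)).character (φ h) = (Nat.card G / Nat.card H : ℂ) * α h := by
  classical
  cases nonempty_fintype G
  cases nonempty_fintype H
  simp [character_coind, hh, hφ.eq_iff]
  ring

/-- The character of an induced representation as a sum over coset representatives. -/
theorem character_coind_of_bijective [Finite G] [Fintype H] [DecidableEq G] {T : Type*} [Fintype T]
    (r : T → G) (hr : Function.Bijective fun x : H × T => φ x.1 * r x.2) (g : G) :
    (coind φ (charRep α)).character g = ∑ t, ∑ h, if r t * g = φ h * r t then α h else 0 := by
  cases nonempty_fintype G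
  rw [character_coind, ← (Equiv.ofBijective _ hr).sum_comp, Fintype.sum_prod_type]
  have (k : H) (t : T) : (∑ h, if Equiv.ofBijective _ hr (k, t) * g =
      φ h * Equiv.ofBijective _ hr (k, t) then α h else 0) =
      ∑ h, if r t * g = φ h * r t then α h else 0 := by
    -- Replacing a representative s by φ(k)s conjugates h by k, and α does not change under
    -- conjugation because its values commute.
    rw [← Equiv.sum_comp (MulAut.conj k).toEquiv]
    refine Finset.sum_congr rfl fun h _ => ?_
    have h1 : α (k * h * k⁻¹) = α h := by
      rw [map_mul, map_mul, mul_comm (α k), mul_assoc, ← map_mul, mul_inv_cancel, map_one, mul_one]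
    have h2 : (φ k * r t * g = φ (k * h * k⁻¹) * (φ k * r t)) ↔ (r t * g = φ h * r t) := by
      simp [mul_assoc]
    change (if φ k * r t * g = φ (k * h * k⁻¹) * (φ k * r t) then α (k * h * k⁻¹) else 0) = _
    simp only [h1, h2]
  simp only [this]
  simp

/-- Frobenius reciprocity for characters. -/
theorem pair_coind [Finite G] [Finite H] (f : G → ℂ) (hf : ∀ g s, f (s * g * s⁻¹) = f g) :
    pair (coind φ (charRep α)).character f = avg fun h => α h * f (φ h) := by
  classical
  cases nonempty_fintype G
  cases nonempty_fintype H
  rw [pair, avg_eq_sum, avg_eq_sum]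
  have h1 : ∑ g, (coind φ (charRep α)).character g * f g =
      (Fintype.card H : ℂ)⁻¹ * ∑ s : G, ∑ h, α h * f (φ h) := by
    simp only [character_coind, Finset.mul_sum, Finset.sum_mul]
    rw [Finset.sum_comm]
    refine Finset.sum_congr rfl fun s _ => ?_
    rw [Finset.sum_comm]
    refine Finset.sum_congr rfl fun h _ => ?_
    rw [Finset.sum_eq_single (s⁻¹ * φ h * s)]
    · rw [if_pos (by group), mul_assoc]
      congr 2
      simpa using hf (φ h) s⁻¹
    · intro g _ hg
      rw [if_neg, mul_zero, zero_mul]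
      intro h'
      exact hg (by rw [mul_assoc, ← h']; group)
    · simp
  rw [h1]
  simp
  field_simp

theorem check_character_coind [Finite G] [Finite H] (α' : H →* ℂ) (hα : ∀ h, α' h = α h⁻¹) :
    check (coind φ (charRep α)).character = (coind φ (charRep α')).character := by
  classical
  cases nonempty_fintype G
  cases nonempty_fintype H
  ext g
  rw [check, character_coind, character_coind]
  congr 1
  refine Finset.sum_congr rfl fun s _ => ?_
  rw [← Equiv.sum_comp (Equiv.inv H)]
  refine Finset.sum_congr rfl fun h _ => ?_
  have : s * g⁻¹ = φ h⁻¹ * s ↔ s * g = φ h * s := by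
    rw [mul_inv_eq_iff_eq_mul, map_inv, mul_assoc, eq_inv_mul_iff_mul_eq, eq_comm]
  simp only [Equiv.inv_apply, this, hα]

end Coinduction

/-! ### Bruhat cells and induced characters on triangular matrices. -/

section Matrices

variable {F : Type*} [Field F]

/-- The upper triangular matrix `(a, x; 0, d)`. -/
def upper (a d : Fˣ) (x : F) : GL (Fin 2) F :=
  GeneralLinearGroup.mkOfDetNeZero !![(a : F), x; 0, (d : F)] (by simp)

theorem coe_upper (a d : Fˣ) (x : F) :
    (upper a d x : Matrix (Fin 2) (Fin 2) F) = !![(a : F), x; 0, (d : F)] := rfl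

/-- The matrix `(0, t; 1, x)`. -/
def bigCell (t : Fˣ) (x : F) : GL (Fin 2) F :=
  GeneralLinearGroup.mkOfDetNeZero !![0, (t : F); 1, x] (by simp)

theorem coe_bigCell (t : Fˣ) (x : F) :
    (bigCell t x : Matrix (Fin 2) (Fin 2) F) = !![0, (t : F); 1, x] := rfl

/-- Representatives of the cosets `B \ G`, twisted by `diag(t, 1)`. -/
def cosetRep (t : Fˣ) : Option F → GL (Fin 2) F
  | none => upper t 1 0
  | some x => bigCell t x

theorem GL_eq_iff (A B : GL (Fin 2) F) : A = B ↔
    A 0 0 = B 0 0 ∧ A 0 1 = B 0 1 ∧ A 1 0 = B 1 0 ∧ A 1 1 = B 1 1 := by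
  constructor
  · rintro rfl; simp
  · rintro ⟨h1, h2, h3, h4⟩
    ext i j
    fin_cases i <;> fin_cases j <;> assumption

theorem upper_mul (a d a' d' : Fˣ) (x x' : F) :
    upper a d x * upper a' d' x' = upper (a * a') (d * d') (a * x' + x * d') := by
  simp [GL_eq_iff, coe_upper, Matrix.mul_apply, Fin.sum_univ_two]

theorem upper_inj {a d a' d' : Fˣ} {x x' : F} :
    upper a d x = upper a' d' x' ↔ a = a' ∧ d = d' ∧ x = x' := by
  simp [coe_upper, Units.ext_iff]
  tauto

theorem upper_mem_borel (a d : Fˣ) (x : F) : upper a d x ∈ borel F := by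
  change (upper a d x : Matrix (Fin 2) (Fin 2) F) 1 0 = 0
  simp [coe_upper]

theorem eq_upper_of_apply_eq_zero {g : GL (Fin 2) F} (hg : g 1 0 = 0) :
    ∃ a d x, g = upper a d x := by
  have hdet : g.1.det ≠ 0 := (Matrix.isUnit_iff_isUnit_det _).1 g.isUnit |>.ne_zero
  rw [Matrix.det_fin_two, hg, mul_zero, sub_zero] at hdet
  refine ⟨Units.mk0 _ (left_ne_zero_of_mul hdet), Units.mk0 _ (right_ne_zero_of_mul hdet),
    g 0 1, ?_⟩
  simp [GL_eq_iff, coe_upper, hg]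

variable (F) in
/-- The entries of an upper triangular matrix. -/
def borelEquiv : Fˣ × Fˣ × F ≃ borel F :=
  Equiv.ofBijective (fun p => ⟨upper p.1 p.2.1 p.2.2, upper_mem_borel _ _ _⟩) (by
    constructor
    · rintro ⟨a, d, x⟩ ⟨a', d', x'⟩ h
      simpa [upper_inj] using congrArg Subtype.val h
    · rintro ⟨g, hg⟩
      obtain ⟨a, d, x, rfl⟩ := eq_upper_of_apply_eq_zero hg
      exact ⟨(a, d, x), rfl⟩)

theorem coe_borelEquiv (p : Fˣ × Fˣ × F) :
    (borelEquiv F p : GL (Fin 2) F) = upper p.1 p.2.1 p.2.2 := rfl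

theorem borelChar_upper (μ₁ μ₂ : Fˣ →* ℂˣ) (p : Fˣ × Fˣ × F) :
    borelChar μ₁ μ₂ (borelEquiv F p) = (μ₁ p.1 : ℂ) * μ₂ p.2.1 := by
  have h0 : borelDiag 0 (borelEquiv F p) = p.1 := by
    ext; simp [borelDiag, coe_borelEquiv, coe_upper]
  have h1 : borelDiag 1 (borelEquiv F p) = p.2.1 := by
    ext; simp [borelDiag, coe_borelEquiv, coe_upper]
  simp [borelChar, toC, h0, h1]

theorem znHom_apply (a : Fˣ) (x : F) :
    znHom F (a, Multiplicative.ofAdd x) = upper a a (a * x) := rfl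

theorem exists_upper_mul_cosetRep (g : GL (Fin 2) F) :
    ∃ a d x o, g = upper a d x * cosetRep 1 o := by
  by_cases hg : g 1 0 = 0
  · obtain ⟨a, d, x, rfl⟩ := eq_upper_of_apply_eq_zero hg
    exact ⟨a, d, x, none, by simp [cosetRep, upper_mul]⟩
  · have hdet : g.1.det ≠ 0 := (Matrix.isUnit_iff_isUnit_det _).1 g.isUnit |>.ne_zero
    rw [Matrix.det_fin_two] at hdet
    -- This entry is -det g / g₁₀.
    have ha : g 0 1 - g 0 0 * (g 1 1 / g 1 0) ≠ 0 := by
      intro h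
      apply hdet
      field_simp at h
      linear_combination -h
    refine ⟨Units.mk0 _ ha, Units.mk0 _ hg, g 0 0, some (g 1 1 / g 1 0), ?_⟩
    simp [GL_eq_iff, coe_upper, cosetRep, coe_bigCell, Matrix.mul_apply, Fin.sum_univ_two]
    field_simp

theorem upper_mul_cosetRep_inj {a d a' d' t t' : Fˣ} {x x' : F} {o o' : Option F}
    (h : upper a d x * cosetRep t o = upper a' d' x' * cosetRep t' o') :
    o = o' ∧ d = d' ∧ a * t = a' * t' := by
  rcases o with _ | y <;> rcases o' with _ | y'
  · simp [cosetRep, upper_mul, upper_inj] at h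
    simp [h]
  · simp [GL_eq_iff, coe_upper, cosetRep, coe_bigCell, Matrix.mul_apply, Fin.sum_univ_two] at h
    exact absurd h.2.2.1.symm d'.ne_zero
  · simp [GL_eq_iff, coe_upper, cosetRep, coe_bigCell, Matrix.mul_apply, Fin.sum_univ_two] at h
  · simp [coe_upper, cosetRep, coe_bigCell, Units.ext_iff] at h ⊢
    obtain ⟨⟨rfl, h2⟩, h3, h4⟩ := h
    rw [h3] at h4
    have h5 : y = y' := by simpa using h4
    subst h5
    exact ⟨rfl, h3, by simpa using h2⟩

theorem borel_mul_cosetRep_bijective :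
    Function.Bijective fun p : borel F × Option F =>
      (borel F).subtype p.1 * cosetRep (1 : Fˣ) p.2 := by
  constructor
  · rintro ⟨b, o⟩ ⟨b', o'⟩ h
    obtain ⟨p, rfl⟩ := (borelEquiv F).surjective b
    obtain ⟨p', rfl⟩ := (borelEquiv F).surjective b'
    obtain ⟨rfl, -⟩ := upper_mul_cosetRep_inj h
    exact Prod.ext (Subtype.ext (mul_right_cancel h)) rfl
  · intro g
    obtain ⟨a, d, x, o, rfl⟩ := exists_upper_mul_cosetRep g
    exact ⟨(borelEquiv F (a, d, x), o), rfl⟩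

theorem cosetRep_eq_mul (t : Fˣ) (o : Option F) : cosetRep t o = upper t 1 0 * cosetRep 1 o := by
  rcases o with _ | x
  · simp [cosetRep, upper_mul]
  · simp [GL_eq_iff, coe_upper, cosetRep, coe_bigCell, Matrix.mul_apply, Fin.sum_univ_two]

theorem znHom_mul_cosetRep_bijective :
    Function.Bijective fun p : (Fˣ × Multiplicative F) × (Fˣ × Option F) =>
      znHom F p.1 * cosetRep p.2.1 p.2.2 := by
  constructor
  · rintro ⟨⟨a, x⟩, t, o⟩ ⟨⟨a', x'⟩, t', o'⟩ h
    have h' : upper a a (a * x.toAdd) * cosetRep t o =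
      upper a' a' (a' * x'.toAdd) * cosetRep t' o' := h
    obtain ⟨rfl, rfl, h1⟩ := upper_mul_cosetRep_inj h'
    obtain rfl : t = t' := mul_left_cancel h1
    have h2 := mul_right_cancel h'
    rw [upper_inj] at h2
    have h3 : x.toAdd = x'.toAdd := by simpa using h2.2.2
    simp [Multiplicative.toAdd.injective h3]
  · intro g
    obtain ⟨a, d, x, o, rfl⟩ := exists_upper_mul_cosetRep g
    -- Modulo the centre the torus is diag(t, 1) with t = a/d. The factor d⁻¹ compensates the
    -- scaling of the upper entry built into `znHom`.
    refine ⟨((d, .ofAdd ((d : F)⁻¹ * x)), (a * d⁻¹, o)), ?_⟩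
    dsimp only
    rw [znHom_apply, cosetRep_eq_mul, ← mul_assoc, upper_mul]
    congr 1
    simp

variable [Finite F]

-- The trivial coset contributes μ₁(a)μ₂(d). The coset of the big cell with parameter x is fixed
-- exactly when y + xd = xa, and then contributes the swapped character.
open Classical in
theorem character_principal_upper [Fintype F] (μ₁ μ₂ : Fˣ →* ℂˣ) (a d : Fˣ) (y : F) :
    (principal μ₁ μ₂).character (upper a d y) = (μ₁ a : ℂ) * μ₂ d +
      (∑ x : F, if y + x * d = x * a then 1 else 0) * ((μ₁ d : ℂ) * μ₂ a) := by
  let _ : Fintype (borel F) := Fintype.ofFinite _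
  rw [principal, character_coind_of_bijective _ _ _ borel_mul_cosetRep_bijective,
    Fintype.sum_option, Finset.sum_mul]
  congr 1
  · rw [Finset.sum_eq_single (borelEquiv F (a, d, y))]
    · rw [if_pos, borelChar_upper]
      simp [cosetRep, coe_borelEquiv, upper_mul]
    · intro b _ hb
      rw [if_neg]
      intro h
      apply hb
      apply Subtype.ext
      have h1 : cosetRep (1 : Fˣ) (none : Option F) = 1 := by
        simp [cosetRep, GL_eq_iff, coe_upper]
      rw [h1, mul_one, one_mul] at h
      exact h.symm
    · simp
  · refine Finset.sum_congr rfl fun x _ => ?_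
    rw [Finset.sum_eq_single (borelEquiv F (d, a, 0)), borelChar_upper, ite_mul, one_mul, zero_mul]
    · congr 1
      simp [GL_eq_iff, coe_upper, cosetRep, coe_bigCell, Matrix.mul_apply, Fin.sum_univ_two,
        coe_borelEquiv]
      simp [mul_comm]
    · intro b _ hb
      rw [if_neg]
      intro h
      apply hb
      obtain ⟨⟨a', d', x'⟩, rfl⟩ := (borelEquiv F).surjective b
      simp [GL_eq_iff, coe_upper, cosetRep, coe_bigCell, Matrix.mul_apply, Fin.sum_univ_two,
        coe_borelEquiv] at h
      obtain ⟨h1, h2, h3, h4⟩ := h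
      simp only [EmbeddingLike.apply_eq_iff_eq, Prod.mk.injEq, Units.ext_iff]
      refine ⟨?_, h3.symm, h1.symm⟩
      rw [← h1] at h2
      simpa using h2.symm
    · simp

-- The coset of diag(t, 1) contributes ω(a)ψ(ty). The big-cell cosets are fixed only when the matrix
-- is scalar, that is y = 0, and then each of the q of them contributes ω(a).
open Classical in
theorem character_zn_upper [Fintype F] (ψ : AddChar F ℂ) (ω : Fˣ →* ℂ) (a : Fˣ) (y : F) :
    (coind (znHom F) (charRep (ω.coprod ψ.toMonoidHom))).character (upper a a (a * y)) =
      ω a * ∑ t : Fˣ, (ψ (t * y) + if y = 0 then (Fintype.card F : ℂ) else 0) := by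
  let _ : Fintype (Multiplicative F) := Fintype.ofFinite _
  rw [character_coind_of_bijective (T := Fˣ × Option F) (znHom F) (ω.coprod ψ.toMonoidHom)
    (fun p => cosetRep p.1 p.2) znHom_mul_cosetRep_bijective, Fintype.sum_prod_type,
    Finset.mul_sum]
  refine Finset.sum_congr rfl fun t _ => ?_
  rw [Fintype.sum_option, mul_add]
  congr 1
  · rw [Finset.sum_eq_single (a, .ofAdd (t * y)), if_pos]
    · rfl
    · rw [znHom_apply]
      simp only [cosetRep, upper_mul, upper_inj]
      refine ⟨mul_comm _ _, mul_comm _ _, ?_⟩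
      simp; ring
    · rintro ⟨a', x⟩ _ hb
      rw [if_neg]
      intro h
      apply hb
      have h' : cosetRep t none * upper a a (a * y) =
        upper a' a' (a' * x.toAdd) * cosetRep t none := h
      simp only [cosetRep, upper_mul, upper_inj] at h'
      obtain ⟨h1, h2, h3⟩ := h'
      obtain rfl : a = a' := by simpa using h2
      refine Prod.ext rfl (Multiplicative.toAdd.injective ?_)
      have h4 : (a : F) * (t * y) = a * x.toAdd := by simpa [mul_left_comm] using h3
      exact (mul_left_cancel₀ a.ne_zero h4).symm
    · simp
  · have key (x : F) : (∑ h, if cosetRep t (some x) * upper a a (a * y) =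
        znHom F h * cosetRep t (some x) then ω.coprod ψ.toMonoidHom h else 0) =
        if y = 0 then ω a else 0 := by
      rw [Finset.sum_eq_single (a, .ofAdd 0)]
      · have : ω.coprod ψ.toMonoidHom (a, Multiplicative.ofAdd (0 : F)) = ω a := by
          simp
        rw [this]
        congr 1
        rw [znHom_apply]
        simp [GL_eq_iff, coe_upper, cosetRep, coe_bigCell, Matrix.mul_apply, Fin.sum_univ_two]
        simp [mul_comm]
      · rintro ⟨a', z⟩ _ hb
        rw [if_neg]
        intro h
        apply hb
        have h' : cosetRep t (some x) * upper a a (a * y) =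
          upper a' a' (a' * z.toAdd) * cosetRep t (some x) := h
        simp [GL_eq_iff, coe_upper, cosetRep, coe_bigCell, Matrix.mul_apply, Fin.sum_univ_two]
          at h'
        obtain ⟨h1, h2, h3, h4⟩ := h'
        refine Prod.ext (Units.ext h3.symm) (Multiplicative.toAdd.injective ?_)
        exact h1
      · simp
    simp only [key]
    split_ifs <;> simp [mul_comm]

end Matrices

/-! ### Pairings with representations induced from B and from ZN. -/

section Borel

variable {F : Type*} [Field F] [Fintype F]

theorem sum_addChar_unit_mul {ψ : AddChar F ℂ} (hψ : ψ ≠ 1) [Fintype Fˣ] {y : F} (hy : y ≠ 0) :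
    ∑ t : Fˣ, ψ (t * y) = -1 := by
  classical
  have h1 : ∑ x : F, ψ (x * y) = 0 := by
    rw [← AddChar.sum_eq_zero_of_ne_one hψ]
    exact Equiv.sum_comp (Equiv.mulRight₀ y hy) ψ
  have h2 : ∑ x : {x : F // x ≠ 0}, ψ (x * y) = ∑ t : Fˣ, ψ (t * y) :=
    (Fintype.sum_equiv unitsEquivNeZero _ _ fun t => rfl).symm
  rw [← h2]
  rw [← Fintype.sum_subtype_add_sum_subtype (fun x : F => x = 0) fun x => ψ (x * y)] at h1
  have h3 : ∑ x : {x : F // x = 0}, ψ (x * y) = 1 := by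
    rw [Finset.sum_congr rfl (g := fun _ => 1) fun x _ => by rw [x.2]; simp]
    simp
  rw [eq_neg_iff_add_eq_zero, ← h3, add_comm, ← h1]
  congr!

theorem avg_addChar {ψ : AddChar F ℂ} (hψ : ψ ≠ 1) :
    avg (fun x : Multiplicative F => ψ x.toAdd) = 0 := by
  let _ : Fintype (Multiplicative F) := Fintype.ofFinite _
  rw [avg_eq_sum]
  have : ∑ x : Multiplicative F, ψ x.toAdd = ∑ x : F, ψ x :=
    Fintype.sum_equiv Multiplicative.toAdd _ _ fun _ => rfl
  rw [this, AddChar.sum_eq_zero_of_ne_one hψ, mul_zero]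

open Classical in
theorem avg_single_zero (c : ℂ) (f : Multiplicative F → ℂ) :
    avg (fun x : Multiplicative F => f x * if x.toAdd = 0 then c else 0) =
      (Fintype.card F : ℂ)⁻¹ * (f 1 * c) := by
  let _ : Fintype (Multiplicative F) := Fintype.ofFinite _
  have hc : Fintype.card (Multiplicative F) = Fintype.card F :=
    Fintype.card_congr Multiplicative.toAdd
  rw [avg_eq_sum, hc, Finset.sum_eq_single 1]
  · simp
  · intro x _ hx
    rw [if_neg, mul_zero]
    exact fun h => hx (Multiplicative.toAdd.injective h)
  · simp

-- The principal series and ZN-induced characters are, on each coset aN of a scalar a, a delta at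
-- the scalar plus a constant, up to a factor. Pairing with a nontrivial ψ kills the constant and
-- keeps the delta.
open Classical in
theorem avg_addChar_mul {ψ : AddChar F ℂ} (hψ : ψ ≠ 1) (c A B : ℂ) :
    avg (fun x : Multiplicative F => ψ x.toAdd * (c * ((if x.toAdd = 0 then A else 0) + B))) =
      c * ((Fintype.card F : ℂ)⁻¹ * A) := by
  have h (x : Multiplicative F) :
      ψ x.toAdd * (c * ((if x.toAdd = 0 then A else 0) + B)) =
        (c * ψ x.toAdd) * (if x.toAdd = 0 then A else 0) + (c * B) * ψ x.toAdd := by ring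
  have h2 (f f' : Multiplicative F → ℂ) : avg (fun a => f a + f' a) = avg f + avg f' :=
    avg_add f f'
  simp only [h]
  rw [h2, avg_mul_left (c * B), avg_addChar hψ, avg_single_zero A fun x => c * ψ x.toAdd]
  simp
  ring

theorem card_units_cast : (Nat.card Fˣ : ℂ) = Fintype.card F - 1 := by
  classical
  rw [Nat.card_eq_fintype_card, Fintype.card_units, Nat.cast_sub Fintype.card_pos]
  simp

open Classical in
theorem character_zn_znHom {ψ : AddChar F ℂ} (hψ : ψ ≠ 1) (ω : Fˣ →* ℂ)
    (a : Fˣ) (y : Multiplicative F) :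
    (coind (znHom F) (charRep (ω.coprod ψ.toMonoidHom))).character (znHom F (a, y)) =
      ω a * ((if y.toAdd = 0 then (Fintype.card F : ℂ) ^ 2 else 0) - 1) := by
  change (coind (znHom F) (charRep (ω.coprod ψ.toMonoidHom))).character
    (upper a a (a * y.toAdd)) = _
  rw [character_zn_upper]
  congr 1
  split_ifs with hy
  · simp only [hy, mul_zero, AddChar.map_zero_eq_one, Finset.sum_const, Finset.card_univ,
      nsmul_eq_mul, ← Nat.card_eq_fintype_card (α := Fˣ), card_units_cast]
    ring
  · simp only [add_zero, sum_addChar_unit_mul hψ hy]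
    ring

open Classical in
theorem character_principal_znHom (μ₁ μ₂ : Fˣ →* ℂˣ) (a : Fˣ) (y : Multiplicative F) :
    (principal μ₁ μ₂).character (znHom F (a, y)) =
      ((μ₁ a : ℂ) * μ₂ a) * ((if y.toAdd = 0 then (Fintype.card F : ℂ) else 0) + 1) := by
  change (principal μ₁ μ₂).character (upper a a (a * y.toAdd)) = _
  rw [character_principal_upper]
  have h (x : F) : (a * y.toAdd + x * (a : F) = x * a) ↔ y.toAdd = 0 := by simp
  simp only [h]
  split_ifs <;> simp; ring

/-- Each x satisfies y + xd = xa for exactly one y, so the fixed-point counts sum to q for every a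
and d. The two terms are those of the Jacquet module. -/
theorem avg_character_principal_upper (μ₁ μ₂ : Fˣ →* ℂˣ) (a d : Fˣ) :
    avg (fun x : F => (principal μ₁ μ₂).character (upper a d x)) =
      (μ₁ a : ℂ) * μ₂ d + (μ₁ d : ℂ) * μ₂ a := by
  classical
  simp only [character_principal_upper]
  have h : ∑ y : F, ∑ x : F, (if y + x * (d : F) = x * a then (1 : ℂ) else 0) =
      Fintype.card F := by
    rw [Finset.sum_comm]
    simp [← eq_sub_iff_add_eq]
  simp only [avg_eq_sum, Finset.sum_add_distrib, ← Finset.sum_mul, h]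
  simp
  field_simp

theorem avg_borel (f : borel F → ℂ) :
    avg f = avg fun a : Fˣ => avg fun d : Fˣ => avg fun x : F => f (borelEquiv F (a, d, x)) := by
  rw [← avg_comp_equiv (borelEquiv F), avg_prod]
  congr 1; ext a
  exact avg_prod _

theorem pair_principal (μ₁ μ₂ : Fˣ →* ℂˣ) (f : GL (Fin 2) F → ℂ)
    (hf : ∀ g s, f (s * g * s⁻¹) = f g) :
    pair (principal μ₁ μ₂).character f = avg fun a : Fˣ => avg fun d : Fˣ =>
      ((μ₁ a : ℂ) * μ₂ d) * avg fun x : F => f (upper a d x) := by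
  rw [principal, pair_coind _ _ _ hf, avg_borel]
  simp only [borelChar_upper, avg_mul_left]
  rfl

theorem pair_zn (ψ : AddChar F ℂ) (ω : Fˣ →* ℂ) (f : GL (Fin 2) F → ℂ)
    (hf : ∀ g s, f (s * g * s⁻¹) = f g) :
    pair (coind (znHom F) (charRep (ω.coprod ψ.toMonoidHom))).character f =
      avg fun a : Fˣ => ω a * avg fun x : Multiplicative F => ψ x.toAdd * f (znHom F (a, x)) := by
  rw [pair_coind _ _ _ hf, avg_prod]
  simp only [MonoidHom.coprod_apply, mul_assoc, avg_mul_left]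
  rfl

-- The two terms are the two double cosets of B in Mackey's formula. After averaging over N, only
-- orthogonality of characters of Fˣ is left.
open Classical in
theorem pair_principal_principal (μ₁ μ₂ μ₁' μ₂' : Fˣ →* ℂˣ) :
    pair (principal μ₁ μ₂).character (principal μ₁' μ₂').character =
      (if μ₁ * μ₁' = 1 ∧ μ₂ * μ₂' = 1 then 1 else 0) +
        if μ₁ * μ₂' = 1 ∧ μ₂ * μ₁' = 1 then 1 else 0 := by
  rw [pair_principal _ _ _ fun g s => char_conj _ _ _]
  simp only [avg_character_principal_upper]
  have h1 (a d : Fˣ) : ((μ₁ a : ℂ) * μ₂ d) * ((μ₁' a : ℂ) * μ₂' d + (μ₁' d : ℂ) * μ₂' a) =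
      ((μ₁ * μ₁') a : ℂˣ) * ((μ₂ * μ₂') d : ℂˣ) + ((μ₁ * μ₂') a : ℂˣ) * ((μ₂ * μ₁') d : ℂˣ) := by
    simp; ring
  have h2 (f f' : Fˣ → ℂ) : avg (fun a => f a + f' a) = avg f + avg f' := avg_add f f'
  simp only [h1, h2, avg_mul_left, avg_mul_right, avg_character]
  split_ifs <;> simp_all

omit [Fintype F] in
theorem character_chi (μ : Fˣ →* ℂˣ) (g : GL (Fin 2) F) :
    (chi μ).character g = μ (GeneralLinearGroup.det g) := by
  rw [chi, character_charRep]; rfl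

omit [Fintype F] in
theorem det_upper (a d : Fˣ) (x : F) : GeneralLinearGroup.det (upper a d x) = a * d := by
  ext; simp [coe_upper]

open Classical in
theorem pair_principal_chi (μ₁ μ₂ μ : Fˣ →* ℂˣ) :
    pair (principal μ₁ μ₂).character (chi μ).character =
      if μ₁ * μ = 1 ∧ μ₂ * μ = 1 then 1 else 0 := by
  rw [pair_principal _ _ _ fun g s => char_conj _ _ _]
  simp only [character_chi, det_upper, avg_const]
  have h1 (a d : Fˣ) : ((μ₁ a : ℂ) * μ₂ d) * (μ (a * d) : ℂˣ) =
      ((μ₁ * μ) a : ℂˣ) * ((μ₂ * μ) d : ℂˣ) := by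
    simp; ring
  simp only [h1, avg_mul_left, avg_mul_right, avg_character]
  split_ifs <;> simp_all

omit [Fintype F] in
theorem det_surjective : Function.Surjective (GeneralLinearGroup.det : GL (Fin 2) F →* Fˣ) :=
  fun a => ⟨upper a 1 0, by rw [det_upper, mul_one]⟩

open Classical in
theorem pair_chi_chi (μ μ' : Fˣ →* ℂˣ) :
    pair (chi μ).character (chi μ').character = if μ * μ' = 1 then 1 else 0 := by
  rw [← avg_character, ← avg_comp_surjective _ (det_surjective (F := F)), pair]
  simp [character_chi]

-- ψ-Whittaker functionals on a principal series have multiplicity one, so only the compatibility of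
-- central characters matters.
open Classical in
theorem pair_zn_principal {ψ : AddChar F ℂ} (hψ : ψ ≠ 1) (ω μ₁ μ₂ : Fˣ →* ℂˣ) :
    pair (coind (znHom F) (charRep ((toC ω).coprod ψ.toMonoidHom))).character
      (principal μ₁ μ₂).character = if ω * μ₁ * μ₂ = 1 then 1 else 0 := by
  rw [pair_zn _ _ _ fun g s => char_conj _ _ _]
  have h1 (a : Fˣ) : avg (fun x : Multiplicative F => ψ x.toAdd *
      (principal μ₁ μ₂).character (znHom F (a, x))) = (μ₁ a : ℂ) * μ₂ a := by
    simp only [character_principal_znHom, avg_addChar_mul hψ]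
    simp
  simp only [h1]
  rw [← avg_character]
  congr 1; ext a
  simp [toC, mul_assoc]

theorem pair_zn_chi {ψ : AddChar F ℂ} (hψ : ψ ≠ 1) (ω μ : Fˣ →* ℂˣ) :
    pair (coind (znHom F) (charRep ((toC ω).coprod ψ.toMonoidHom))).character
      (chi μ).character = 0 := by
  rw [pair_zn _ _ _ fun g s => char_conj _ _ _]
  have h (a : Fˣ) (x : Multiplicative F) : (chi μ).character (znHom F (a, x)) =
      μ (a * a) := by
    rw [character_chi]; exact congrArg (fun t => (μ t : ℂ)) (det_upper _ _ _)
  simp only [h, avg_mul_right, avg_addChar hψ, zero_mul, mul_zero, avg_const]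

open Classical in
theorem pair_zn_zn {ψ ψ' : AddChar F ℂ} (hψ : ψ ≠ 1) (hψ' : ψ' ≠ 1) (ω ω' : Fˣ →* ℂˣ) :
    pair (coind (znHom F) (charRep ((toC ω).coprod ψ.toMonoidHom))).character
      (coind (znHom F) (charRep ((toC ω').coprod ψ'.toMonoidHom))).character =
      if ω * ω' = 1 then (Fintype.card F : ℂ) else 0 := by
  rw [pair_zn _ _ _ fun g s => char_conj _ _ _]
  have h1 (a : Fˣ) : avg (fun x : Multiplicative F => ψ x.toAdd *
      (coind (znHom F) (charRep ((toC ω').coprod ψ'.toMonoidHom))).character (znHom F (a, x))) =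
      ω' a * Fintype.card F := by
    simp only [character_zn_znHom hψ', sub_eq_add_neg, avg_addChar_mul hψ]
    simp only [toC, MonoidHom.comp_apply, Units.coeHom_apply]
    field_simp
  simp only [h1, ← mul_assoc, avg_mul_right]
  have h3 (a : Fˣ) : toC ω a * (ω' a : ℂ) = ((ω * ω') a : ℂˣ) := by simp [toC]
  simp only [h3, avg_character, ite_mul, one_mul, zero_mul]

end Borel

/-! ### The embedded torus Eˣ: centralizers and conjugacy. -/

section Torus

variable {F : Type*} [Field F] [Fintype F] {E : Type*} [Field E] [Algebra F E] [Finite E]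
  (b : Module.Basis (Fin 2) F E)

/-- The inclusion of `Fˣ` in `Eˣ`. -/
abbrev inc (F E : Type*) [Field F] [Field E] [Algebra F E] : Fˣ →* Eˣ :=
  Units.map (algebraMap F E : F →* E)

omit [Fintype F] [Finite E] in
theorem inc_injective : Function.Injective (inc F E) := fun _ _ h =>
  Units.ext ((algebraMap F E).injective (congrArg Units.val h))

omit [Fintype F] [Finite E] in
theorem torusHom_injective : Function.Injective (torusHom b) := fun _ _ h =>
  Units.ext (Algebra.leftMulMatrix_injective b (congrArg Units.val h))

omit [Fintype F] [Finite E] in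
theorem coe_torusHom (e : Eˣ) :
    (torusHom b e : Matrix (Fin 2) (Fin 2) F) = Algebra.leftMulMatrix b (e : E) := rfl

omit [Fintype F] [Finite E] in
theorem torusHom_inc (a : Fˣ) : torusHom b (inc F E a) = upper a a 0 := by
  apply Units.ext
  change Algebra.leftMulMatrix b (algebraMap F E a) = _
  rw [AlgHom.commutes, coe_upper]
  ext i j
  fin_cases i <;> fin_cases j <;> simp [Matrix.algebraMap_matrix_apply]

omit [Fintype F] in
theorem upper_scalar_comm (a : Fˣ) (s : GL (Fin 2) F) : s * upper a a 0 = upper a a 0 * s := by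
  simp [GL_eq_iff, coe_upper, Matrix.mul_apply, Fin.sum_univ_two, mul_comm]

omit [Fintype F] [Finite E] in
/-- An element of `Eˣ` conjugate to an upper triangular matrix is in `Fˣ`. -/
theorem exists_eq_inc {e : Eˣ} {s h : GL (Fin 2) F} (hs : s * torusHom b e = h * s)
    (hh : h 1 0 = 0) : ∃ a, e = inc F E a := by
  obtain ⟨a, d, x, rfl⟩ := eq_upper_of_apply_eq_zero hh
  -- Since d is an eigenvalue of the triangular matrix, e - d acts singularly on E. Its norm is
  -- therefore 0, and e = d.
  have h1 : (s : Matrix (Fin 2) (Fin 2) F) * Algebra.leftMulMatrix b ((e : E) - algebraMap F E d) =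
      (upper a d x - algebraMap F _ (d : F)) * s := by
    have h2 : (s : Matrix (Fin 2) (Fin 2) F) * Algebra.leftMulMatrix b (e : E) =
      upper a d x * s := congrArg Units.val hs
    rw [map_sub, mul_sub, sub_mul, h2, AlgHom.commutes, ← Algebra.commutes]
  have h3 : (upper a d x - algebraMap F (Matrix (Fin 2) (Fin 2) F) (d : F)).det = 0 := by
    rw [Matrix.det_fin_two]
    simp [coe_upper, Matrix.algebraMap_matrix_apply]
  have h4 := congrArg Matrix.det h1
  rw [Matrix.det_mul, Matrix.det_mul, h3, zero_mul, ← Algebra.norm_eq_matrix_det] at h4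
  have h5 : s.1.det ≠ 0 := ((Matrix.isUnit_iff_isUnit_det _).1 s.isUnit).ne_zero
  have : Module.Finite F E := Module.Finite.of_basis b
  have h6 := Algebra.norm_eq_zero_iff.1 ((mul_eq_zero.1 h4).resolve_left h5)
  exact ⟨d, Units.ext (sub_eq_zero.1 h6)⟩

omit [Finite E] in
include b in
theorem card_E : Nat.card E = Fintype.card F ^ 2 := by
  have : Module.Finite F E := Module.Finite.of_basis b
  rw [Module.natCard_eq_pow_finrank (K := F), Module.finrank_eq_card_basis b,
    Nat.card_eq_fintype_card, Fintype.card_fin]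

include b in
theorem card_units_E : (Nat.card Eˣ : ℂ) = (Fintype.card F : ℂ) ^ 2 - 1 := by
  have : Fintype E := Fintype.ofFinite E
  rw [card_units_cast, ← Nat.card_eq_fintype_card, card_E b]
  push_cast; rfl

theorem card_F_sub_one_ne_zero : (Fintype.card F : ℂ) - 1 ≠ 0 := by
  have : 1 < Fintype.card F := Fintype.one_lt_card
  rw [sub_ne_zero]
  exact_mod_cast this.ne'

omit [Field F] in
theorem card_F_add_one_ne_zero : (Fintype.card F : ℂ) + 1 ≠ 0 := by
  exact_mod_cast Nat.succ_ne_zero (Fintype.card F)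

theorem card_F_ne_zero : (Fintype.card F : ℂ) ≠ 0 := by simp

theorem card_GL : (Nat.card (GL (Fin 2) F) : ℂ) =
    ((Fintype.card F : ℂ) ^ 2 - 1) * ((Fintype.card F : ℂ) ^ 2 - Fintype.card F) := by
  rw [Matrix.card_GL_field, Fin.prod_univ_two]
  have h1 : 1 ≤ Fintype.card F ^ 2 := Nat.one_le_pow _ _ Fintype.card_pos
  have h2 : Fintype.card F ≤ Fintype.card F ^ 2 := Nat.le_self_pow (by norm_num) _
  simp [Nat.cast_sub h1, Nat.cast_sub h2]

-- The factor is the inverse of the index q + 1 of Fˣ in Eˣ.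
include b in
theorem avg_units_of_support (f : Eˣ → ℂ) (hf : ∀ e, (∀ a, e ≠ inc F E a) → f e = 0) :
    avg f = ((Fintype.card F : ℂ) + 1)⁻¹ * avg fun a : Fˣ => f (inc F E a) := by
  rw [avg_eq_of_support (inc_injective (F := F) (E := E)) f, card_units_cast, card_units_E b]
  · congr 1
    have h1 := card_F_sub_one_ne_zero (F := F)
    have h2 := card_F_add_one_ne_zero (F := F)
    rw [show (Fintype.card F : ℂ) ^ 2 - 1 = (Fintype.card F - 1) * (Fintype.card F + 1) by ring]
    field_simp
  · exact fun e he => hf e fun a h => he ⟨a, h.symm⟩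

include b in
theorem algebraMap_norm (e : E) : algebraMap F E (Algebra.norm F e) = e * e ^ Fintype.card F := by
  rw [FiniteField.algebraMap_norm_eq_prod_pow, Module.finrank_eq_card_basis b]
  simp [Finset.prod_range_succ]

include b in
theorem algebraMap_trace (e : E) : algebraMap F E (Algebra.trace F E e) = e + e ^ Fintype.card F := by
  rw [FiniteField.algebraMap_trace_eq_sum_pow, Module.finrank_eq_card_basis b]
  simp [Finset.sum_range_succ]

-- The q elements of F already exhaust the roots that X^q - X can have in E.
omit [Finite E] in
theorem exists_algebraMap_of_pow_eq {e : E} (he : e ^ Fintype.card F = e) :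
    ∃ a, e = algebraMap F E a := by
  classical
  by_contra! hne
  have hP : (Polynomial.X ^ Fintype.card F - Polynomial.X : Polynomial E) ≠ 0 :=
    FiniteField.X_pow_card_sub_X_ne_zero E Fintype.one_lt_card
  have hsub : insert e (Finset.univ.image (algebraMap F E)) ⊆
      (Polynomial.X ^ Fintype.card F - Polynomial.X : Polynomial E).roots.toFinset := by
    intro x hx
    rw [Multiset.mem_toFinset, Polynomial.mem_roots hP]
    rcases Finset.mem_insert.1 hx with rfl | hx
    · simp [he]
    · obtain ⟨a, -, rfl⟩ := Finset.mem_image.1 hx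
      simp [← map_pow, FiniteField.pow_card]
  have h1 := (Finset.card_le_card hsub).trans (Multiset.toFinset_card_le _)
  have h2 := h1.trans (Polynomial.card_roots' _)
  rw [FiniteField.X_pow_card_sub_X_natDegree_eq E Fintype.one_lt_card, Finset.card_insert_of_notMem
    (by simpa using fun a => (hne a).symm), Finset.card_image_of_injective _
    (algebraMap F E).injective, Finset.card_univ] at h2
  omega

omit [Finite E] in
theorem exists_inc_of_pow_eq {e : Eˣ} (he : e ^ Fintype.card F = e) : ∃ a, e = inc F E a := by
  obtain ⟨a, ha⟩ := exists_algebraMap_of_pow_eq (F := F) (e := (e : E))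
    (by rw [← Units.val_pow_eq_pow_val, he])
  have h0 : a ≠ 0 := by rintro rfl; exact e.ne_zero (by rw [ha, map_zero])
  exact ⟨Units.mk0 a h0, Units.ext ha⟩

omit [Fintype F] [Finite E] in
/-- The centralizer of an element of `Eˣ` outside `Fˣ` is `Eˣ`. -/
theorem exists_eq_torusHom {e : Eˣ} (he : ∀ a, e ≠ inc F E a) {s : GL (Fin 2) F}
    (hs : s * torusHom b e = torusHom b e * s) : ∃ k, s = torusHom b k := by
  have : Module.Finite F E := Module.Finite.of_basis b
  have hfin : Module.finrank F E = 2 := by simp [Module.finrank_eq_card_basis b]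
  have : IsSimpleOrder (Subalgebra F E) :=
    Subalgebra.isSimpleOrder_of_finrank_prime F E (hfin ▸ Nat.prime_two)
  let S : E →ₗ[F] E := Matrix.toLin b b s
  have hS : Matrix.toLin b b (Algebra.leftMulMatrix b (e : E)) = Algebra.lmul F E (e : E) := by
    rw [Algebra.leftMulMatrix_apply, Matrix.toLin_toMatrix]
  have hcomm (v : E) : S (e * v) = e * S v := by
    have h1 : (s : Matrix (Fin 2) (Fin 2) F) * Algebra.leftMulMatrix b (e : E) =
      Algebra.leftMulMatrix b (e : E) * s := congrArg Units.val hs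
    have h2 := congrArg (fun M => Matrix.toLin b b M v) h1
    simp only [Matrix.toLin_mul b b b, hS] at h2
    exact h2
  -- The elements over which S is linear form a subalgebra containing e. As [E : F] is prime and e
  -- is not in F, it is all of E, so S is multiplication by S(1).
  let A : Subalgebra F E :=
    { carrier := {v | ∀ w, S (v * w) = v * S w}
      mul_mem' := fun {x y} hx hy w => by rw [mul_assoc, hx, hy, mul_assoc]
      add_mem' := fun {x y} hx hy w => by rw [add_mul, map_add, hx, hy, add_mul]
      algebraMap_mem' := fun r w => by rw [← Algebra.smul_def, map_smul, Algebra.smul_def] }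
  have hA : A = ⊤ := by
    refine (eq_bot_or_eq_top A).resolve_left fun hbot => ?_
    have heA : (e : E) ∈ A := hcomm
    rw [hbot, Algebra.mem_bot] at heA
    obtain ⟨a, ha⟩ := heA
    have h0 : a ≠ 0 := by rintro rfl; exact e.ne_zero (by rw [← ha, map_zero])
    exact he (Units.mk0 a h0) (Units.ext ha.symm)
  have hSv (v : E) : S v = S 1 * v := by
    have : v ∈ A := hA ▸ Algebra.mem_top
    have := this 1
    rw [mul_one] at this
    rw [this, mul_comm]
  have hs1 : (s : Matrix (Fin 2) (Fin 2) F) = Algebra.leftMulMatrix b (S 1) := by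
    rw [Algebra.leftMulMatrix_apply, ← LinearMap.toMatrix_toLin b b (s : Matrix (Fin 2) (Fin 2) F)]
    congr 1
    exact LinearMap.ext hSv
  have hne : S 1 ≠ 0 := by
    intro h0
    rw [h0, map_zero] at hs1
    exact s.ne_zero hs1
  exact ⟨Units.mk0 _ hne, Units.ext hs1⟩

/-- The matrix of the Frobenius automorphism of `E`. -/
theorem exists_frobenius : ∃ s : GL (Fin 2) F, ∀ e : Eˣ,
    s * torusHom b e = torusHom b (e ^ Fintype.card F) * s := by
  have : Module.Finite F E := Module.Finite.of_basis b
  let σ := (FiniteField.frobeniusAlgEquivOfAlgebraic F E).toLinearEquiv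
  have hσ (v : E) : σ v = v ^ Fintype.card F := rfl
  refine ⟨⟨LinearMap.toMatrix b b σ, LinearMap.toMatrix b b σ.symm, ?_, ?_⟩, fun e => ?_⟩
  · rw [← LinearMap.toMatrix_comp b b b]; simp
  · rw [← LinearMap.toMatrix_comp b b b]; simp
  · apply Units.ext
    change LinearMap.toMatrix b b σ * Algebra.leftMulMatrix b (e : E) =
      Algebra.leftMulMatrix b ((e ^ Fintype.card F : Eˣ) : E) * LinearMap.toMatrix b b σ
    rw [Algebra.leftMulMatrix_apply, Algebra.leftMulMatrix_apply,
      ← LinearMap.toMatrix_comp b b b, ← LinearMap.toMatrix_comp b b b]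
    congr 1
    refine LinearMap.ext fun v => ?_
    change ((e : E) * v) ^ Fintype.card F = _
    simp [hσ, mul_pow]

/-- Elements of `Eˣ` conjugate in `G` are conjugate over `F`. -/
theorem eq_or_eq_pow_of_conj {e e' : Eˣ} {s : GL (Fin 2) F}
    (hs : s * torusHom b e = torusHom b e' * s) : e' = e ∨ e' = e ^ Fintype.card F := by
  have h1 : (s : Matrix (Fin 2) (Fin 2) F) * Algebra.leftMulMatrix b (e : E) =
    Algebra.leftMulMatrix b (e' : E) * s := congrArg Units.val hs
  have h2 : Algebra.leftMulMatrix b (e' : E) =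
      s * Algebra.leftMulMatrix b (e : E) * (s⁻¹ : GL (Fin 2) F) := by
    rw [h1, mul_assoc, ← Units.val_mul, mul_inv_cancel, Units.val_one, mul_one]
  have hdet : Algebra.norm F (e' : E) = Algebra.norm F (e : E) := by
    rw [Algebra.norm_eq_matrix_det b, Algebra.norm_eq_matrix_det b, h2, Matrix.det_mul,
      Matrix.det_mul, mul_right_comm, ← Matrix.det_mul, ← Units.val_mul, mul_inv_cancel]
    simp
  have htr : Algebra.trace F E (e' : E) = Algebra.trace F E (e : E) := by
    rw [Algebra.trace_eq_matrix_trace b, Algebra.trace_eq_matrix_trace b, h2,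
      Matrix.trace_mul_comm, ← mul_assoc, ← Units.val_mul, inv_mul_cancel]
    simp
  have hdet' := congrArg (algebraMap F E) hdet
  have htr' := congrArg (algebraMap F E) htr
  rw [algebraMap_norm b, algebraMap_norm b] at hdet'
  rw [algebraMap_trace b, algebraMap_trace b] at htr'
  -- Conjugate elements share trace and norm, so e' is a root of the characteristic polynomial (X -
  -- e)(X - e^q).
  have h3 : ((e' : E) - e) * (e' - (e : E) ^ Fintype.card F) = 0 := by
    linear_combination (e' : E) * htr' - hdet'
  rcases mul_eq_zero.1 h3 with h | h
  · exact Or.inl (Units.ext (sub_eq_zero.1 h))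
  · exact Or.inr (Units.ext (by simpa [sub_eq_zero] using h))

end Torus

/-! ### Characters induced from Eˣ and their pairings. -/

section TorusValues

variable {F : Type*} [Field F] [Fintype F] {E : Type*} [Field E] [Algebra F E] [Finite E]
  (b : Module.Basis (Fin 2) F E)

theorem character_torus_inc (ν : Eˣ →* ℂˣ) (a : Fˣ) :
    (coind (torusHom b) (charRep (toC ν))).character (torusHom b (inc F E a)) =
      ((Fintype.card F : ℂ) ^ 2 - Fintype.card F) * resF F ν a := by
  rw [character_coind_central _ _ (torusHom_injective b), card_GL, card_units_E b]
  · have h1 : (Fintype.card F : ℂ) ^ 2 - 1 ≠ 0 := by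
      rw [show (Fintype.card F : ℂ) ^ 2 - 1 = (Fintype.card F - 1) * (Fintype.card F + 1) by ring]
      exact mul_ne_zero card_F_sub_one_ne_zero card_F_add_one_ne_zero
    field_simp
    rfl
  · intro s
    rw [torusHom_inc, upper_scalar_comm]

/-- The elements conjugating e into the torus send it to e or to e^q. The first kind form the
centralizer Eˣ and the second its translate by the Frobenius matrix, so each has |Eˣ| elements. -/
theorem character_torus_of_ne (ν : Eˣ →* ℂˣ) {e : Eˣ} (he : ∀ a, e ≠ inc F E a) :
    (coind (torusHom b) (charRep (toC ν))).character (torusHom b e) =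
      (ν e : ℂ) + ν (e ^ Fintype.card F) := by
  classical
  have : Fintype Eˣ := Fintype.ofFinite _
  obtain ⟨s₀, hs₀⟩ := exists_frobenius b
  have hne : e ^ Fintype.card F ≠ e := fun h => by
    obtain ⟨a, ha⟩ := exists_inc_of_pow_eq h
    exact he a ha
  have h1 (s : GL (Fin 2) F) :
      (∑ h, if s * torusHom b e = torusHom b h * s then toC ν h else 0) =
      (if s * torusHom b e = torusHom b e * s then (ν e : ℂ) else 0) +
        if s * torusHom b e = torusHom b (e ^ Fintype.card F) * s
          then (ν (e ^ Fintype.card F) : ℂ) else 0 := by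
    rw [← Finset.sum_subset (Finset.subset_univ {e, e ^ Fintype.card F}),
      Finset.sum_pair hne.symm]
    · rfl
    · intro h _ hh
      rw [if_neg]
      intro hc
      apply hh
      rcases eq_or_eq_pow_of_conj b hc with rfl | rfl <;> simp
  have hcard : (Finset.univ.filter fun s => s * torusHom b e = torusHom b e * s).card =
      Fintype.card Eˣ := by
    rw [← Finset.card_univ, ← Finset.card_image_of_injective _ (torusHom_injective b)]
    congr 1
    ext s
    simp only [Finset.mem_filter, Finset.mem_univ, true_and, Finset.mem_image]
    constructor
    · intro hs
      obtain ⟨k, rfl⟩ := exists_eq_torusHom b he hs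
      exact ⟨k, rfl⟩
    · rintro ⟨k, rfl⟩
      rw [← map_mul, mul_comm, map_mul]
  have hcard' : (Finset.univ.filter fun s =>
      s * torusHom b e = torusHom b (e ^ Fintype.card F) * s).card = Fintype.card Eˣ := by
    rw [← hcard]
    refine Finset.card_nbij' (fun s => s₀⁻¹ * s) (fun s => s₀ * s) ?_ ?_
      (fun s _ => mul_inv_cancel_left s₀ s) (fun s _ => inv_mul_cancel_left s₀ s)
    · intro s hs
      simp only [Finset.coe_filter, Finset.mem_univ, true_and, Set.mem_ofPred_eq] at hs ⊢
      rw [mul_assoc, hs, ← mul_assoc, ← mul_assoc]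
      congr 1
      rw [inv_mul_eq_iff_eq_mul, ← mul_assoc, hs₀, mul_assoc, mul_inv_cancel, mul_one]
    · intro s hs
      simp only [Finset.coe_filter, Finset.mem_univ, true_and, Set.mem_ofPred_eq] at hs ⊢
      rw [mul_assoc, hs, ← mul_assoc, hs₀, mul_assoc]
  rw [character_coind]
  simp only [h1, Finset.sum_add_distrib]
  rw [← Finset.sum_filter, ← Finset.sum_filter, Finset.sum_const, Finset.sum_const, hcard,
    hcard']
  simp only [nsmul_eq_mul, ← mul_add]
  rw [inv_mul_cancel_left₀]
  simp

theorem character_torus_upper (ν : Eˣ →* ℂˣ) (a : Fˣ) {x : F} (hx : x ≠ 0) :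
    (coind (torusHom b) (charRep (toC ν))).character (upper a a x) = 0 := by
  apply character_coind_eq_zero
  intro s e h
  have h' : s⁻¹ * torusHom b e = upper a a x * s⁻¹ := by
    rw [inv_mul_eq_iff_eq_mul, ← mul_assoc, h, mul_assoc, mul_inv_cancel, mul_one]
  obtain ⟨c, rfl⟩ := exists_eq_inc b h' (upper_mem_borel _ _ _)
  rw [torusHom_inc, ← upper_scalar_comm] at h
  have := mul_left_cancel h
  rw [upper_inj] at this
  exact hx this.2.2

omit [Finite E] in
theorem character_zn_torus (ψ : AddChar F ℂ) (ω : Fˣ →* ℂ) {e : Eˣ}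
    (he : ∀ a, e ≠ inc F E a) :
    (coind (znHom F) (charRep (ω.coprod ψ.toMonoidHom))).character (torusHom b e) = 0 := by
  apply character_coind_eq_zero
  intro s h hs
  obtain ⟨a, ha⟩ := exists_eq_inc b hs (upper_mem_borel _ _ _)
  exact he a ha

omit [Finite E] in
theorem character_principal_torus (μ₁ μ₂ : Fˣ →* ℂˣ) {e : Eˣ} (he : ∀ a, e ≠ inc F E a) :
    (principal μ₁ μ₂).character (torusHom b e) = 0 := by
  apply character_coind_eq_zero
  intro s h hs
  obtain ⟨a, ha⟩ := exists_eq_inc b hs h.2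
  exact he a ha

omit [Fintype F] in
theorem znHom_one (a : Fˣ) : znHom F (a, 1) = upper a a 0 := by
  change upper a a (a * 0) = _
  rw [mul_zero]

theorem pair_torus (ν : Eˣ →* ℂˣ) (f : GL (Fin 2) F → ℂ) (hf : ∀ g s, f (s * g * s⁻¹) = f g) :
    pair (coind (torusHom b) (charRep (toC ν))).character f =
      avg fun e => (ν e : ℂ) * f (torusHom b e) :=
  pair_coind _ _ _ hf

-- Elements of Eˣ outside Fˣ are not conjugate into B, so only Fˣ contributes. The principal series
-- has value (q + 1)μ₁μ₂ on scalars, which cancels the index.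
open Classical in
theorem pair_torus_principal (ν : Eˣ →* ℂˣ) (μ₁ μ₂ : Fˣ →* ℂˣ) :
    pair (coind (torusHom b) (charRep (toC ν))).character (principal μ₁ μ₂).character =
      if resF F ν * μ₁ * μ₂ = 1 then 1 else 0 := by
  rw [pair_torus b _ _ fun g s => char_conj _ _ _, avg_units_of_support b]
  · have h (a : Fˣ) : (ν (inc F E a) : ℂ) * (principal μ₁ μ₂).character (torusHom b (inc F E a)) =
        ((Fintype.card F : ℂ) + 1) * ((resF F ν * μ₁ * μ₂) a : ℂˣ) := by
      rw [torusHom_inc, ← znHom_one, character_principal_znHom]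
      simp [resF]
      ring
    simp only [h, avg_mul_left, avg_character]
    rw [inv_mul_cancel_left₀ card_F_add_one_ne_zero]
  · intro e he
    rw [character_principal_torus b _ _ he, mul_zero]

open Classical in
theorem pair_torus_zn {ψ : AddChar F ℂ} (hψ : ψ ≠ 1) (ν : Eˣ →* ℂˣ) (ω : Fˣ →* ℂˣ) :
    pair (coind (torusHom b) (charRep (toC ν))).character
      (coind (znHom F) (charRep ((toC ω).coprod ψ.toMonoidHom))).character =
      if resF F ν * ω = 1 then (Fintype.card F : ℂ) - 1 else 0 := by
  rw [pair_torus b _ _ fun g s => char_conj _ _ _, avg_units_of_support b]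
  · have h (a : Fˣ) : (ν (inc F E a) : ℂ) * (coind (znHom F) (charRep ((toC ω).coprod
        ψ.toMonoidHom))).character (torusHom b (inc F E a)) =
        ((Fintype.card F : ℂ) + 1) * ((Fintype.card F - 1) * ((resF F ν * ω) a : ℂˣ)) := by
      rw [torusHom_inc, ← znHom_one, character_zn_znHom hψ]
      simp [resF, toC]
      ring
    simp only [h, avg_mul_left, avg_character]
    rw [inv_mul_cancel_left₀ card_F_add_one_ne_zero]
    simp
  · intro e he
    rw [character_zn_torus b _ _ he, mul_zero]

omit [Fintype F] [Finite E] in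
theorem det_torusHom (e : Eˣ) :
    GeneralLinearGroup.det (torusHom b e) = Units.map (Algebra.norm F : E →* F) e := by
  ext
  simp [coe_torusHom, Algebra.norm_eq_matrix_det b]

open Classical in
theorem pair_torus_chi (ν : Eˣ →* ℂˣ) (μ : Fˣ →* ℂˣ) :
    pair (coind (torusHom b) (charRep (toC ν))).character (chi μ).character =
      if ν * μ.comp (Units.map (Algebra.norm F : E →* F)) = 1 then 1 else 0 := by
  rw [pair_torus b _ _ fun g s => char_conj _ _ _, ← avg_character]
  simp [character_chi, det_torusHom]

open Classical in
theorem pair_torus_torus (ν ν' : Eˣ →* ℂˣ) :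
    pair (coind (torusHom b) (charRep (toC ν))).character
      (coind (torusHom b) (charRep (toC ν'))).character =
      (if resF F ν * resF F ν' = 1 then (Fintype.card F : ℂ) - 2 else 0) +
      (if ν * ν' = 1 then 1 else 0) + if ν * ν' ^ Fintype.card F = 1 then 1 else 0 := by
  rw [pair_torus b _ _ fun g s => char_conj _ _ _]
  -- The formula ν' + ν'^q, valid off Fˣ, is extended to all of Eˣ. The correction on Fˣ has
  -- coefficient q² - q - 2 = (q + 1)(q - 2), and the index absorbs q + 1.
  have h (e : Eˣ) : (ν e : ℂ) * (coind (torusHom b) (charRep (toC ν'))).character (torusHom b e) =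
      (if ∃ a, e = inc F E a then
        ((Fintype.card F : ℂ) + 1) * ((Fintype.card F - 2) * ((ν * ν') e : ℂˣ)) else 0) +
      ((ν * ν') e : ℂˣ) + ((ν * ν' ^ Fintype.card F) e : ℂˣ) := by
    split_ifs with he
    · obtain ⟨a, rfl⟩ := he
      rw [character_torus_inc]
      have : inc F E a ^ Fintype.card F = inc F E a := by
        rw [← map_pow]
        congr 1
        ext
        rw [Units.val_pow_eq_pow_val, FiniteField.pow_card]
      simp only [resF, MonoidHom.comp_apply, MonoidHom.mul_apply, MonoidHom.pow_apply,
        Units.val_mul, ← map_pow ν', this]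
      ring
    · rw [character_torus_of_ne b ν' fun a ha => he ⟨a, ha⟩]
      simp [mul_add]
  have h2 (f f' : Eˣ → ℂ) : avg (fun a => f a + f' a) = avg f + avg f' := avg_add f f'
  simp only [h, h2, avg_character]
  congr 2
  rw [avg_units_of_support b _ fun e he => if_neg fun ⟨a, ha⟩ => he a ha]
  have h3 (a : Fˣ) : ∃ a', inc F E a = inc F E a' := ⟨a, rfl⟩
  simp only [h3, if_true, avg_mul_left]
  rw [inv_mul_cancel_left₀ card_F_add_one_ne_zero]
  have h4 (a : Fˣ) : (ν * ν') (inc F E a) = (resF F ν * resF F ν') a := rfl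
  simp only [h4, avg_character]
  simp

end TorusValues

/-! ### Identities in the group of characters of a unit group. -/

section UnitCharacters

variable {A : Type*} [Field A]

theorem unitsChar_mul_inv (ν : Aˣ →* ℂˣ) : ν * ν⁻¹ = 1 := mul_inv_cancel ν

theorem unitsChar_inv_mul (ν : Aˣ →* ℂˣ) : ν⁻¹ * ν = 1 := inv_mul_cancel ν

theorem unitsChar_inv_inv (ν : Aˣ →* ℂˣ) : ν⁻¹⁻¹ = ν := inv_inv ν

theorem unitsChar_mul_inv_eq_one {ν ν' : Aˣ →* ℂˣ} : ν * ν'⁻¹ = 1 ↔ ν = ν' := by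
  refine ⟨fun h => MonoidHom.ext fun a => ?_, fun h => h ▸ unitsChar_mul_inv ν⟩
  exact mul_inv_eq_one.1 (DFunLike.congr_fun h a)

theorem unitsChar_mul_inv_pow (ν : Aˣ →* ℂˣ) (n : ℕ) : ν * ν⁻¹ ^ n = 1 ↔ ν ^ n = ν := by
  have h : ν⁻¹ ^ n = (ν ^ n)⁻¹ := inv_pow ν n
  rw [h, unitsChar_mul_inv_eq_one, eq_comm]

end UnitCharacters

/-! ### Cuspidal characters and existence of cuspidal representations. -/

section Cuspidal

variable {F : Type*} [Field F] [Fintype F] {E : Type*} [Field E] [Algebra F E] [Finite E]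
  (b : Module.Basis (Fin 2) F E)

theorem check_principal (μ₁ μ₂ : Fˣ →* ℂˣ) :
    check (principal μ₁ μ₂).character = (principal μ₁⁻¹ μ₂⁻¹).character :=
  check_character_coind _ _ _ fun h => by simp [borelChar, toC]

omit [Fintype F] in
theorem check_chi (μ : Fˣ →* ℂˣ) : check (chi μ).character = (chi μ⁻¹).character := by
  ext g; simp [check, character_chi]

/-- The character of `Ind_{ZN}^G ν_ψ`. -/
def znChar (ψ : AddChar F ℂ) (ν : Eˣ →* ℂˣ) : GL (Fin 2) F → ℂ :=
  (coind (znHom F) (charRep (nuPsi ψ ν))).character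

/-- The character of `Ind_{Eˣ}^G ν`. -/
def torusChar (ν : Eˣ →* ℂˣ) : GL (Fin 2) F → ℂ :=
  (coind (torusHom b) (charRep (toC ν))).character

omit [Finite E] in
theorem check_znChar (ψ : AddChar F ℂ) (ν : Eˣ →* ℂˣ) :
    check (znChar ψ ν) = znChar ψ⁻¹ ν⁻¹ :=
  check_character_coind _ _ _ fun h => by
    simp [nuPsi, toC, resF, AddChar.inv_apply]

theorem check_torusChar (ν : Eˣ →* ℂˣ) : check (torusChar b ν) = torusChar b ν⁻¹ :=
  check_character_coind _ _ _ fun h => by simp [toC]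

/-- The virtual character `Ind_{ZN}^G ν_ψ - Ind_{Eˣ}^G ν`. -/
def cuspidalChar (ψ : AddChar F ℂ) (ν : Eˣ →* ℂˣ) : GL (Fin 2) F → ℂ :=
  znChar ψ ν - torusChar b ν

theorem check_cuspidalChar (ψ : AddChar F ℂ) (ν : Eˣ →* ℂˣ) :
    check (cuspidalChar b ψ ν) = cuspidalChar b ψ⁻¹ ν⁻¹ := by
  rw [cuspidalChar, cuspidalChar, ← check_torusChar, ← check_znChar]; rfl

omit [Finite E] in
open Classical in
theorem pair_znChar_znChar {ψ ψ' : AddChar F ℂ} (hψ : ψ ≠ 1) (hψ' : ψ' ≠ 1) (ν ν' : Eˣ →* ℂˣ) :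
    pair (znChar ψ ν) (znChar ψ' ν') =
      if resF F ν * resF F ν' = 1 then (Fintype.card F : ℂ) else 0 :=
  pair_zn_zn hψ hψ' _ _

open Classical in
theorem pair_torusChar_znChar {ψ : AddChar F ℂ} (hψ : ψ ≠ 1) (ν ν' : Eˣ →* ℂˣ) :
    pair (torusChar b ν) (znChar ψ ν') =
      if resF F ν * resF F ν' = 1 then (Fintype.card F : ℂ) - 1 else 0 :=
  pair_torus_zn b hψ _ _

-- When the central characters match, the contributions are q - 2(q - 1) + (q - 2) = 0. Only the
-- comparison of ν' with its Galois conjugate on Eˣ survives, and it does not involve the additive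
-- characters.
open Classical in
theorem pair_cuspidalChar {ψ ψ' : AddChar F ℂ} (hψ : ψ ≠ 1) (hψ' : ψ' ≠ 1) (ν ν' : Eˣ →* ℂˣ) :
    pair (cuspidalChar b ψ ν) (cuspidalChar b ψ' ν') =
      (if ν * ν' = 1 then 1 else 0) + if ν * ν' ^ Fintype.card F = 1 then 1 else 0 := by
  rw [cuspidalChar, cuspidalChar, pair_sub_left, pair_sub_right, pair_sub_right,
    pair_znChar_znChar hψ hψ', pair_torusChar_znChar b hψ', pair_comm (znChar ψ ν),
    pair_torusChar_znChar b hψ, torusChar, torusChar, pair_torus_torus, mul_comm (resF F ν')]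
  split_ifs <;> ring

omit [Fintype F] in
theorem addChar_inv_ne_one {ψ : AddChar F ℂ} (hψ : ψ ≠ 1) : ψ⁻¹ ≠ 1 := _root_.inv_ne_one.2 hψ

omit [Fintype F] [Finite E] in
include b in
theorem resF_norm (μ : Fˣ →* ℂˣ) :
    resF F (μ.comp (Units.map (Algebra.norm F : E →* F))) = μ * μ := by
  ext a
  have : Units.map (Algebra.norm F : E →* F) (inc F E a) = a * a := by
    ext
    simp [Algebra.norm_algebraMap_of_basis b, pow_two]
  change ((μ (Units.map (Algebra.norm F : E →* F) (inc F E a)) : ℂˣ) : ℂ) = _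
  rw [this]; simp

include b in
theorem norm_units (e : Eˣ) :
    inc F E (Units.map (Algebra.norm F : E →* F) e) = e * e ^ Fintype.card F := by
  ext
  exact algebraMap_norm b (e : E)

omit [Finite E] in
theorem norm_comp_pow (μ : Fˣ →* ℂˣ) :
    (μ.comp (Units.map (Algebra.norm F : E →* F))) ^ Fintype.card F =
      μ.comp (Units.map (Algebra.norm F : E →* F)) := by
  ext e
  simp only [MonoidHom.pow_apply, MonoidHom.comp_apply, ← map_pow]
  congr 2
  rw [map_pow]
  ext
  rw [Units.val_pow_eq_pow_val, FiniteField.pow_card]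

-- This is Hilbert 90 for characters: ν factors through the norm exactly when it is fixed by
-- Frobenius. For a generator g of Eˣ, an element gᵏ of norm 1 has (q - 1) ∣ k, and a
-- Frobenius-fixed ν kills (q - 1)-th powers.
include b in
theorem isPrimitive_iff (ν : Eˣ →* ℂˣ) : IsPrimitive F ν ↔ ν ^ Fintype.card F ≠ ν := by
  rw [IsPrimitive, not_iff_not]
  constructor
  · rintro ⟨μ, rfl⟩
    exact norm_comp_pow μ
  · intro hν
    have hq : 1 ≤ Fintype.card F := Fintype.card_pos
    have hν' (e : Eˣ) : ν e ^ (Fintype.card F - 1) = 1 := by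
      have h1 : ν e ^ Fintype.card F = ν e := DFunLike.congr_fun hν e
      rw [← Nat.sub_add_cancel hq, pow_succ] at h1
      exact mul_eq_right.1 h1
    have hsurj := FiniteField.unitsMap_norm_surjective F E
    obtain ⟨g, hg⟩ := IsCyclic.exists_zpow_surjective (G := Eˣ)
    have hord : orderOf g = (Fintype.card F - 1) * (Fintype.card F + 1) := by
      rw [orderOf_eq_card_of_forall_mem_zpowers hg, Nat.card_units, card_E b]
      zify [hq, Nat.one_le_pow 2 _ hq]
      ring
    have hker (e : Eˣ) (he : e ∈ (Units.map (Algebra.norm F : E →* F)).ker) : e ∈ ν.ker := by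
      obtain ⟨k, rfl⟩ := hg e
      have h1 := norm_units b (g ^ k)
      rw [MonoidHom.mem_ker.1 he, map_one, ← pow_succ', ← zpow_natCast, ← _root_.zpow_mul, eq_comm,
        ← orderOf_dvd_iff_zpow_eq_one, hord] at h1
      push_cast at h1
      obtain ⟨m, rfl⟩ := Int.dvd_of_mul_dvd_mul_right (by positivity) h1
      rw [MonoidHom.mem_ker, map_zpow, _root_.zpow_mul, zpow_natCast, hν', _root_.one_zpow]
    refine ⟨MonoidHom.liftOfSurjective _ hsurj ⟨ν, hker⟩, ?_⟩
    ext e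
    simp

theorem irreducible_of_cuspidalChar {V : Type*} [AddCommGroup V] [Module ℂ V]
    [FiniteDimensional ℂ V] {ρ : Representation ℂ (GL (Fin 2) F) V} {ψ : AddChar F ℂ}
    (hψ : ψ ≠ 1) {ν : Eˣ →* ℂˣ} (hν : IsPrimitive F ν) (h : ρ.character = cuspidalChar b ψ ν) :
    ρ.IsIrreducible := by
  classical
  apply isIrreducible_of_pair_check
  rw [h, check_cuspidalChar, pair_cuspidalChar b hψ (addChar_inv_ne_one hψ), if_pos (unitsChar_mul_inv _), if_neg,
    add_zero]
  rw [isPrimitive_iff b] at hν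
  rwa [unitsChar_mul_inv_pow]

omit [Finite E] in
theorem IsCuspidalRep.character_eq {V : Type*} [AddCommGroup V] [Module ℂ V]
    [FiniteDimensional ℂ V] {ρ : Representation ℂ (GL (Fin 2) F) V} {ψ : AddChar F ℂ}
    {ν : Eˣ →* ℂˣ} (h : IsCuspidalRep b ψ ν ρ) : ρ.character = cuspidalChar b ψ ν := by
  obtain ⟨e⟩ := h
  have := char_iso e
  rw [character_prod] at this
  rw [cuspidalChar, znChar, this, torusChar, add_sub_cancel_right]

omit [Fintype F] [Finite E] in
theorem IsCuspidalRep.congr {V W : Type*} [AddCommGroup V] [Module ℂ V] [AddCommGroup W]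
    [Module ℂ W] {ρ : Representation ℂ (GL (Fin 2) F) V} {σ : Representation ℂ (GL (Fin 2) F) W}
    {ψ : AddChar F ℂ} {ν : Eˣ →* ℂˣ} (h : IsCuspidalRep b ψ ν ρ) (e : ρ.Equiv σ) :
    IsCuspidalRep b ψ ν σ := by
  obtain ⟨f⟩ := h
  exact ⟨f.trans (prodEquiv e (.refl _))⟩

theorem exists_isCuspidalRep {ψ : AddChar F ℂ} (hψ : ψ ≠ 1) {ν : Eˣ →* ℂˣ}
    (hν : IsPrimitive F ν) : ∃ (V : Type v) (_ : AddCommGroup V) (_ : Module ℂ V)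
      (_ : FiniteDimensional ℂ V) (ρ : Representation ℂ (GL (Fin 2) F) V),
      IsCuspidalRep b ψ ν ρ := by
  classical
  obtain ⟨C, _, _, _, κ, ⟨e⟩⟩ := exists_equiv_prod (coind (torusHom b) (charRep (toC ν)))
    (coind (znHom F) (charRep (nuPsi ψ ν))) rfl
    (by
      have h1 := char_one (coind (torusHom b) (charRep (toC ν)))
      have h2 := char_one (coind (znHom F) (charRep (nuPsi ψ ν)))
      have h3 := character_torus_inc b ν 1
      have h4 := character_zn_znHom hψ (toC (resF F ν)) 1 1
      simp only [map_one] at h3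
      rw [← Prod.one_eq_mk, map_one, toAdd_one, if_pos rfl, map_one] at h4
      have h5 : (coind (znHom F) (charRep (nuPsi ψ ν))).character 1 = _ := h4
      rw [h1] at h3
      rw [h2] at h5
      -- The dimensions are q² - 1 and q² - q, so the difference is q - 1.
      have h6 : ((Module.finrank ℂ (coindV (znHom F) (charRep (nuPsi ψ ν))) + 1 : ℕ) : ℂ) =
          ((Module.finrank ℂ (coindV (torusHom b) (charRep (toC ν))) + Fintype.card F : ℕ) : ℂ) := by
        push_cast
        rw [h3, h5]
        simp
      have h7 := Nat.cast_injective h6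
      have : 1 < Fintype.card F := Fintype.one_lt_card
      omega)
    (by
      change pair (cuspidalChar b ψ ν) (check (cuspidalChar b ψ ν)) = 1
      rw [check_cuspidalChar, pair_cuspidalChar b hψ (addChar_inv_ne_one hψ), if_pos (unitsChar_mul_inv _), if_neg,
        add_zero]
      rw [isPrimitive_iff b] at hν
      rwa [unitsChar_mul_inv_pow])
  -- The constructed space lives in the universe of the induced spaces. Moving to lifted coordinates
  -- gives a model in any universe.
  let f : C ≃ₗ[ℂ] ULift.{v} (Fin (Module.finrank ℂ C) → ℂ) :=
    (Module.finBasis ℂ C).equivFun.trans ULift.moduleEquiv.symm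
  exact ⟨_, inferInstance, inferInstance, inferInstance, transport κ f,
    IsCuspidalRep.congr b (ρ := κ) ⟨e⟩ (transportEquiv κ f)⟩

/-- For non-primitive ν nothing new appears. With I, χ, C the three characters, the pairings are I·I
= 2, I·χ = 1, χ·χ = 1, I·C = 0, χ·C = -1, C·C = 2, each with `check` on one side. Hence I - 2χ - C
has norm 2 + 4 + 2 - 4 - 4 = 0. -/
theorem cuspidalChar_norm {ψ : AddChar F ℂ} (hψ : ψ ≠ 1) (μ : Fˣ →* ℂˣ) :
    cuspidalChar b ψ (μ.comp (Units.map (Algebra.norm F : E →* F))) =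
      (principal μ μ).character - (2 : ℂ) • (chi μ).character := by
  classical
  set ν := μ.comp (Units.map (Algebra.norm F : E →* F)) with hν
  rw [eq_comm, ← sub_eq_zero]
  have hν' : ν⁻¹ = μ⁻¹.comp (Units.map (Algebra.norm F : E →* F)) := by
    ext; simp [hν]
  have hr : resF F ν = μ * μ := resF_norm b μ
  have hr' : resF F ν⁻¹ = μ⁻¹ * μ⁻¹ := by rw [hν', resF_norm b]
  have hψ' := addChar_inv_ne_one hψ
  apply eq_zero_of_pair_check_eq_zero
  · intro g
    simp [cuspidalChar, znChar, torusChar, character_inv, Complex.conj_ofNat]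
  · have hc : check ((principal μ μ).character - (2 : ℂ) • (chi μ).character -
        cuspidalChar b ψ ν) = (principal μ⁻¹ μ⁻¹).character - (2 : ℂ) • (chi μ⁻¹).character -
        cuspidalChar b ψ⁻¹ ν⁻¹ := by
      rw [← check_principal, ← check_chi, ← check_cuspidalChar]; rfl
    have hIC (μ : Fˣ →* ℂˣ) (ν : Eˣ →* ℂˣ) {ψ : AddChar F ℂ} (hψ : ψ ≠ 1) :
        pair (cuspidalChar b ψ ν) (principal μ μ).character = 0 := by
      rw [cuspidalChar, pair_sub_left, torusChar, pair_torus_principal, znChar, nuPsi,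
        pair_zn_principal hψ, sub_self]
    have hχC (μ : Fˣ →* ℂˣ) {ψ : AddChar F ℂ} (hψ : ψ ≠ 1) :
        pair (cuspidalChar b ψ (μ.comp (Units.map (Algebra.norm F : E →* F))))
          (chi μ⁻¹).character = -1 := by
      rw [cuspidalChar, pair_sub_left, torusChar, pair_torus_chi, znChar, nuPsi,
        pair_zn_chi hψ, if_pos]
      · simp
      · ext; simp
    have hCC : pair (cuspidalChar b ψ ν) (cuspidalChar b ψ⁻¹ ν⁻¹) = 2 := by
      rw [pair_cuspidalChar b hψ hψ', if_pos (unitsChar_mul_inv _), if_pos]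
      · norm_num
      · rw [unitsChar_mul_inv_pow, norm_comp_pow]
    have hχC' : pair (cuspidalChar b ψ⁻¹ ν⁻¹) (chi μ).character = -1 := by
      have := hχC μ⁻¹ hψ'
      rwa [← hν', unitsChar_inv_inv] at this
    rw [hc]
    simp only [pair_sub_left, pair_sub_right, pair_smul_left, pair_smul_right]
    rw [pair_comm _ (cuspidalChar b ψ⁻¹ ν⁻¹), pair_comm _ (cuspidalChar b ψ⁻¹ ν⁻¹),
      pair_comm (chi μ).character (principal _ _).character,
      hIC _ _ hψ, hIC _ _ hψ', hχC _ hψ, hχC', hCC, pair_principal_principal, pair_chi_chi,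
      pair_principal_chi, pair_principal_chi]
    simp [unitsChar_mul_inv, unitsChar_inv_mul]
    norm_num

end Cuspidal

/-! ### Steinberg characters and irreducibility of the non-cuspidal families. -/

section Steinberg

variable {F : Type*} [Field F] [Fintype F]

omit [Fintype F] in
theorem detVec_ne_zero (μ : Fˣ →* ℂˣ) : detVec μ ≠ 0 := by
  intro h0
  have : ((μ (GeneralLinearGroup.det (1 : GL (Fin 2) F)) : ℂˣ) : ℂ) = 0 :=
    congrFun (congrArg Subtype.val h0) 1
  simp at this

theorem character_quotient_span_singleton {G V : Type*} [Group G] [Finite G] [AddCommGroup V]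
    [Module ℂ V] [FiniteDimensional ℂ V] (ρ : Representation ℂ G V) {v : V} (hv : v ≠ 0)
    (c : G → ℂ) (hc : ∀ g, ρ g v = c g • v)
    (hp : ∀ g, Submodule.span ℂ {v} ≤ (Submodule.span ℂ {v}).comap (ρ g)) :
    (ρ.quotient (Submodule.span ℂ {v}) hp).character = ρ.character - c := by
  rw [character_quotient ρ _ hp, eq_sub_iff_add_eq, add_comm]
  congr 1
  ext g
  have : ρ.subrepresentation (Submodule.span ℂ {v}) hp g = c g • LinearMap.id := by
    refine LinearMap.ext fun ⟨x, hx⟩ => Subtype.ext ?_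
    obtain ⟨a, rfl⟩ := Submodule.mem_span_singleton.1 hx
    change ρ g (a • v) = c g • a • v
    rw [map_smul, hc, smul_comm]
  rw [character, this, map_smul, LinearMap.trace_id, finrank_span_singleton hv]
  simp

theorem character_steinberg (μ : Fˣ →* ℂˣ) :
    (steinberg μ).character = (principal μ μ).character - (chi μ).character := by
  rw [show (chi μ).character = _ from funext (character_chi μ)]
  exact character_quotient_span_singleton _ (detVec_ne_zero μ) _ (principal_detVec μ) _

open Classical in
theorem pair_steinberg (μ μ' : Fˣ →* ℂˣ) :
    pair (steinberg μ).character (steinberg μ').character = if μ * μ' = 1 then 1 else 0 := by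
  simp only [character_steinberg, pair_sub_left, pair_sub_right]
  rw [pair_comm (chi μ).character (principal _ _).character, pair_principal_principal,
    pair_principal_chi, pair_principal_chi, pair_chi_chi, mul_comm μ' μ]
  split_ifs <;> simp_all

theorem check_steinberg (μ : Fˣ →* ℂˣ) :
    check (steinberg μ).character = (steinberg μ⁻¹).character := by
  rw [character_steinberg, character_steinberg, ← check_principal, ← check_chi]; rfl

theorem steinberg_isIrreducible (μ : Fˣ →* ℂˣ) : (steinberg μ).IsIrreducible := by
  classical
  apply isIrreducible_of_pair_check
  rw [check_steinberg, pair_steinberg, if_pos (unitsChar_mul_inv μ)]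

theorem chi_isIrreducible (μ : Fˣ →* ℂˣ) : (chi μ).IsIrreducible := by
  classical
  apply isIrreducible_of_pair_check
  rw [check_chi, pair_chi_chi, if_pos (unitsChar_mul_inv μ)]

theorem principal_isIrreducible {μ₁ μ₂ : Fˣ →* ℂˣ} (h : μ₁ ≠ μ₂) :
    (principal μ₁ μ₂).IsIrreducible := by
  classical
  apply isIrreducible_of_pair_check
  rw [check_principal, pair_principal_principal,
    if_pos ⟨unitsChar_mul_inv μ₁, unitsChar_mul_inv μ₂⟩, if_neg, add_zero]
  rintro ⟨h1, -⟩
  exact h (unitsChar_mul_inv_eq_one.1 h1)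

end Steinberg

/-! ### Whittaker coefficients and completeness of the list. -/

section Classification

variable {F : Type*} [Field F] [Fintype F] {E : Type*} [Field E] [Algebra F E] [Finite E]
  (b : Module.Basis (Fin 2) F E)

/-- Orthogonality in the dual variable leaves only the identity. The number of characters is kept as
a symbol: below it is enough that it is nonzero. -/
theorem sum_characters {H : Type*} [CommGroup H] [Finite H] [Fintype (H →* ℂˣ)] (f : H → ℂ) :
    ∑ ν : H →* ℂˣ, avg (fun h => (ν h : ℂ) * f h) =
      Fintype.card (H →* ℂˣ) / Nat.card H * f 1 := by
  classical
  cases nonempty_fintype H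
  have h0 (h : H) (hh : h ≠ 1) : ∑ ν : H →* ℂˣ, (ν h : ℂ) = 0 := by
    obtain ⟨ν₀, hν₀⟩ := CommGroup.exists_apply_ne_one_of_hasEnoughRootsOfUnity H ℂ hh
    have hs : (ν₀ h : ℂ) * ∑ ν : H →* ℂˣ, (ν h : ℂ) = ∑ ν : H →* ℂˣ, (ν h : ℂ) := by
      rw [Finset.mul_sum, ← Equiv.sum_comp (Equiv.mulLeft ν₀) fun ν : H →* ℂˣ => (ν h : ℂ)]
      rfl
    by_contra hne
    exact hν₀ (Units.ext (mul_eq_right₀ hne |>.1 hs))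
  rw [← avg_finset_sum, avg_eq_sum, Finset.sum_eq_single 1]
  · simp; ring
  · intro h _ hh
    rw [Finset.sum_apply, ← Finset.sum_mul, h0 h hh, zero_mul]
  · simp

/-- The Whittaker coefficient `|F|⁻¹ ∑ ψ(x) f(1, x; 0, 1)`. -/
def whittaker (ψ : AddChar F ℂ) (f : GL (Fin 2) F → ℂ) : ℂ :=
  avg fun x : Multiplicative F => ψ x.toAdd * f (znHom F (1, x))

theorem whittaker_sub (ψ : AddChar F ℂ) (f f' : GL (Fin 2) F → ℂ) :
    whittaker ψ (f - f') = whittaker ψ f - whittaker ψ f' := by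
  simp only [whittaker, Pi.sub_apply, mul_sub]; exact avg_sub _ _

theorem whittaker_principal {ψ : AddChar F ℂ} (hψ : ψ ≠ 1) (μ₁ μ₂ : Fˣ →* ℂˣ) :
    whittaker ψ (principal μ₁ μ₂).character = 1 := by
  simp only [whittaker, character_principal_znHom, avg_addChar_mul hψ]
  simp

theorem whittaker_chi {ψ : AddChar F ℂ} (hψ : ψ ≠ 1) (μ : Fˣ →* ℂˣ) :
    whittaker ψ (chi μ).character = 0 := by
  have h (x : Multiplicative F) : (chi μ).character (znHom F (1, x)) = 1 := by
    rw [character_chi, show GeneralLinearGroup.det (znHom F (1, x)) = 1 * 1 from det_upper _ _ _]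
    simp
  simp only [whittaker, h, mul_one, avg_addChar hψ]

theorem whittaker_steinberg {ψ : AddChar F ℂ} (hψ : ψ ≠ 1) (μ : Fˣ →* ℂˣ) :
    whittaker ψ (steinberg μ).character = 1 := by
  rw [character_steinberg, whittaker_sub, whittaker_principal hψ, whittaker_chi hψ, sub_zero]

-- The ZN part contributes q and the torus part (q² - q)/q = q - 1.
open Classical in
theorem whittaker_cuspidalChar {ψ : AddChar F ℂ} (hψ : ψ ≠ 1) (ν : Eˣ →* ℂˣ) :
    whittaker ψ (cuspidalChar b ψ ν) = 1 := by
  have h1 : whittaker ψ (znChar ψ ν) = Fintype.card F := by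
    have h (x : Multiplicative F) : znChar ψ ν (znHom F (1, x)) =
        1 * ((if x.toAdd = 0 then (Fintype.card F : ℂ) ^ 2 else 0) + -1) := by
      rw [znChar, nuPsi, character_zn_znHom hψ, map_one, sub_eq_add_neg]
    simp only [whittaker, h, avg_addChar_mul hψ]
    field_simp
  have h2 (x : Multiplicative F) : torusChar b ν (znHom F (1, x)) =
      1 * ((if x.toAdd = 0 then (Fintype.card F : ℂ) ^ 2 - Fintype.card F else 0) + 0) := by
    change torusChar b ν (upper 1 1 (((1 : Fˣ) : F) * x.toAdd)) = _
    by_cases hx : x.toAdd = 0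
    · rw [hx, mul_zero, ← torusHom_inc b, torusChar, character_torus_inc]
      simp
    · rw [torusChar, character_torus_upper b ν 1 (mul_ne_zero (Units.ne_zero _) hx)]
      simp [hx]
  rw [cuspidalChar, whittaker_sub, h1]
  simp only [whittaker, h2, avg_addChar_mul hψ]
  field_simp
  ring

omit [Fintype F] in
theorem apply_unipotent_eq {f : GL (Fin 2) F → ℂ} (hf : ∀ g s, f (s * g * s⁻¹) = f g) {x : F}
    (hx : x ≠ 0) : f (upper 1 1 x) = f (upper 1 1 1) := by
  rw [← hf (upper 1 1 1) (upper (Units.mk0 x hx) 1 0)]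
  congr 1
  rw [eq_mul_inv_iff_mul_eq, upper_mul, upper_mul]
  simp

open Classical in
theorem whittaker_eq {ψ : AddChar F ℂ} (hψ : ψ ≠ 1) {f : GL (Fin 2) F → ℂ}
    (hf : ∀ g s, f (s * g * s⁻¹) = f g) :
    whittaker ψ f = (Fintype.card F : ℂ)⁻¹ * (f 1 - f (upper 1 1 1)) := by
  have h (x : Multiplicative F) : f (znHom F (1, x)) =
      1 * ((if x.toAdd = 0 then f 1 - f (upper 1 1 1) else 0) + f (upper 1 1 1)) := by
    change f (upper 1 1 (((1 : Fˣ) : F) * x.toAdd)) = _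
    by_cases hx : x.toAdd = 0
    · have : upper 1 1 (0 : F) = 1 := by simp [GL_eq_iff, coe_upper]
      simp [hx, this]
    · rw [Units.val_one, one_mul, apply_unipotent_eq hf hx]
      simp [hx]
  simp only [whittaker, h, avg_addChar_mul hψ]
  rw [one_mul]

/-- Summing the hypotheses over all characters isolates the values on N, where a class function has
only two values, f(1) and c. The principal series give f(1) + (q - 1)c = 0 and the cuspidal
differences give f(1) = (q + 1)c, so 2qc = 0. -/
theorem eq_zero_of_pair_eq_zero {ψ : AddChar F ℂ} (hψ : ψ ≠ 1) {f : GL (Fin 2) F → ℂ}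
    (hf : ∀ g s, f (s * g * s⁻¹) = f g)
    (h1 : ∀ μ₁ μ₂ : Fˣ →* ℂˣ, pair (principal μ₁ μ₂).character f = 0)
    (h2 : ∀ ν : Eˣ →* ℂˣ, pair (cuspidalChar b ψ ν) f = 0) : f 1 = 0 := by
  classical
  have : Fintype (Fˣ →* ℂˣ) := Fintype.ofFinite _
  have : Fintype (Eˣ →* ℂˣ) := Fintype.ofFinite _
  have hu1 : upper 1 1 (0 : F) = 1 := by simp [GL_eq_iff, coe_upper]
  set c := f (upper 1 1 1) with hc
  have hq := card_F_ne_zero (F := F)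
  have hq1 := card_F_sub_one_ne_zero (F := F)
  have hq2 := card_F_add_one_ne_zero (F := F)
  -- the unipotent average vanishes
  have h3 : avg (fun x : F => f (upper 1 1 x)) = 0 := by
    have hs : ∑ μ₁ : Fˣ →* ℂˣ, ∑ μ₂ : Fˣ →* ℂˣ, pair (principal μ₁ μ₂).character f = 0 := by
      simp [h1]
    simp only [pair_principal _ _ f hf] at hs
    have hin (μ₁ : Fˣ →* ℂˣ) : ∑ μ₂ : Fˣ →* ℂˣ, avg (fun a : Fˣ => avg fun d : Fˣ =>
        (μ₁ a : ℂ) * μ₂ d * avg fun x : F => f (upper a d x)) =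
        (Fintype.card (Fˣ →* ℂˣ) / Nat.card Fˣ : ℂ) * avg fun a : Fˣ => (μ₁ a : ℂ) *
          avg fun x : F => f (upper a 1 x) := by
      rw [← avg_finset_sum, ← avg_mul_left]
      congr 1; ext a
      rw [Finset.sum_apply]
      simp only [mul_assoc (μ₁ a : ℂ), avg_mul_left]
      rw [← Finset.mul_sum, sum_characters fun d => avg fun x : F => f (upper a d x)]
      ring
    simp only [hin] at hs
    rw [← Finset.mul_sum, sum_characters fun a => avg fun x : F => f (upper a 1 x)] at hs
    have hN : (Fintype.card (Fˣ →* ℂˣ) / Nat.card Fˣ : ℂ) ≠ 0 := by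
      simp
    exact (mul_eq_zero.1 ((mul_eq_zero.1 hs).resolve_left hN)).resolve_left hN
  have h4 : f 1 + (Fintype.card F - 1) * c = 0 := by
    have : ∑ x : F, f (upper 1 1 x) = f 1 + (Fintype.card F - 1) * c := by
      rw [← Finset.add_sum_erase _ _ (Finset.mem_univ 0), hu1]
      congr 1
      rw [Finset.sum_congr rfl (g := fun _ => c) fun x hx =>
        apply_unipotent_eq hf (Finset.ne_of_mem_erase hx)]
      rw [Finset.sum_const, Finset.card_erase_of_mem (Finset.mem_univ _), Finset.card_univ,
        nsmul_eq_mul, Nat.cast_sub Fintype.card_pos, Nat.cast_one]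
    rw [avg_eq_sum, this] at h3
    exact (mul_eq_zero.1 h3).resolve_left (inv_ne_zero hq)
  have h5 : (f 1 - c) * (Fintype.card F + 1) = Fintype.card F * f 1 := by
    have hs : ∑ ν : Eˣ →* ℂˣ, pair (znChar ψ ν) f = ∑ ν : Eˣ →* ℂˣ, pair (torusChar b ν) f := by
      refine Finset.sum_congr rfl fun ν _ => ?_
      have := h2 ν
      rwa [cuspidalChar, pair_sub_left, sub_eq_zero] at this
    have hN : (Fintype.card (Eˣ →* ℂˣ) : ℂ) ≠ 0 := by simp
    have hE : (Nat.card Eˣ : ℂ) = (Fintype.card F - 1) * (Fintype.card F + 1) := by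
      rw [card_units_E b]; ring
    have ht : ∑ ν : Eˣ →* ℂˣ, pair (torusChar b ν) f =
        Fintype.card (Eˣ →* ℂˣ) / Nat.card Eˣ * f 1 := by
      simp only [torusChar, pair_torus b _ f hf]
      rw [sum_characters fun e => f (torusHom b e), map_one]
    have hz : ∑ ν : Eˣ →* ℂˣ, pair (znChar ψ ν) f =
        Fintype.card (Eˣ →* ℂˣ) / Nat.card Fˣ * whittaker ψ f := by
      -- Extension by zero from Fˣ to Eˣ, so that the sum over ν, which enters only through its
      -- restriction, falls under orthogonality on Eˣ.
      let f' : Eˣ → ℂ := fun e => if h : ∃ a, e = inc F E a then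
        avg (fun x : Multiplicative F => ψ x.toAdd * f (znHom F (h.choose, x))) else 0
      have hf' (a : Fˣ) : f' (inc F E a) =
          avg (fun x : Multiplicative F => ψ x.toAdd * f (znHom F (a, x))) := by
        have h : ∃ a', inc F E a = inc F E a' := ⟨a, rfl⟩
        have h' : h.choose = a := (inc_injective h.choose_spec).symm
        simp only [f', dif_pos h, h']
      have hν (ν : Eˣ →* ℂˣ) : pair (znChar ψ ν) f =
          ((Fintype.card F : ℂ) + 1) * avg fun e => (ν e : ℂ) * f' e := by
        rw [avg_units_of_support b, ← mul_assoc, mul_inv_cancel₀ hq2, one_mul, znChar, nuPsi,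
          pair_zn _ _ f hf]
        · simp only [hf']; rfl
        · intro e he
          have : ¬ ∃ a, e = inc F E a := fun ⟨a, ha⟩ => he a ha
          simp [f', this]
      simp only [hν]
      rw [← Finset.mul_sum, sum_characters f', ← map_one (inc F E), hf', card_units_cast (F := F),
        hE, whittaker]
      field_simp
    rw [ht, hz, card_units_cast (F := F), hE, whittaker_eq hψ hf] at hs
    field_simp at hs
    linear_combination hs
  have h6 : (2 * Fintype.card F : ℂ) * c = 0 := by
    linear_combination h4 - h5
  have h7 : c = 0 := (mul_eq_zero.1 h6).resolve_left (mul_ne_zero two_ne_zero hq)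
  rw [h7, mul_zero, add_zero] at h4
  exact h4

theorem IsIrreducible_finrank_ne_zero {G V : Type*} [Group G] [AddCommGroup V] [Module ℂ V]
    [FiniteDimensional ℂ V] {ρ : Representation ℂ G V} (hρ : ρ.IsIrreducible) :
    (Module.finrank ℂ V : ℂ) ≠ 0 := by
  rw [Nat.cast_ne_zero, ← Nat.pos_iff_ne_zero, Module.finrank_pos_iff]
  by_contra h
  rw [not_nontrivial_iff_subsingleton] at h
  obtain ⟨x, y, hxy⟩ := hρ.toNontrivial
  apply hxy
  apply Subrepresentation.toSubmodule_injective
  exact Subsingleton.elim _ _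

/-- The classification of the irreducible representations of `GL(2, F)`. -/
theorem classification {ψ : AddChar F ℂ} (hψ : ψ ≠ 1) {V : Type*} [AddCommGroup V] [Module ℂ V]
    [FiniteDimensional ℂ V] {ρ : Representation ℂ (GL (Fin 2) F) V} (hρ : ρ.IsIrreducible) :
    (∃ μ : Fˣ →* ℂˣ, Nonempty (ρ.Equiv (chi μ))) ∨
    (∃ μ₁ μ₂ : Fˣ →* ℂˣ, μ₁ ≠ μ₂ ∧ Nonempty (ρ.Equiv (principal μ₁ μ₂))) ∨
    (∃ μ : Fˣ →* ℂˣ, Nonempty (ρ.Equiv (steinberg μ))) ∨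
    ∃ ν : Eˣ →* ℂˣ, IsPrimitive F ν ∧ IsCuspidalRep b ψ ν ρ := by
  by_contra! hcon
  obtain ⟨hc1, hc2, hc3, hc4⟩ := hcon
  have h1 (μ : Fˣ →* ℂˣ) : pair (chi μ).character (check ρ.character) = 0 := by
    by_contra h
    rw [pair_comm] at h
    exact not_isEmpty_iff.2 (nonempty_equiv_of_pair_ne_zero hρ (chi_isIrreducible μ) h) (hc1 μ)
  have h3 (μ : Fˣ →* ℂˣ) : pair (steinberg μ).character (check ρ.character) = 0 := by
    by_contra h
    rw [pair_comm] at h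
    exact not_isEmpty_iff.2
      (nonempty_equiv_of_pair_ne_zero hρ (steinberg_isIrreducible μ) h) (hc3 μ)
  -- For equal characters I(μ, μ) is St_μ plus χ_μ, and both are already excluded.
  have h2 (μ₁ μ₂ : Fˣ →* ℂˣ) :
      pair (principal μ₁ μ₂).character (check ρ.character) = 0 := by
    by_cases hμ : μ₁ = μ₂
    · subst hμ
      have := h3 μ₁
      rwa [character_steinberg, pair_sub_left, h1, sub_zero] at this
    · by_contra h
      rw [pair_comm] at h
      exact not_isEmpty_iff.2
        (nonempty_equiv_of_pair_ne_zero hρ (principal_isIrreducible hμ) h) (hc2 _ _ hμ)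
  have h4 (ν : Eˣ →* ℂˣ) : pair (cuspidalChar b ψ ν) (check ρ.character) = 0 := by
    by_cases hν : IsPrimitive F ν
    · obtain ⟨W, _, _, _, σ, hσ⟩ := exists_isCuspidalRep.{0} b hψ hν
      have hχ := IsCuspidalRep.character_eq b hσ
      by_contra h
      rw [pair_comm, ← hχ] at h
      obtain ⟨e⟩ := nonempty_equiv_of_pair_ne_zero hρ (irreducible_of_cuspidalChar b hψ hν hχ) h
      exact hc4 ν hν (IsCuspidalRep.congr b hσ e.symm)
    -- A non-primitive ν gives a combination of characters already treated.
    · obtain ⟨μ, rfl⟩ := not_not.1 hν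
      rw [cuspidalChar_norm b hψ, pair_sub_left, pair_smul_left, h1, h2]
      simp
  have h5 := eq_zero_of_pair_eq_zero b hψ (f := check ρ.character)
    (fun g s => by
      rw [check, check, conj_inv, char_conj]) h2 h4
  rw [check, inv_one, char_one] at h5
  exact IsIrreducible_finrank_ne_zero hρ h5

end Classification

/-! ### Eigenspaces as invariants of a twist. -/

section TwistedInvariants

variable {H V : Type*} [Group H] [AddCommGroup V] [Module ℂ V]

/-- The twist of a representation by a linear character. -/
def twist (θ : H →* ℂ) (σ : Representation ℂ H V) : Representation ℂ H V where
  toFun h := θ h • σ h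
  map_one' := by simp
  map_mul' g h := by
    refine LinearMap.ext fun v => ?_
    simp [smul_smul, mul_comm (θ g)]

theorem avg_character_eq_finrank [Finite H] [FiniteDimensional ℂ V] (τ : Representation ℂ H V) :
    avg τ.character = Module.finrank ℂ τ.invariants := by
  classical
  cases nonempty_fintype H
  let _ : Invertible (Fintype.card H : ℂ) := invertibleOfNonzero (by simp)
  rw [← (isProj_averageMap τ).trace, avg_eq_sum]
  simp [character, Representation.averageMap, GroupAlgebra.average, map_sum]

end TwistedInvariants

/-! ### Symmetry of invariant forms from multiplicity one. -/

section Symmetry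

variable {F : Type*} [Field F] [Fintype F] {V : Type*} [AddCommGroup V] [Module ℂ V]
  [FiniteDimensional ℂ V] {ρ : Representation ℂ (GL (Fin 2) F) V}

omit [Fintype F] in
theorem upper_neg_one_conj (x : Multiplicative F) :
    upper (-1) 1 0 * znHom F (1, x) * upper (-1) 1 0 = znHom F (1, x⁻¹) := by
  change upper (-1) 1 0 * upper 1 1 (((1 : Fˣ) : F) * x.toAdd) * upper (-1) 1 0 =
    upper 1 1 (((1 : Fˣ) : F) * -x.toAdd)
  simp [upper_mul]

omit [Fintype F] in
theorem upper_neg_one_sq : upper (-1) 1 0 * upper (-1) 1 (0 : F) = 1 := by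
  rw [upper_mul]
  simp [GL_eq_iff, coe_upper]

/-- An irreducible representation in which the character `ψ⁻¹` of the unipotent group occurs with
multiplicity one has no alternating invariant form. -/
theorem symmetric_of_whittaker {ψ : AddChar F ℂ} (hρ : ρ.IsIrreducible)
    (hw : whittaker ψ ρ.character = 1) {B : V →ₗ[ℂ] Module.Dual ℂ V}
    (hB : ∀ g x y, B (ρ g x) (ρ g y) = B x y) (x y : V) : B x y = B y x := by
  let z : Multiplicative F →* GL (Fin 2) F := (znHom F).comp (MonoidHom.inr Fˣ (Multiplicative F))
  -- The invariants of the twist are the vectors on which N acts through ψ⁻¹, and the average of its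
  -- character is the Whittaker coefficient.
  let τ : Representation ℂ (Multiplicative F) V := twist ψ.toMonoidHom (ρ.comp z)
  have hτ (x : Multiplicative F) (v : V) : τ x v = ψ x.toAdd • ρ (znHom F (1, x)) v := rfl
  have hfin : Module.finrank ℂ τ.invariants = 1 := by
    have h : τ.character = fun x : Multiplicative F =>
        ψ x.toAdd * ρ.character (znHom F (1, x)) := by
      ext x
      change LinearMap.trace ℂ V (ψ x.toAdd • ρ (znHom F (1, x))) = _
      rw [map_smul]; rfl
    have := avg_character_eq_finrank τ
    rw [h] at this
    exact_mod_cast this.symm.trans hw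
  obtain ⟨⟨v, hv⟩, hv0, hspan⟩ := finrank_eq_one_iff'.1 hfin
  have hv0 : v ≠ 0 := fun h => hv0 (Subtype.ext h)
  let t := ρ (upper (-1) 1 (0 : F))
  have ht (w : V) : t (t w) = w := by
    change (ρ (upper (-1) 1 (0 : F)) * ρ (upper (-1) 1 (0 : F))) w = w
    rw [← map_mul ρ, upper_neg_one_sq, map_one, Module.End.one_apply]
  let S : V →ₗ[ℂ] Module.Dual ℂ V := B - B.flip
  have hS (x y : V) : S x y = B x y - B y x := rfl
  have hSinv (g x y) : S (ρ g x) (ρ g y) = S x y := by simp only [hS, hB]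
  have hSanti (x y : V) : S x y = -S y x := by simp only [hS]; ring
  -- Since t² = 1, invariance gives S(tv, v) = S(v, tv), while skewness gives the opposite sign.
  have h0 : S v (t v) = 0 := by
    have h1 : S (t v) (t (t v)) = S v (t v) := hSinv _ _ _
    rw [ht, hSanti] at h1
    linear_combination (-1 / 2 : ℂ) * h1
  -- t turns n(x) into n(x)⁻¹. Invariance moves it onto v, where it acts by ψ(x)⁻¹ and cancels the
  -- twist.
  have h1 (x : Multiplicative F) (w : V) : S v (t w) = S v (t (τ x w)) := by
    have hx : t (ρ (znHom F (1, x)) w) = ρ (znHom F (1, x⁻¹)) (t w) := by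
      rw [← upper_neg_one_conj, map_mul ρ, map_mul ρ, Module.End.mul_apply, Module.End.mul_apply]
      exact congrArg _ (congrArg _ (ht w).symm)
    have hx' : znHom F (1, x) * znHom F (1, x⁻¹) = 1 := by
      rw [← map_mul, Prod.mk_mul_mk, mul_inv_cancel, mul_one]; exact map_one _
    have hx'' : ρ (znHom F (1, x)) (ρ (znHom F (1, x⁻¹)) (t w)) = t w := by
      rw [← Module.End.mul_apply, ← map_mul ρ, hx', map_one, Module.End.one_apply]
    rw [hτ, map_smul, map_smul, hx, ← hSinv (znHom F (1, x)) v
      (ρ (znHom F (1, x⁻¹)) (t w)), hx'',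
      ← LinearMap.smul_apply, ← map_smul, ← hτ, hv x]
  have h2 (w : V) : S v (t w) = 0 := by
    classical
    let _ : Invertible (Fintype.card (Multiplicative F) : ℂ) := invertibleOfNonzero (by simp)
    have h3 : S v (t w) = S v (t (τ.averageMap w)) := by
      have : τ.averageMap w = (Fintype.card (Multiplicative F) : ℂ)⁻¹ • ∑ x, τ x w := by
        simp [Representation.averageMap, GroupAlgebra.average, map_sum]
      rw [this, map_smul, map_smul, map_sum, map_sum]
      simp only [← h1 _ w, Finset.sum_const, Finset.card_univ]
      rw [← Nat.cast_smul_eq_nsmul ℂ, smul_smul, inv_mul_cancel₀ (by simp), one_smul]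
    -- Averaging over N projects w onto the line of v, where the previous vanishing applies.
    obtain ⟨c, hc⟩ := hspan ⟨_, τ.averageMap_invariant w⟩
    have hc : c • v = τ.averageMap w := congrArg Subtype.val hc
    rw [h3, ← hc, map_smul, map_smul, h0, smul_zero]
  -- As an intertwiner from an irreducible representation, S is injective or zero, and v ≠ 0 is in
  -- its kernel.
  let f : IntertwiningMap ρ ρ.dual := LinearMap.intertwiningMap_of_isIntertwiningMap ρ ρ.dual S
    fun g x => LinearMap.ext fun y => by
      change S (ρ g x) y = S x (ρ g⁻¹ y)
      rw [← hSinv g x, self_inv_apply]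
  have : ρ.IsIrreducible := hρ
  rcases IsIrreducible.injective_or_eq_zero f with hf | hf
  · refine absurd (hf (a₁ := v) (a₂ := 0) ?_) hv0
    rw [map_zero]
    refine LinearMap.ext fun w => ?_
    rw [← ht w]
    exact h2 (t w)
  · have : S x y = 0 := congrArg (fun f' : IntertwiningMap ρ ρ.dual => f' x y) hf
    rwa [hS, sub_eq_zero] at this

theorem indicator_eq_of_whittaker {ψ : AddChar F ℂ} (hρ : ρ.IsIrreducible)
    (hw : whittaker ψ ρ.character = 1) : indicator ρ = pair ρ.character ρ.character :=
  indicator_eq_pair_self _ fun _ hB => symmetric_of_whittaker hρ hw hB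

end Symmetry

/-! ### The indicator of an arbitrary irreducible representation. -/

section Indicator

theorem indicator_charRep {G : Type*} [Group G] [Finite G] (χ : G →* ℂ) :
    indicator (charRep χ) = pair (charRep χ).character (charRep χ).character := by
  refine indicator_eq_pair_self _ fun B _ x y => ?_
  have h (x y : ℂ) : B x y = x * (y * B 1 1) := by
    conv_lhs => rw [← mul_one x, ← mul_one y, ← smul_eq_mul, ← smul_eq_mul]
    rw [map_smul, map_smul, LinearMap.smul_apply, smul_eq_mul, smul_eq_mul]
    ring
  rw [h, h y]; ring

variable {F : Type*} [Field F] [Fintype F] {E : Type*} [Field E] [Algebra F E] [Finite E]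
  (b : Module.Basis (Fin 2) F E) {V : Type*} [AddCommGroup V] [Module ℂ V]
  [FiniteDimensional ℂ V] {ρ : Representation ℂ (GL (Fin 2) F) V}

include b in
theorem indicator_eq {ψ : AddChar F ℂ} (hψ : ψ ≠ 1) (hρ : ρ.IsIrreducible) :
    indicator ρ = pair ρ.character ρ.character := by
  rcases classification b hψ hρ with ⟨μ, ⟨e⟩⟩ | ⟨μ₁, μ₂, -, ⟨e⟩⟩ | ⟨μ, ⟨e⟩⟩ | ⟨ν, -, hν⟩
  · rw [indicator_eq_avg, char_iso e, ← indicator_eq_avg]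
    exact indicator_charRep _
  · exact indicator_eq_of_whittaker hρ (char_iso e ▸ whittaker_principal hψ μ₁ μ₂)
  · exact indicator_eq_of_whittaker hρ (char_iso e ▸ whittaker_steinberg hψ μ)
  · exact indicator_eq_of_whittaker hρ
      (IsCuspidalRep.character_eq b hν ▸ whittaker_cuspidalChar b hψ ν)

end Indicator

/-! ### Characters of order at most two. -/

section QuadraticCharacters

theorem unitsChar_eq_inv {A : Type*} [Field A] {μ₁ μ₂ : Aˣ →* ℂˣ} (h : μ₁ * μ₂ = 1) :
    μ₂ = μ₁⁻¹ :=
  MonoidHom.ext fun a => eq_inv_of_mul_eq_one_right (DFunLike.congr_fun h a)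

theorem unitsChar_one_mul_one {A : Type*} [Field A] : (1 : Aˣ →* ℂˣ) * 1 = 1 :=
  MonoidHom.ext fun _ => mul_one 1

theorem unitsChar_mul_self_iff {A : Type*} [Field A] [Finite A] (h : Odd (Nat.card Aˣ))
    (μ : Aˣ →* ℂˣ) : μ * μ = 1 ↔ μ = 1 := by
  refine ⟨fun hμ => MonoidHom.ext fun a => ?_, by rintro rfl; exact unitsChar_one_mul_one⟩
  have h1 : μ a ^ 2 = 1 := (pow_two _).trans (DFunLike.congr_fun hμ a)
  have h2 : μ a ^ Nat.card Aˣ = 1 := by rw [← map_pow, pow_card_eq_one', map_one]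
  obtain ⟨k, hk⟩ := h
  rwa [hk, pow_succ, pow_mul, h1, one_pow, one_mul] at h2

variable {F : Type*} [Field F] [Fintype F]

theorem odd_card_units (h : Even (Fintype.card F)) : Odd (Nat.card Fˣ) := by
  classical
  rw [Nat.card_eq_fintype_card, Fintype.card_units]
  exact Nat.Even.sub_odd Fintype.card_pos h odd_one

theorem unitsChar_mul_self_iff_of_even (h : Even (Fintype.card F)) (μ : Fˣ →* ℂˣ) :
    μ * μ = 1 ↔ μ = 1 :=
  unitsChar_mul_self_iff (odd_card_units h) μ

variable [DecidableEq F]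

theorem epsilon_of_isSquare {a : Fˣ} (h : IsSquare (a : F)) : epsilon F a = 1 := by
  ext
  have h1 : quadraticChar F (a : F) = 1 := (quadraticChar_one_iff_isSquare a.ne_zero).2 h
  simp [epsilon, h1]

theorem epsilon_of_not_isSquare {a : Fˣ} (h : ¬ IsSquare (a : F)) : epsilon F a = -1 := by
  ext
  have h1 : quadraticChar F (a : F) = -1 := quadraticChar_neg_one_iff_not_isSquare.2 h
  simp [epsilon, h1]

theorem epsilon_mul_self : epsilon F * epsilon F = 1 := by
  refine MonoidHom.ext fun a => ?_
  change epsilon F a * epsilon F a = 1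
  by_cases h : IsSquare (a : F)
  · rw [epsilon_of_isSquare h, one_mul]
  · rw [epsilon_of_not_isSquare h, neg_mul_neg, one_mul]

/-- Such a μ is 1 on squares. If it is nontrivial it is -1 at some nonsquare, hence at all of them,
as a product of two nonsquares is a square. In even characteristic every unit is a square and the
two alternatives coincide. -/
theorem unitsChar_mul_self_iff_epsilon (μ : Fˣ →* ℂˣ) :
    μ * μ = 1 ↔ μ = 1 ∨ μ = epsilon F := by
  refine ⟨fun h => ?_, ?_⟩
  · have hsq (a : Fˣ) (ha : IsSquare (a : F)) : μ a = 1 := by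
      obtain ⟨s, hs⟩ := ha
      have hs0 : s ≠ 0 := by
        rintro rfl
        exact a.ne_zero (by rw [hs, mul_zero])
      rw [show a = Units.mk0 s hs0 * Units.mk0 s hs0 from Units.ext hs, map_mul]
      exact DFunLike.congr_fun h _
    refine or_iff_not_imp_left.2 fun h1 => ?_
    obtain ⟨a, ha⟩ : ∃ a, μ a ≠ 1 := by
      by_contra! h2
      exact h1 (MonoidHom.ext h2)
    have haq : ¬ IsSquare (a : F) := fun h => ha (hsq a h)
    have ha1 : μ a = -1 := by
      have h2 : μ a * μ a = 1 := DFunLike.congr_fun h a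
      have h3 : (μ a : ℂ) * μ a = 1 := congrArg Units.val h2
      rcases mul_self_eq_one_iff.1 h3 with h4 | h4
      · exact absurd (Units.ext h4) ha
      · exact Units.ext h4
    refine MonoidHom.ext fun c => ?_
    by_cases hc : IsSquare (c : F)
    · rw [hsq c hc, epsilon_of_isSquare hc]
    · have hca : IsSquare ((c * a : Fˣ) : F) := by
        rw [← quadraticChar_one_iff_isSquare (Units.ne_zero _), Units.val_mul, map_mul,
          quadraticChar_neg_one_iff_not_isSquare.2 hc, quadraticChar_neg_one_iff_not_isSquare.2 haq]
        norm_num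
      have h2 := hsq _ hca
      rw [map_mul, ha1, mul_neg, mul_one] at h2
      rw [epsilon_of_not_isSquare hc, ← h2, neg_neg]
  · rintro (rfl | rfl)
    · exact unitsChar_one_mul_one
    · exact epsilon_mul_self

end QuadraticCharacters

/-! ### Which irreducible characters are real. -/

section Reality

variable {F : Type*} [Field F] [Fintype F] {E : Type*} [Field E] [Algebra F E] [Finite E]
  (b : Module.Basis (Fin 2) F E) {V : Type*} [AddCommGroup V] [Module ℂ V]
  [FiniteDimensional ℂ V] {ρ : Representation ℂ (GL (Fin 2) F) V}

include b in
theorem indicator_eq_one_of_real {ψ : AddChar F ℂ} (hψ : ψ ≠ 1) (hρ : ρ.IsIrreducible)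
    (h : HasRealCharacter ρ) : indicator ρ = 1 := by
  rw [indicator_eq b hψ hρ, pair_self_of_real ρ hρ h]

include b in
theorem indicator_eq_zero_of_not_real {ψ : AddChar F ℂ} (hψ : ψ ≠ 1) (hρ : ρ.IsIrreducible)
    (h : ¬ HasRealCharacter ρ) : indicator ρ = 0 := by
  rw [indicator_eq b hψ hρ, pair_self_of_not_real ρ hρ h]

include b in
theorem indicator_eq_of_hasRealCharacter_iff {ψ : AddChar F ℂ} (hψ : ψ ≠ 1)
    (hρ : ρ.IsIrreducible) {p : Prop} (h : HasRealCharacter ρ ↔ p) :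
    (p → indicator ρ = 1) ∧ (¬ p → indicator ρ = 0) :=
  ⟨fun hp => indicator_eq_one_of_real b hψ hρ (h.2 hp),
    fun hp => indicator_eq_zero_of_not_real b hψ hρ fun hr => hp (h.1 hr)⟩

theorem hasRealCharacter_iff_of_chi (hρ : ρ.IsIrreducible) {μ : Fˣ →* ℂˣ}
    (h : Nonempty (ρ.Equiv (chi μ))) : HasRealCharacter ρ ↔ μ * μ = 1 := by
  classical
  obtain ⟨e⟩ := h
  rw [hasRealCharacter_iff ρ hρ, char_iso e, pair_chi_chi]
  simp

theorem hasRealCharacter_iff_of_steinberg (hρ : ρ.IsIrreducible) {μ : Fˣ →* ℂˣ}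
    (h : Nonempty (ρ.Equiv (steinberg μ))) : HasRealCharacter ρ ↔ μ * μ = 1 := by
  classical
  obtain ⟨e⟩ := h
  rw [hasRealCharacter_iff ρ hρ, char_iso e, pair_steinberg]
  simp

theorem hasRealCharacter_iff_of_principal (hρ : ρ.IsIrreducible) {μ₁ μ₂ : Fˣ →* ℂˣ}
    (h : Nonempty (ρ.Equiv (principal μ₁ μ₂))) :
    HasRealCharacter ρ ↔ μ₁ * μ₂ = 1 ∨ (μ₁ * μ₁ = 1 ∧ μ₂ * μ₂ = 1) := by
  classical
  obtain ⟨e⟩ := h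
  rw [hasRealCharacter_iff ρ hρ, char_iso e, pair_principal_principal, mul_comm μ₂ μ₁]
  split_ifs <;> simp_all

omit [Fintype F] [Finite E] in
include b in
theorem norm_units_surjective [Finite E] (a : Fˣ) :
    ∃ e : Eˣ, Units.map (Algebra.norm F : E →* F) e = a := by
  have : Module.Finite F E := Module.Finite.of_basis b
  exact FiniteField.unitsMap_norm_surjective F E a

-- The character e ↦ ν(e)^(1+q) is the restriction of ν to Fˣ composed with the norm, and the norm
-- is surjective.
include b in
theorem resF_eq_one_iff (ν : Eˣ →* ℂˣ) : resF F ν = 1 ↔ ν * ν ^ Fintype.card F = 1 := by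
  have h (e : Eˣ) : (ν * ν ^ Fintype.card F) e =
      resF F ν (Units.map (Algebra.norm F : E →* F) e) := by
    change ν e * ν e ^ Fintype.card F = ν (inc F E _)
    rw [norm_units b, map_mul, map_pow]
  constructor
  · intro h1
    refine MonoidHom.ext fun e => ?_
    rw [h, h1]; rfl
  · intro h1
    refine MonoidHom.ext fun a => ?_
    obtain ⟨e, rfl⟩ := norm_units_surjective b a
    rw [← h, h1]; rfl

-- A character with ν² = 1 is fixed by Frobenius. This is immediate for q odd; for q even the group
-- Eˣ has odd order and ν = 1.
include b in
theorem IsPrimitive.mul_self_ne_one {ν : Eˣ →* ℂˣ} (hν : IsPrimitive F ν) : ν * ν ≠ 1 := by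
  rw [isPrimitive_iff b] at hν
  intro h
  apply hν
  rcases Nat.even_or_odd (Fintype.card F) with hq | ⟨k, hk⟩
  · have hodd : Odd (Nat.card Eˣ) := by
      cases nonempty_fintype E
      refine odd_card_units ?_
      rw [← Nat.card_eq_fintype_card, card_E b]
      exact hq.pow_of_ne_zero two_ne_zero
    rw [(unitsChar_mul_self_iff hodd ν).1 h]
    exact one_pow (M := Eˣ →* ℂˣ) _
  · refine MonoidHom.ext fun e => ?_
    change ν e ^ Fintype.card F = ν e
    have h1 : ν e ^ 2 = 1 := (pow_two _).trans (DFunLike.congr_fun h e)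
    rw [hk, pow_succ, pow_mul, h1, one_pow, one_mul]

/-- The pairing of the character with itself has one term for ν² = 1, impossible for primitive ν,
and one for ν^(1+q) = 1, that is, trivial restriction to Fˣ. -/
theorem hasRealCharacter_iff_of_cuspidal {ψ : AddChar F ℂ} (hψ : ψ ≠ 1) (hρ : ρ.IsIrreducible)
    {ν : Eˣ →* ℂˣ} (hν : IsPrimitive F ν) (h : IsCuspidalRep b ψ ν ρ) :
    HasRealCharacter ρ ↔ resF F ν = 1 := by
  classical
  rw [hasRealCharacter_iff ρ hρ, IsCuspidalRep.character_eq b h, pair_cuspidalChar b hψ hψ,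
    if_neg (hν.mul_self_ne_one b), resF_eq_one_iff b]
  simp

theorem IsCuspidalRep.isIrreducible {ψ : AddChar F ℂ} (hψ : ψ ≠ 1) {ν : Eˣ →* ℂˣ}
    (hν : IsPrimitive F ν) (h : IsCuspidalRep b ψ ν ρ) : ρ.IsIrreducible :=
  irreducible_of_cuspidalChar b hψ hν (h.character_eq b)

theorem nonempty_equiv_principal_swap {μ₁ μ₂ : Fˣ →* ℂˣ} (h : μ₁ ≠ μ₂) :
    Nonempty ((principal μ₁ μ₂).Equiv (principal μ₂ μ₁)) := by
  classical
  refine nonempty_equiv_of_pair_ne_zero (principal_isIrreducible h)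
    (principal_isIrreducible h.symm) ?_
  rw [check_principal, pair_principal_principal, if_neg, if_pos]
  · simp
  · exact ⟨unitsChar_inv_mul _, unitsChar_inv_mul _⟩
  · rintro ⟨h1, -⟩
    exact h.symm (unitsChar_mul_inv_eq_one.1 ((mul_comm μ₂ μ₁⁻¹).trans h1))

include b in
theorem hasRealCharacter_iff_of_even {ψ : AddChar F ℂ} (hψ : ψ ≠ 1) (hρ : ρ.IsIrreducible)
    (hq : Even (Fintype.card F)) : HasRealCharacter ρ ↔
      Nonempty (ρ.Equiv (chi (1 : Fˣ →* ℂˣ))) ∨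
      (∃ μ : Fˣ →* ℂˣ, μ ≠ 1 ∧ Nonempty (ρ.Equiv (principal μ μ⁻¹))) ∨
      Nonempty (ρ.Equiv (steinberg (1 : Fˣ →* ℂˣ))) ∨
      (∃ ν : Eˣ →* ℂˣ, IsPrimitive F ν ∧ resF F ν = 1 ∧ IsCuspidalRep b ψ ν ρ) := by
  constructor
  · intro hr
    rcases classification b hψ hρ with ⟨μ, e⟩ | ⟨μ₁, μ₂, hne, e⟩ | ⟨μ, e⟩ | ⟨ν, hν, hc⟩
    · rw [hasRealCharacter_iff_of_chi hρ e, unitsChar_mul_self_iff_of_even hq] at hr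
      exact Or.inl (hr ▸ e)
    · rw [hasRealCharacter_iff_of_principal hρ e, unitsChar_mul_self_iff_of_even hq,
        unitsChar_mul_self_iff_of_even hq] at hr
      rcases hr with hr | ⟨rfl, rfl⟩
      · obtain rfl : μ₂ = μ₁⁻¹ := unitsChar_eq_inv hr
        refine Or.inr (Or.inl ⟨μ₁, ?_, e⟩)
        rintro rfl
        exact hne (inv_one (G := Fˣ →* ℂˣ)).symm
      · exact absurd rfl hne
    · rw [hasRealCharacter_iff_of_steinberg hρ e, unitsChar_mul_self_iff_of_even hq] at hr
      exact Or.inr (Or.inr (Or.inl (hr ▸ e)))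
    · rw [hasRealCharacter_iff_of_cuspidal b hψ hρ hν hc] at hr
      exact Or.inr (Or.inr (Or.inr ⟨ν, hν, hr, hc⟩))
  · rintro (e | ⟨μ, -, e⟩ | e | ⟨ν, hν, hr, hc⟩)
    · exact (hasRealCharacter_iff_of_chi hρ e).2 (unitsChar_one_mul_one)
    · exact (hasRealCharacter_iff_of_principal hρ e).2 (Or.inl (unitsChar_mul_inv μ))
    · exact (hasRealCharacter_iff_of_steinberg hρ e).2 (unitsChar_one_mul_one)
    · exact (hasRealCharacter_iff_of_cuspidal b hψ hρ hν hc).2 hr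

theorem hasRealCharacter_iff_of_odd [DecidableEq F] {ψ : AddChar F ℂ} (hψ : ψ ≠ 1)
    (hρ : ρ.IsIrreducible) : HasRealCharacter ρ ↔
      Nonempty (ρ.Equiv (chi (1 : Fˣ →* ℂˣ))) ∨
      Nonempty (ρ.Equiv (chi (epsilon F))) ∨
      (∃ μ : Fˣ →* ℂˣ, μ ≠ 1 ∧ μ ≠ epsilon F ∧ Nonempty (ρ.Equiv (principal μ μ⁻¹))) ∨
      Nonempty (ρ.Equiv (principal 1 (epsilon F))) ∨
      Nonempty (ρ.Equiv (steinberg (1 : Fˣ →* ℂˣ))) ∨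
      Nonempty (ρ.Equiv (steinberg (epsilon F))) ∨
      (∃ ν : Eˣ →* ℂˣ, IsPrimitive F ν ∧ resF F ν = 1 ∧ IsCuspidalRep b ψ ν ρ) := by
  have hε : epsilon F * epsilon F = 1 := epsilon_mul_self
  have h1 : (1 : Fˣ →* ℂˣ) * 1 = 1 := unitsChar_one_mul_one
  constructor
  · intro hr
    rcases classification b hψ hρ with ⟨μ, e⟩ | ⟨μ₁, μ₂, hne, e⟩ | ⟨μ, e⟩ | ⟨ν, hν, hc⟩
    · rw [hasRealCharacter_iff_of_chi hρ e, unitsChar_mul_self_iff_epsilon] at hr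
      rcases hr with rfl | rfl <;> tauto
    · rw [hasRealCharacter_iff_of_principal hρ e] at hr
      -- Two distinct quadratic characters must be 1 and ε, in either order. Otherwise μ₂ = μ₁⁻¹,
      -- and μ₁ ≠ μ₂ excludes both 1 and ε.
      by_cases hs : μ₁ * μ₁ = 1 ∧ μ₂ * μ₂ = 1
      · rw [unitsChar_mul_self_iff_epsilon, unitsChar_mul_self_iff_epsilon] at hs
        rcases hs with ⟨rfl | rfl, rfl | rfl⟩
        · exact absurd rfl hne
        · tauto
        · obtain ⟨e⟩ := e
          obtain ⟨f⟩ := nonempty_equiv_principal_swap hne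
          exact Or.inr (Or.inr (Or.inr (Or.inl ⟨e.trans f⟩)))
        · exact absurd rfl hne
      · obtain hr := hr.resolve_right hs
        obtain rfl : μ₂ = μ₁⁻¹ := unitsChar_eq_inv hr
        have hn : ¬ (μ₁ * μ₁ = 1) := fun h => hne (by
          rw [← unitsChar_mul_inv_eq_one, unitsChar_inv_inv, h])
        rw [unitsChar_mul_self_iff_epsilon, not_or] at hn
        exact Or.inr (Or.inr (Or.inl ⟨μ₁, hn.1, hn.2, e⟩))
    · rw [hasRealCharacter_iff_of_steinberg hρ e, unitsChar_mul_self_iff_epsilon] at hr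
      rcases hr with rfl | rfl <;> tauto
    · rw [hasRealCharacter_iff_of_cuspidal b hψ hρ hν hc] at hr
      have : ∃ ν : Eˣ →* ℂˣ, IsPrimitive F ν ∧ resF F ν = 1 ∧ IsCuspidalRep b ψ ν ρ :=
        ⟨ν, hν, hr, hc⟩
      tauto
  · rintro (e | e | ⟨μ, -, -, e⟩ | e | e | e | ⟨ν, hν, hr, hc⟩)
    · exact (hasRealCharacter_iff_of_chi hρ e).2 h1
    · exact (hasRealCharacter_iff_of_chi hρ e).2 hε
    · exact (hasRealCharacter_iff_of_principal hρ e).2 (Or.inl (unitsChar_mul_inv μ))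
    · exact (hasRealCharacter_iff_of_principal hρ e).2 (Or.inr ⟨h1, hε⟩)
    · exact (hasRealCharacter_iff_of_steinberg hρ e).2 h1
    · exact (hasRealCharacter_iff_of_steinberg hρ e).2 hε
    · exact (hasRealCharacter_iff_of_cuspidal b hψ hρ hν hc).2 hr

end Reality

/-! ### PGL(2, F): every element is conjugate to its inverse. -/

section Projective

variable {F : Type*} [Field F]

/-- The invertible matrix `(p, q; r, -p)`. -/
def traceless (p q r : F) (h : p * p + q * r ≠ 0) : GL (Fin 2) F :=
  GeneralLinearGroup.mkOfDetNeZero !![p, q; r, -p] (by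
    rw [det_fin_two_of]
    intro h0
    exact h (by linear_combination -h0))

/-- Take x invertible with tr x = 0 and tr(gx) = 0. By Cayley–Hamilton (gx)² = -det(gx) and x² =
-det x, so gxgx = det(g) x², and x cancels. The equation tr(gx) = 0 is `h'` below, a linear
condition on (p, q, r); the cases exhibit a solution of nonzero determinant. -/
theorem exists_mul_mul_eq (g : GL (Fin 2) F) :
    ∃ x : GL (Fin 2) F, g * x * g = GeneralLinearGroup.scalar (Fin 2)
      (GeneralLinearGroup.det g) * x := by
  have key (p q r : F) (h : p * p + q * r ≠ 0)
      (h' : p * (g 0 0 - g 1 1) + q * g 1 0 + r * g 0 1 = 0) :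
      g * traceless p q r h * g = GeneralLinearGroup.scalar (Fin 2)
        (GeneralLinearGroup.det g) * traceless p q r h := by
    ext i j
    fin_cases i <;> fin_cases j <;>
      simp [traceless, GeneralLinearGroup.mkOfDetNeZero, Matrix.mul_apply, Fin.sum_univ_two,
        det_fin_two]
    · linear_combination g 0 0 * h'
    · linear_combination g 0 1 * h'
    · linear_combination g 1 0 * h'
    · linear_combination g 1 1 * h'
  by_cases hb : g 0 1 = 0
  · by_cases hc : g 1 0 = 0
    · exact ⟨_, key 0 1 1 (by simp) (by rw [hb, hc]; ring)⟩
    · exact ⟨_, key (g 1 0) (g 1 1 - g 0 0) 0 (by simpa using hc) (by ring)⟩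
  · by_cases hc : g 1 0 = 0
    · exact ⟨_, key (g 0 1) 0 (g 1 1 - g 0 0) (by simpa using hb) (by ring)⟩
    · exact ⟨_, key 0 (g 0 1) (-g 1 0) (by simpa using ⟨hb, hc⟩) (by ring)⟩

theorem exists_conj_eq_inv (k : PGL(2, F)) : ∃ y, y * k * y⁻¹ = k⁻¹ := by
  obtain ⟨g, rfl⟩ := ProjGenLinGroup.mk_surjective k
  obtain ⟨x, hx⟩ := exists_mul_mul_eq g
  refine ⟨ProjGenLinGroup.mk x, ?_⟩
  have h := congrArg ProjGenLinGroup.mk hx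
  rw [map_mul, map_mul, map_mul, ProjGenLinGroup.mk_scalar, one_mul] at h
  rw [mul_inv_eq_iff_eq_mul, eq_inv_mul_iff_mul_eq, ← mul_assoc, h]

variable [Fintype F] {V : Type*} [AddCommGroup V] [Module ℂ V] [FiniteDimensional ℂ V]

theorem hasRealCharacter_pgl (ρ : Representation ℂ PGL(2, F) V) : HasRealCharacter ρ := by
  intro k
  obtain ⟨y, hy⟩ := exists_conj_eq_inv k
  rw [← Complex.conj_eq_iff_im, ← character_inv, ← hy, char_conj]

theorem indicator_pgl {E : Type*} [Field E] [Algebra F E] [Finite E]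
    (b : Module.Basis (Fin 2) F E) {ψ : AddChar F ℂ} (hψ : ψ ≠ 1)
    {ρ : Representation ℂ PGL(2, F) V} (hρ : ρ.IsIrreducible) : indicator ρ = 1 := by
  let σ : Representation ℂ (GL (Fin 2) F) V := MonoidHom.comp ρ ProjGenLinGroup.mk
  have hσ (g : GL (Fin 2) F) : σ.character g = ρ.character (ProjGenLinGroup.mk g) := rfl
  -- Inflation along a surjection preserves all averages, hence the norm of the character and the
  -- indicator.
  have hirr : σ.IsIrreducible := by
    apply isIrreducible_of_pair_check
    rw [← pair_check_self hρ, pair, pair,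
      ← avg_comp_surjective ProjGenLinGroup.mk ProjGenLinGroup.mk_surjective]
    simp only [check, hσ, map_inv]
  rw [← indicator_eq_one_of_real b hψ hirr fun g => hasRealCharacter_pgl ρ _, indicator_eq_avg,
    indicator_eq_avg, ← avg_comp_surjective ProjGenLinGroup.mk ProjGenLinGroup.mk_surjective]
  simp only [hσ, map_pow]

end Projective

/-! ### Counting involutions. -/

section Involutions

variable {F : Type*} [Field F]

/-- The matrices of trace `0` and determinant `-1`. -/
def reflections (F : Type*) [Field F] : Set (GL (Fin 2) F) :=
  {k | k 0 0 + k 1 1 = 0 ∧ k 0 0 * k 0 0 + k 0 1 * k 1 0 = 1}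

/-- The off-diagonal entries of k² and the difference of its diagonal entries are multiples of tr k.
So either tr k = 0 or k is scalar. -/
theorem sq_eq_one_iff (k : GL (Fin 2) F) : k ^ 2 = 1 ↔ k ∈ reflections F ∨ k = 1 ∨ k = -1 := by
  rw [pow_two, GL_eq_iff, GL_eq_iff, GL_eq_iff]
  simp only [reflections, Set.mem_ofPred_eq, Units.val_mul, Matrix.mul_apply, Fin.sum_univ_two,
    Units.val_one, Units.val_neg, Matrix.one_apply_eq, Matrix.neg_apply, ne_eq, zero_ne_one,
    not_false_eq_true, Matrix.one_apply_ne, one_ne_zero, neg_zero]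
  constructor
  · rintro ⟨h1, h2, h3, h4⟩
    by_cases ht : k 0 0 + k 1 1 = 0
    · exact Or.inl ⟨ht, h1⟩
    · have hb : k 0 1 = 0 := by
        refine (mul_eq_zero.1 ?_).resolve_right ht
        linear_combination h2
      have hc : k 1 0 = 0 := by
        refine (mul_eq_zero.1 ?_).resolve_right ht
        linear_combination h3
      have hd : k 0 0 - k 1 1 = 0 := by
        refine (mul_eq_zero.1 ?_).resolve_right ht
        linear_combination h1 - h4
      have hd' : k 1 1 = k 0 0 := (sub_eq_zero.1 hd).symm
      rw [hb, zero_mul, add_zero] at h1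
      rcases mul_self_eq_one_iff.1 h1 with h | h
      · exact Or.inr (Or.inl ⟨h, hb, hc, hd'.trans h⟩)
      · exact Or.inr (Or.inr ⟨h, hb, hc, hd'.trans h⟩)
  · rintro (⟨h1, h2⟩ | ⟨h1, h2, h3, h4⟩ | ⟨h1, h2, h3, h4⟩)
    · have hd : k 1 1 = -k 0 0 := by linear_combination h1
      rw [hd]
      refine ⟨h2, ?_, ?_, ?_⟩
      · ring
      · ring
      · linear_combination h2
    · rw [h1, h2, h3, h4]; simp
    · rw [h1, h2, h3, h4]; simp

/-- A parametrization of the matrices of trace `0` and determinant `-1`. -/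
def reflectionOf : (F × Fˣ) ⊕ ({a : F // a * a = 1} × F) → GL (Fin 2) F
  | .inl (a, c) => traceless a ((1 - a * a) * (c : F)⁻¹) c (by simp)
  | .inr (a, x) => traceless a x 0 (by simp [a.2])

theorem coe_traceless (p q r : F) (h : p * p + q * r ≠ 0) :
    (traceless p q r h : Matrix (Fin 2) (Fin 2) F) = !![p, q; r, -p] := rfl

theorem reflectionOf_injective : Function.Injective (reflectionOf (F := F)) := by
  rintro (⟨a, c⟩ | ⟨⟨a, ha⟩, x⟩) (⟨a', c'⟩ | ⟨⟨a', ha'⟩, x'⟩) h <;>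
    rw [GL_eq_iff] at h <;> simp only [reflectionOf, coe_traceless] at h <;>
    simp at h
  · rw [h.1, Units.ext h.2.2.1]
  · exact absurd h.2.2.1.symm c'.ne_zero
  · obtain ⟨rfl, rfl, -⟩ := h
    rfl

theorem range_reflectionOf : Set.range (reflectionOf (F := F)) = reflections F := by
  ext k
  constructor
  · rintro ⟨⟨a, c⟩ | ⟨⟨a, ha⟩, x⟩, rfl⟩
    · simp [reflections, reflectionOf, coe_traceless]
    · simp [reflections, reflectionOf, coe_traceless, ha]
  · rintro ⟨h1, h2⟩
    have hd : k 1 1 = -k 0 0 := by linear_combination h1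
    by_cases hc : k 1 0 = 0
    · rw [hc, mul_zero, add_zero] at h2
      refine ⟨.inr (⟨k 0 0, h2⟩, k 0 1), ?_⟩
      rw [GL_eq_iff]
      simp [reflectionOf, coe_traceless, hc, hd]
    · refine ⟨.inl (k 0 0, Units.mk0 _ hc), ?_⟩
      rw [GL_eq_iff]
      have : (1 - k 0 0 * k 0 0) * (k 1 0)⁻¹ = k 0 1 := by
        rw [mul_inv_eq_iff_eq_mul₀ hc]
        linear_combination -h2
      simp [reflectionOf, coe_traceless, hd, this]

variable [Fintype F]

theorem ncard_reflections : (reflections F).ncard =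
    Fintype.card F * (Fintype.card F - 1) +
      {a : F | a * a = 1}.ncard * Fintype.card F := by
  classical
  rw [← range_reflectionOf, ← Nat.card_coe_set_eq,
    Nat.card_range_of_injective reflectionOf_injective, Nat.card_sum, Nat.card_prod, Nat.card_prod,
    Nat.card_eq_fintype_card, Nat.card_eq_fintype_card, Fintype.card_units]
  rfl

theorem two_eq_zero_of_even (h : Even (Fintype.card F)) : (2 : F) = 0 := by
  have h1 : ringChar F = 2 := FiniteField.even_card_iff_char_two.2 (Nat.even_iff.1 h)
  have h2 := ringChar.Nat.cast_ringChar (R := F)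
  rw [h1] at h2
  exact_mod_cast h2

theorem two_ne_zero_of_odd (h : Odd (Fintype.card F)) : (2 : F) ≠ 0 := by
  intro h2
  obtain ⟨k, hk⟩ := h
  have h1 := FiniteField.cast_card_eq_zero F
  rw [hk] at h1
  push_cast at h1
  rw [h2] at h1
  simp at h1

theorem card_involutions_of_even (h : Even (Fintype.card F)) :
    Nat.card {k : GL (Fin 2) F // k ^ 2 = 1 ∧ k ≠ 1} = Fintype.card F ^ 2 - 1 := by
  have h2 := two_eq_zero_of_even h
  have hneg (x : F) : -x = x := by linear_combination -x * h2
  have hs : {k : GL (Fin 2) F | k ^ 2 = 1 ∧ k ≠ 1} = reflections F \ {1} := by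
    ext k
    have h1 : (-1 : GL (Fin 2) F) = 1 := by simp [GL_eq_iff, hneg]
    rw [Set.mem_ofPred_eq, sq_eq_one_iff, h1, or_self, Set.mem_sdiff, Set.mem_singleton_iff]
    tauto
  -- In characteristic 2 the identity itself has trace 0 and determinant -1, so it must be removed
  -- from the q² matrices counted.
  have h1 : (1 : GL (Fin 2) F) ∈ reflections F := by
    simp [reflections, ← two_mul, h2]
  have ha : {a : F | a * a = 1} = {1} := by
    ext a
    simp [mul_self_eq_one_iff, hneg]
  change Nat.card {k : GL (Fin 2) F | k ^ 2 = 1 ∧ k ≠ 1} = _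
  rw [Nat.card_coe_set_eq, hs, Set.ncard_sdiff_singleton_of_mem h1, ncard_reflections, ha,
    Set.ncard_singleton, one_mul, ← Nat.mul_succ, Nat.succ_eq_add_one,
    Nat.sub_add_cancel Fintype.card_pos, pow_two]

theorem card_involutions_of_odd (h : Odd (Fintype.card F)) :
    Nat.card {k : GL (Fin 2) F // k ^ 2 = 1 ∧ k ≠ 1} =
      Fintype.card F ^ 2 + Fintype.card F + 1 := by
  have h2 := two_ne_zero_of_odd h
  have hne : (-1 : F) ≠ 1 := fun h => h2 (by linear_combination -h)
  have h1 : (1 : GL (Fin 2) F) ∉ reflections F := by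
    simp [reflections, ← two_mul, h2]
  have h1' : (-1 : GL (Fin 2) F) ∉ reflections F := by
    rintro ⟨h3, -⟩
    simp at h3
    exact h2 (by linear_combination -h3)
  have h3 : (-1 : GL (Fin 2) F) ≠ 1 := by simp [GL_eq_iff, hne]
  -- For q odd neither 1 nor -1 has trace 0, so -1 is one element beyond the q² + q matrices of
  -- trace 0 and determinant -1.
  have hs : {k : GL (Fin 2) F | k ^ 2 = 1 ∧ k ≠ 1} = insert (-1) (reflections F) := by
    ext k
    rw [Set.mem_ofPred_eq, sq_eq_one_iff, Set.mem_insert_iff]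
    constructor
    · tauto
    · rintro (rfl | hk)
      · tauto
      · exact ⟨Or.inl hk, fun h4 => h1 (h4 ▸ hk)⟩
  have ha : {a : F | a * a = 1} = {1, -1} := by
    ext a
    simp [mul_self_eq_one_iff]
  change Nat.card {k : GL (Fin 2) F | k ^ 2 = 1 ∧ k ≠ 1} = _
  rw [Nat.card_coe_set_eq, hs, Set.ncard_insert_of_notMem h1', ncard_reflections, ha,
    Set.ncard_pair hne.symm]
  obtain ⟨m, hm⟩ := Nat.exists_eq_succ_of_ne_zero (Fintype.card_ne_zero (α := F))
  rw [hm, Nat.succ_sub_one, Nat.succ_eq_add_one]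
  ring

end Involutions

end GL2FS

end

theorem mainTheorem8 {F : Type u} [Field F] [Fintype F] [DecidableEq F]
    {E : Type w} [Field E] [Algebra F E] (b : Module.Basis (Fin 2) F E)
    (ψ : AddChar F ℂ) (hψ : ψ ≠ 1) :
    -- indicators of arbitrary irreducible representations of `GL(2, F)`
    (∀ (V : Type v) [AddCommGroup V] [Module ℂ V] [FiniteDimensional ℂ V]
      (ρ : Representation ℂ (GL (Fin 2) F) V), ρ.IsIrreducible →
        GL2FS.indicator ρ ≠ -1 ∧
        (GL2FS.HasRealCharacter ρ → GL2FS.indicator ρ = 1) ∧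
        (¬ GL2FS.HasRealCharacter ρ → GL2FS.indicator ρ = 0)) ∧
    -- the indicator of each representation of the four types, `q` even
    (Even (Fintype.card F) →
      (∀ μ : Fˣ →* ℂˣ, (GL2FS.chi μ).IsIrreducible ∧
        (μ = 1 → GL2FS.indicator (GL2FS.chi μ) = 1) ∧
        (μ ≠ 1 → GL2FS.indicator (GL2FS.chi μ) = 0)) ∧
      (∀ μ₁ μ₂ : Fˣ →* ℂˣ, μ₁ ≠ μ₂ → (GL2FS.principal μ₁ μ₂).IsIrreducible ∧
        (μ₁ * μ₂ = 1 → GL2FS.indicator (GL2FS.principal μ₁ μ₂) = 1) ∧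
        (μ₁ * μ₂ ≠ 1 → GL2FS.indicator (GL2FS.principal μ₁ μ₂) = 0)) ∧
      (∀ μ : Fˣ →* ℂˣ, (GL2FS.steinberg μ).IsIrreducible ∧
        (μ = 1 → GL2FS.indicator (GL2FS.steinberg μ) = 1) ∧
        (μ ≠ 1 → GL2FS.indicator (GL2FS.steinberg μ) = 0))) ∧
    -- the indicator of each representation of the four types, `q` odd
    (Odd (Fintype.card F) →
      (∀ μ : Fˣ →* ℂˣ, (GL2FS.chi μ).IsIrreducible ∧
        ((μ = 1 ∨ μ = GL2FS.epsilon F) → GL2FS.indicator (GL2FS.chi μ) = 1) ∧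
        (¬ (μ = 1 ∨ μ = GL2FS.epsilon F) → GL2FS.indicator (GL2FS.chi μ) = 0)) ∧
      (∀ μ₁ μ₂ : Fˣ →* ℂˣ, μ₁ ≠ μ₂ → (GL2FS.principal μ₁ μ₂).IsIrreducible ∧
        ((μ₁ * μ₂ = 1 ∨ (μ₁ = 1 ∧ μ₂ = GL2FS.epsilon F) ∨ (μ₁ = GL2FS.epsilon F ∧ μ₂ = 1)) →
          GL2FS.indicator (GL2FS.principal μ₁ μ₂) = 1) ∧
        (¬ (μ₁ * μ₂ = 1 ∨ (μ₁ = 1 ∧ μ₂ = GL2FS.epsilon F) ∨ (μ₁ = GL2FS.epsilon F ∧ μ₂ = 1)) →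
          GL2FS.indicator (GL2FS.principal μ₁ μ₂) = 0)) ∧
      (∀ μ : Fˣ →* ℂˣ, (GL2FS.steinberg μ).IsIrreducible ∧
        ((μ = 1 ∨ μ = GL2FS.epsilon F) → GL2FS.indicator (GL2FS.steinberg μ) = 1) ∧
        (¬ (μ = 1 ∨ μ = GL2FS.epsilon F) → GL2FS.indicator (GL2FS.steinberg μ) = 0))) ∧
    -- cuspidal representations, any `q`
    (∀ ν : Eˣ →* ℂˣ, GL2FS.IsPrimitive F ν →
      (∃ (V : Type v) (_ : AddCommGroup V) (_ : Module ℂ V) (_ : FiniteDimensional ℂ V)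
        (ρ : Representation ℂ (GL (Fin 2) F) V), GL2FS.IsCuspidalRep b ψ ν ρ) ∧
      (∀ (V : Type v) [AddCommGroup V] [Module ℂ V] [FiniteDimensional ℂ V]
        (ρ : Representation ℂ (GL (Fin 2) F) V), GL2FS.IsCuspidalRep b ψ ν ρ →
          ρ.IsIrreducible ∧
          (GL2FS.resF F ν = 1 → GL2FS.indicator ρ = 1) ∧
          (GL2FS.resF F ν ≠ 1 → GL2FS.indicator ρ = 0))) ∧
    -- the complete list of irreducible representations with real character
    (∀ (V : Type v) [AddCommGroup V] [Module ℂ V] [FiniteDimensional ℂ V]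
      (ρ : Representation ℂ (GL (Fin 2) F) V), ρ.IsIrreducible →
        (Even (Fintype.card F) → (GL2FS.HasRealCharacter ρ ↔
          Nonempty (ρ.Equiv (GL2FS.chi (1 : Fˣ →* ℂˣ))) ∨
          (∃ μ : Fˣ →* ℂˣ, μ ≠ 1 ∧ Nonempty (ρ.Equiv (GL2FS.principal μ μ⁻¹))) ∨
          Nonempty (ρ.Equiv (GL2FS.steinberg (1 : Fˣ →* ℂˣ))) ∨
          (∃ ν : Eˣ →* ℂˣ, GL2FS.IsPrimitive F ν ∧ GL2FS.resF F ν = 1 ∧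
            GL2FS.IsCuspidalRep b ψ ν ρ))) ∧
        (Odd (Fintype.card F) → (GL2FS.HasRealCharacter ρ ↔
          Nonempty (ρ.Equiv (GL2FS.chi (1 : Fˣ →* ℂˣ))) ∨
          Nonempty (ρ.Equiv (GL2FS.chi (GL2FS.epsilon F))) ∨
          (∃ μ : Fˣ →* ℂˣ, μ ≠ 1 ∧ μ ≠ GL2FS.epsilon F ∧
            Nonempty (ρ.Equiv (GL2FS.principal μ μ⁻¹))) ∨
          Nonempty (ρ.Equiv (GL2FS.principal 1 (GL2FS.epsilon F))) ∨
          Nonempty (ρ.Equiv (GL2FS.steinberg (1 : Fˣ →* ℂˣ))) ∨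
          Nonempty (ρ.Equiv (GL2FS.steinberg (GL2FS.epsilon F))) ∨
          (∃ ν : Eˣ →* ℂˣ, GL2FS.IsPrimitive F ν ∧ GL2FS.resF F ν = 1 ∧
            GL2FS.IsCuspidalRep b ψ ν ρ)))) ∧
    -- `PGL(2, F)`
    (∀ (V : Type v) [AddCommGroup V] [Module ℂ V] [FiniteDimensional ℂ V]
      (ρ : Representation ℂ PGL(2, F) V), ρ.IsIrreducible → GL2FS.indicator ρ = 1) ∧
    -- the number of non-trivial involutions of `GL(2, F)`
    (Even (Fintype.card F) →
      Nat.card {k : GL (Fin 2) F // k ^ 2 = 1 ∧ k ≠ 1} = Fintype.card F ^ 2 - 1) ∧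
    (Odd (Fintype.card F) →
      Nat.card {k : GL (Fin 2) F // k ^ 2 = 1 ∧ k ≠ 1} =
        Fintype.card F ^ 2 + Fintype.card F + 1) := by
  have : Finite E := by
    have : Module.Finite F E := Module.Finite.of_basis b
    exact Module.finite_of_finite F
  refine ⟨fun V _ _ _ ρ hρ => ?_, fun hq => ⟨fun μ => ?_, fun μ₁ μ₂ hμ => ?_, fun μ => ?_⟩,
    fun hq => ⟨fun μ => ?_, fun μ₁ μ₂ hμ => ?_, fun μ => ?_⟩, fun ν hν =>
      ⟨GL2FS.exists_isCuspidalRep b hψ hν, fun V _ _ _ ρ hc => ?_⟩, fun V _ _ _ ρ hρ =>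
      ⟨GL2FS.hasRealCharacter_iff_of_even b hψ hρ,
        fun _ => GL2FS.hasRealCharacter_iff_of_odd b hψ hρ⟩,
    fun V _ _ _ ρ hρ => GL2FS.indicator_pgl b hψ hρ, GL2FS.card_involutions_of_even,
    GL2FS.card_involutions_of_odd⟩
  · obtain ⟨h1, h2⟩ := GL2FS.indicator_eq_of_hasRealCharacter_iff b hψ hρ Iff.rfl
    refine ⟨?_, h1, h2⟩
    by_cases h : GL2FS.HasRealCharacter ρ
    · rw [h1 h]; norm_num
    · rw [h2 h]; norm_num
  · have hirr := GL2FS.chi_isIrreducible μ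
    have h := GL2FS.hasRealCharacter_iff_of_chi hirr ⟨.refl _⟩
    rw [GL2FS.unitsChar_mul_self_iff_of_even hq] at h
    exact ⟨hirr, GL2FS.indicator_eq_of_hasRealCharacter_iff b hψ hirr h⟩
  · have hirr := GL2FS.principal_isIrreducible hμ
    have h := GL2FS.hasRealCharacter_iff_of_principal hirr ⟨.refl _⟩
    -- For q even the second alternative would make both characters trivial, against μ₁ ≠ μ₂.
    rw [GL2FS.unitsChar_mul_self_iff_of_even hq, GL2FS.unitsChar_mul_self_iff_of_even hq,
      or_iff_left fun h' => hμ (h'.1.trans h'.2.symm)] at h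
    exact ⟨hirr, GL2FS.indicator_eq_of_hasRealCharacter_iff b hψ hirr h⟩
  · have hirr := GL2FS.steinberg_isIrreducible μ
    have h := GL2FS.hasRealCharacter_iff_of_steinberg hirr ⟨.refl _⟩
    rw [GL2FS.unitsChar_mul_self_iff_of_even hq] at h
    exact ⟨hirr, GL2FS.indicator_eq_of_hasRealCharacter_iff b hψ hirr h⟩
  · have hirr := GL2FS.chi_isIrreducible μ
    have h := GL2FS.hasRealCharacter_iff_of_chi hirr ⟨.refl _⟩
    rw [GL2FS.unitsChar_mul_self_iff_epsilon] at h
    exact ⟨hirr, GL2FS.indicator_eq_of_hasRealCharacter_iff b hψ hirr h⟩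
  · have hirr := GL2FS.principal_isIrreducible hμ
    have h := GL2FS.hasRealCharacter_iff_of_principal hirr ⟨.refl _⟩
    have h' : (μ₁ * μ₁ = 1 ∧ μ₂ * μ₂ = 1) ↔
        (μ₁ = 1 ∧ μ₂ = GL2FS.epsilon F) ∨ (μ₁ = GL2FS.epsilon F ∧ μ₂ = 1) := by
      rw [GL2FS.unitsChar_mul_self_iff_epsilon, GL2FS.unitsChar_mul_self_iff_epsilon]
      constructor
      · rintro ⟨rfl | rfl, rfl | rfl⟩ <;> tauto
      · tauto
    rw [h'] at h
    exact ⟨hirr, GL2FS.indicator_eq_of_hasRealCharacter_iff b hψ hirr h⟩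
  · have hirr := GL2FS.steinberg_isIrreducible μ
    have h := GL2FS.hasRealCharacter_iff_of_steinberg hirr ⟨.refl _⟩
    rw [GL2FS.unitsChar_mul_self_iff_epsilon] at h
    exact ⟨hirr, GL2FS.indicator_eq_of_hasRealCharacter_iff b hψ hirr h⟩
  · have hirr := hc.isIrreducible b hψ hν
    exact ⟨hirr, GL2FS.indicator_eq_of_hasRealCharacter_iff b hψ hirr
      (GL2FS.hasRealCharacter_iff_of_cuspidal b hψ hirr hν hc)⟩
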